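/- Let $p$ be a prime, $k$ an algebraically closed field of characteristic $p$, $G$ a group scheme over $k$, $S$ a Dynkin diagram and $n\ge 1$ an integer, in one of the following cases: 1. $p$ arbitrary, $G=\mu_p$, $S=A_{p-1}$, $n=1$; 2. $p=2$, $G=\alpha_2$, $S=D_{2^n}$, $n\ge 2$; 3. $p=2$, $G=\alpha_2$, $S=E_8$, $n=4$; 4. $p=3$, $G=\alpha_3$, $S=E_6$, $n=2$; 5. $p=5$, $G=\alpha_5$, $S=E_8$, $n=2$. Let $A$ be a rational double point of type $S^0$: a Noetherian local $k$-algebra whose completion is isomorphic to $k[[x,y,z]]/(f)$, where $f$ is, respectively, $z^p-xy$; $z^2+x^2y+xy^{2^{n-1}}$; $z^2+x^3+y^5$; $z^2+x^3+y^4$; $z^2+x^3+y^5$. Let $B$ be a smooth point of a surface over $k$ (a two-dimensional regular local $k$-algebra with residue field $k$), with an action of $G$ on $\operatorname{Spec} B$ over $k$ whose fixed locus is, as a set, $\{\mathfrak m_B\}$, and let $\pi:\operatorname{Spec} B\to\operatorname{Spec} A$ be the quotient by $G$, i.e. $A=B^G$. Let $W_n$ denote $p$-typical Witt vectors of length $n$,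 $V$ the Verschiebung and $R$ the restriction. For a regular sequence $x,y$ in $\mathfrak m_A$ write $$H^2_{\mathfrak m_A}(W_nA)=\operatorname{Coker}\bigl(W_n(A[x^{-1}])\oplus W_n(A[y^{-1}])\to W_n(A[(xy)^{-1}])\bigr),$$ and similarly for $B$ with the images of $x,y$; let $H^2_{\mathfrak m_A}(W_nA)[\mathfrak m_A]$ be the submodule of classes annihilated by the ideal $(R^{n-1})^{-1}(\mathfrak m_A)\subset W_n(A)$. Then (for every choice of $x,y$) there is an element $e\in H^2_{\mathfrak m_A}(W_nA)[\mathfrak m_A]$ whose restriction $R^{n-1}(e)$ generates the $A$-module $H^2_{\mathfrak m_A}(A)[\mathfrak m_A]$ and which satisfies $\pi^*(e)=V^{n-1}(e')$ in $H^2_{\mathfrak m_B}(W_nB)$ for some generator $e'$ of the $B$-module $H^2_{\mathfrak m_B}(B)[\mathfrak m_B]$. -/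

import Mathlib

open scoped TensorProduct

namespace RDPWitt

noncomputable section

/-! ### Truncated Witt vectors

`W_n(R)` is Mathlib's `TruncatedWittVector p n R`, and the restriction `W_n(R) → W_m(R)` is Mathlib's
`TruncatedWittVector.truncate`. -/

section Witt

variable (p : ℕ) [hp : Fact p.Prime] (n : ℕ) {R S T : Type*} [CommRing R] [CommRing S] [CommRing T]

/-- `W_n(f) : W_n(R) → W_n(S)`, `(a₀, …, a_{n-1}) ↦ (f a₀, …, f a_{n-1})`. -/
def wittMap (f : R →+* S) : TruncatedWittVector p n R →+* TruncatedWittVector p n S :=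
  RingHom.liftOfRightInverse (WittVector.truncate n) TruncatedWittVector.out
    (fun a => TruncatedWittVector.truncateFun_out a)
    ⟨(WittVector.truncate n).comp (WittVector.map f), by
      intro a ha
      rw [WittVector.mem_ker_truncate] at ha
      rw [RingHom.mem_ker, RingHom.comp_apply, ← RingHom.mem_ker, WittVector.mem_ker_truncate]
      intro i hi
      rw [WittVector.map_coeff, ha i hi, map_zero]⟩

theorem coeff_wittMap (f : R →+* S) (a : TruncatedWittVector p n R) (i : Fin n) :
    (wittMap p n f a).coeff i = f (a.coeff i) := by
  obtain ⟨a, rfl⟩ := WittVector.truncate_surjective (p := p) n R a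
  have h : wittMap p n f (WittVector.truncate n a) = WittVector.truncate n (WittVector.map f a) :=
    RingHom.liftOfRightInverse_comp_apply _ _ _ _ a
  rw [h, WittVector.coeff_truncate, WittVector.coeff_truncate, WittVector.map_coeff]

theorem wittMap_wittMap (g : S →+* T) (f : R →+* S) (a : TruncatedWittVector p n R) :
    wittMap p n g (wittMap p n f a) = wittMap p n (g.comp f) a := by
  ext i
  simp only [coeff_wittMap, RingHom.comp_apply]

variable {p n}

theorem truncate_wittMap {m : ℕ} (h : m ≤ n) (f : R →+* S) (a : TruncatedWittVector p n R) :
    TruncatedWittVector.truncate h (wittMap p n f a)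
      = wittMap p m f (TruncatedWittVector.truncate h a) := by
  ext i
  simp only [coeff_wittMap, TruncatedWittVector.coeff_truncate]

/-- The coefficients of `V^r a` in degree `≥ r`. -/
theorem iterate_verschiebung_coeff_of_le (a : WittVector p R) (r i : ℕ) (h : r ≤ i) :
    (WittVector.verschiebung^[r] a).coeff i = a.coeff (i - r) := by
  obtain ⟨j, rfl⟩ := Nat.exists_eq_add_of_le h
  rw [Nat.add_comm r j, WittVector.iterate_verschiebung_coeff, Nat.add_sub_cancel]

/-- The iterated Verschiebung `V^{n-m} : W_m(R) → W_n(R)`,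
`(a₀, …, a_{m-1}) ↦ (0, …, 0, a₀, …, a_{m-1})`, for `m ≤ n`. -/
def wittV {m : ℕ} (h : m ≤ n) : TruncatedWittVector p m R →+ TruncatedWittVector p n R :=
  AddMonoidHom.mk'
    (fun a => WittVector.truncate n (WittVector.verschiebung^[n - m] a.out)) (by
      intro a b
      have hadd : ∀ u v : WittVector p R, WittVector.verschiebung^[n - m] (u + v)
          = WittVector.verschiebung^[n - m] u + WittVector.verschiebung^[n - m] v :=
        fun u v => iterate_map_add WittVector.verschiebung (n - m) u v
      have hsub : ∀ u v : WittVector p R,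
          WittVector.truncate m u = WittVector.truncate m v →
          WittVector.truncate n (WittVector.verschiebung^[n - m] u)
            = WittVector.truncate n (WittVector.verschiebung^[n - m] v) := by
        intro u v huv
        apply TruncatedWittVector.ext
        intro i
        rw [WittVector.coeff_truncate, WittVector.coeff_truncate]
        by_cases hi : n - m ≤ (i : ℕ)
        · rw [iterate_verschiebung_coeff_of_le _ _ _ hi, iterate_verschiebung_coeff_of_le _ _ _ hi]
          have hlt : (i : ℕ) - (n - m) < m := by have := i.2; omega
          have := congrArg (fun w => TruncatedWittVector.coeff ⟨_, hlt⟩ w) huv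
          simpa only [WittVector.coeff_truncate] using this
        · rw [WittVector.iterate_verschiebung_coeff_eq_zero _ (not_le.mp hi),
            WittVector.iterate_verschiebung_coeff_eq_zero _ (not_le.mp hi)]
      rw [← map_add, ← hadd]
      apply hsub
      have ho : ∀ c : TruncatedWittVector p m R, WittVector.truncate m c.out = c :=
        fun c => TruncatedWittVector.truncateFun_out c
      rw [map_add, ho, ho, ho])

theorem coeff_wittV {m : ℕ} (h : m ≤ n) (a : TruncatedWittVector p m R) (i : Fin n) :
    (wittV h a).coeff i
      = if hi : n - m ≤ (i : ℕ) then a.coeff ⟨(i : ℕ) - (n - m), by have := i.2; omega⟩ else 0 := by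
  change (WittVector.truncate n (WittVector.verschiebung^[n - m] a.out)).coeff i = _
  rw [WittVector.coeff_truncate]
  split_ifs with hi
  · rw [iterate_verschiebung_coeff_of_le _ _ _ hi]
    exact TruncatedWittVector.coeff_out a ⟨_, by have := i.2; omega⟩
  · exact WittVector.iterate_verschiebung_coeff_eq_zero _ (not_le.mp hi)

theorem wittV_wittMap {m : ℕ} (h : m ≤ n) (f : R →+* S) (a : TruncatedWittVector p m R) :
    wittV h (wittMap p m f a) = wittMap p n f (wittV h a) := by
  apply TruncatedWittVector.ext
  intro i
  rw [coeff_wittMap, coeff_wittV, coeff_wittV]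
  split_ifs
  · rw [coeff_wittMap]
  · rw [map_zero]

/-- For an ideal `I ⊆ R`, the ideal `J = (R^{n-1})⁻¹(I)` of `W_n(R)` (see `mem_wittIdeal_iff`). -/
def wittIdeal (p : ℕ) [Fact p.Prime] (n : ℕ) (I : Ideal R) : Ideal (TruncatedWittVector p n R) :=
  (I.comap (WittVector.constantCoeff : WittVector p R →+* R)).map (WittVector.truncate n)

theorem mem_wittIdeal_iff (hn : 1 ≤ n) (I : Ideal R) (a : TruncatedWittVector p n R) :
    a ∈ wittIdeal p n I ↔ a.coeff ⟨0, hn⟩ ∈ I := by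
  rw [wittIdeal, Ideal.mem_map_iff_of_surjective _ (WittVector.truncate_surjective p n R)]
  constructor
  · rintro ⟨b, hb, rfl⟩
    rw [WittVector.coeff_truncate]
    exact hb
  · intro ha
    refine ⟨a.out, ?_, TruncatedWittVector.truncateFun_out a⟩
    have := TruncatedWittVector.coeff_out a ⟨0, hn⟩
    rw [Ideal.mem_comap]
    change a.out.coeff 0 ∈ I
    rw [← this] at ha
    exact ha

end Witt

/-! ### `W_n`-valued local cohomology in dimension two

For a two-dimensional Cohen–Macaulay local ring `A` and a regular sequence `x, y` in its maximal
ideal, `H²_𝔪(W_n A)` is the top cohomology of the Čech complex, that is, the cokernel of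
`W_n(A[1/x]) ⊕ W_n(A[1/y]) → W_n(A[1/(xy)])`. -/

section LocalCohomology

variable (p : ℕ) [hp : Fact p.Prime] (n : ℕ) {A B : Type*} [CommRing A] [CommRing B]

/-- `W_n(A[1/f])` as a `W_n(A)`-module. -/
instance wittAwayModule (f : A) :
    Module (TruncatedWittVector p n A) (TruncatedWittVector p n (Localization.Away f)) :=
  Module.compHom _ (wittMap p n (algebraMap A (Localization.Away f)))

theorem witt_smul_def (f : A) (r : TruncatedWittVector p n A)
    (a : TruncatedWittVector p n (Localization.Away f)) :
    r • a = wittMap p n (algebraMap A (Localization.Away f)) r * a := rfl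

/-- The localization map `A[1/x] → A[1/(xy)]`. -/
abbrev locLeft (x y : A) : Localization.Away x →+* Localization.Away (x * y) :=
  IsLocalization.Away.awayToAwayRight x y

/-- The localization map `A[1/y] → A[1/(xy)]`. -/
abbrev locRight (x y : A) : Localization.Away y →+* Localization.Away (x * y) :=
  IsLocalization.Away.awayToAwayLeft y x

theorem locLeft_comp (x y : A) :
    (locLeft x y).comp (algebraMap A _) = algebraMap A (Localization.Away (x * y)) :=
  RingHom.ext fun a => IsLocalization.Away.awayToAwayRight_eq x y a

theorem locRight_comp (x y : A) :
    (locRight x y).comp (algebraMap A _) = algebraMap A (Localization.Away (x * y)) :=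
  RingHom.ext fun a => IsLocalization.Away.awayToAwayLeft_eq y x a

/-- The Čech boundaries: the sum of the images of `W_n(A[1/x])` and `W_n(A[1/y])` in
`W_n(A[1/(xy)])`. -/
def cechBoundary (x y : A) :
    Submodule (TruncatedWittVector p n A) (TruncatedWittVector p n (Localization.Away (x * y))) where
  carrier := {a | ∃ b c, wittMap p n (locLeft x y) b + wittMap p n (locRight x y) c = a}
  add_mem' := by
    rintro _ _ ⟨b, c, rfl⟩ ⟨b', c', rfl⟩
    exact ⟨b + b', c + c', by rw [map_add, map_add]; abel⟩
  zero_mem' := ⟨0, 0, by rw [map_zero, map_zero, add_zero]⟩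
  smul_mem' := by
    rintro r _ ⟨b, c, rfl⟩
    refine ⟨r • b, r • c, ?_⟩
    simp only [witt_smul_def, map_mul, wittMap_wittMap, locLeft_comp, locRight_comp, mul_add]

/-- `H²_𝔪(W_n A)`, computed with the regular sequence `x, y`. -/
abbrev LocalH2 (x y : A) : Type _ :=
  TruncatedWittVector p n (Localization.Away (x * y)) ⧸ cechBoundary p n x y

/-- An additive map that carries a submodule into another one induces a map of the quotients. -/
def quotMap {R S M N : Type*} [Ring R] [Ring S] [AddCommGroup M] [AddCommGroup N] [Module R M]
    [Module S N] (P : Submodule R M) (Q : Submodule S N) (f : M →+ N) (h : ∀ a ∈ P, f a ∈ Q) :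
    (M ⧸ P) →+ (N ⧸ Q) :=
  QuotientAddGroup.map P.toAddSubgroup Q.toAddSubgroup f h

theorem quotMap_mk {R S M N : Type*} [Ring R] [Ring S] [AddCommGroup M] [AddCommGroup N]
    [Module R M] [Module S N] (P : Submodule R M) (Q : Submodule S N) (f : M →+ N)
    (h : ∀ a ∈ P, f a ∈ Q) (a : M) :
    quotMap P Q f h (Submodule.Quotient.mk a) = Submodule.Quotient.mk (f a) := rfl

variable {p n}

/-- The restriction `R^{n-m} : H²_𝔪(W_n A) → H²_𝔪(W_m A)` for `m ≤ n`. -/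
def cohR {m : ℕ} (h : m ≤ n) (x y : A) : LocalH2 p n x y →+ LocalH2 p m x y :=
  quotMap _ _ (TruncatedWittVector.truncate h).toAddMonoidHom (by
    rintro _ ⟨b, c, rfl⟩
    refine ⟨TruncatedWittVector.truncate h b, TruncatedWittVector.truncate h c, ?_⟩
    change _ = TruncatedWittVector.truncate h _
    rw [map_add, truncate_wittMap, truncate_wittMap])

/-- The Verschiebung `V^{n-m} : H²_𝔪(W_m A) → H²_𝔪(W_n A)` for `m ≤ n`. -/
def cohV {m : ℕ} (h : m ≤ n) (x y : A) : LocalH2 p m x y →+ LocalH2 p n x y :=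
  quotMap _ _ (wittV h) (by
    rintro _ ⟨b, c, rfl⟩
    exact ⟨wittV h b, wittV h c, by rw [map_add, wittV_wittMap, wittV_wittMap]⟩)

/-- The map `A[1/(xy)] → B[1/(f(x)f(y))]` induced by `f : A → B`. -/
def awayMul (f : A →+* B) (x y : A) :
    Localization.Away (x * y) →+* Localization.Away (f x * f y) :=
  IsLocalization.Away.lift (x * y)
    (g := (algebraMap B (Localization.Away (f x * f y))).comp f) (by
      rw [RingHom.comp_apply, map_mul]
      exact IsLocalization.Away.algebraMap_isUnit _)

/-- The map `A[1/x] → B[1/f(x)]` induced by `f : A → B`. -/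
def awayOne (f : A →+* B) (x : A) : Localization.Away x →+* Localization.Away (f x) :=
  IsLocalization.Away.lift x (g := (algebraMap B (Localization.Away (f x))).comp f)
    (IsLocalization.Away.algebraMap_isUnit (f x))

theorem awayMul_algebraMap (f : A →+* B) (x y a : A) :
    awayMul f x y (algebraMap A _ a) = algebraMap B _ (f a) :=
  IsLocalization.Away.lift_eq _ _ a

theorem awayOne_algebraMap (f : A →+* B) (x a : A) :
    awayOne f x (algebraMap A _ a) = algebraMap B _ (f a) :=
  IsLocalization.Away.lift_eq _ _ a

theorem awayMul_comp_locLeft (f : A →+* B) (x y : A) :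
    (awayMul f x y).comp (locLeft x y) = (locLeft (f x) (f y)).comp (awayOne f x) := by
  apply IsLocalization.ringHom_ext (Submonoid.powers x)
  ext a
  simp only [RingHom.comp_apply]
  rw [IsLocalization.Away.awayToAwayRight_eq, awayOne_algebraMap, awayMul_algebraMap,
    IsLocalization.Away.awayToAwayRight_eq]

theorem awayMul_comp_locRight (f : A →+* B) (x y : A) :
    (awayMul f x y).comp (locRight x y) = (locRight (f x) (f y)).comp (awayOne f y) := by
  apply IsLocalization.ringHom_ext (Submonoid.powers y)
  ext a
  simp only [RingHom.comp_apply]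
  rw [IsLocalization.Away.awayToAwayLeft_eq, awayOne_algebraMap, awayMul_algebraMap,
    IsLocalization.Away.awayToAwayLeft_eq]

variable (p n) in
/-- The pullback `H²_{𝔪_A}(W_n A) → H²_{𝔪_B}(W_n B)` along `f : A → B`, the source computed with
`x, y` and the target with `f(x), f(y)`. -/
def cohPullback (f : A →+* B) (x y : A) : LocalH2 p n x y →+ LocalH2 p n (f x) (f y) :=
  quotMap _ _ (wittMap p n (awayMul f x y)).toAddMonoidHom (by
    rintro _ ⟨b, c, rfl⟩
    refine ⟨wittMap p n (awayOne f x) b, wittMap p n (awayOne f y) c, ?_⟩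
    change _ = wittMap p n (awayMul f x y) _
    rw [map_add, wittMap_wittMap, wittMap_wittMap, wittMap_wittMap, wittMap_wittMap,
      awayMul_comp_locLeft, awayMul_comp_locRight])

variable (p n) in
/-- The `I`-torsion part `H²_𝔪(W_n A)[I]`: the classes annihilated by `(R^{n-1})⁻¹(I) ⊆ W_n(A)`. -/
def cohTorsion (x y : A) (I : Ideal A) :
    Submodule (TruncatedWittVector p n A) (LocalH2 p n x y) :=
  Submodule.torsionBySet _ _ (wittIdeal p n I : Set (TruncatedWittVector p n A))

variable (p) in
/-- `e` generates the module `H²_𝔪(A)[I]` over `A = W_1(A)`. -/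
def IsTorsionGenerator (x y : A) (I : Ideal A) (e : LocalH2 p 1 x y) : Prop :=
  Submodule.span (TruncatedWittVector p 1 A) {e} = cohTorsion p 1 x y I

end LocalCohomology

/-! ### Actions of finite group schemes and their quotients

An affine group scheme `G` over `k` is given by its coordinate ring `H = 𝒪(G)`, a commutative Hopf
algebra. -/

section GroupScheme

variable (k : Type*) [Field k] (p : ℕ) (H : Type*) [CommRing H] [HopfAlgebra k H]

/-- `Spec H ≅ μ_p`: `H = k[t]/(t^p - 1)` with `t` group-like. -/
def IsMuP : Prop :=
  ∃ t : H, Coalgebra.comul (R := k) t = t ⊗ₜ[k] t ∧ Coalgebra.counit (R := k) t = 1 ∧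
    Function.Surjective (Polynomial.aeval (R := k) t) ∧
    RingHom.ker (Polynomial.aeval (R := k) t) = Ideal.span {(Polynomial.X ^ p - 1 : Polynomial k)}

/-- `Spec H ≅ α_p`: `H = k[t]/(t^p)` with `t` primitive. -/
def IsAlphaP : Prop :=
  ∃ t : H, Coalgebra.comul (R := k) t = t ⊗ₜ[k] 1 + 1 ⊗ₜ[k] t ∧
    Coalgebra.counit (R := k) t = 0 ∧
    Function.Surjective (Polynomial.aeval (R := k) t) ∧
    RingHom.ker (Polynomial.aeval (R := k) t) = Ideal.span {(Polynomial.X ^ p : Polynomial k)}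

/-- An action over `k` of the group scheme `Spec H` on `Spec B`, as a coaction `B → B ⊗ H`. -/
structure GroupSchemeAction (B : Type*) [CommRing B] [Algebra k B] where
  /-- the coaction -/
  coact : B →ₐ[k] B ⊗[k] H
  /-- the associativity of the action -/
  coassoc : ∀ b : B,
    Algebra.TensorProduct.assoc k k k B H H
        (Algebra.TensorProduct.map coact (AlgHom.id k H) (coact b))
      = Algebra.TensorProduct.map (AlgHom.id k B) (Bialgebra.comulAlgHom k H) (coact b)
  /-- the unit of the group acts trivially -/
  counit : ∀ b : B,
    Algebra.TensorProduct.rid k k B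
        (Algebra.TensorProduct.map (AlgHom.id k B) (Bialgebra.counitAlgHom k H) (coact b)) = b

namespace GroupSchemeAction

variable {k H} {A B : Type*} [CommRing A] [Algebra k A] [CommRing B] [Algebra k B]

/-- The ideal of the fixed point scheme, the largest closed subscheme of `Spec B` on which the group
acts trivially: it is generated by the coefficients in `B` of the elements
`coact b - b ⊗ 1` of `B ⊗ H`. -/
def fixedIdeal (ρ : GroupSchemeAction k H B) : Ideal B :=
  Ideal.span {c | ∃ (b : B) (l : H →ₗ[k] k),
    TensorProduct.rid k B (LinearMap.lTensor B l (ρ.coact b - b ⊗ₜ[k] 1)) = c}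

/-- The fixed locus, as a closed subset of `Spec B`. -/
def fixedLocus (ρ : GroupSchemeAction k H B) : Set (PrimeSpectrum B) :=
  PrimeSpectrum.zeroLocus (ρ.fixedIdeal : Set B)

/-- `Spec B → Spec A` is the quotient by the group scheme: `A` is the ring of invariants of `B`. -/
def IsQuotient (ρ : GroupSchemeAction k H B) (π : A →ₐ[k] B) : Prop :=
  Function.Injective π ∧ ∀ b : B, b ∈ Set.range π ↔ ρ.coact b = b ⊗ₜ[k] 1

end GroupSchemeAction

end GroupScheme

/-! ### Rational double points of coindex zero -/

/-- The Dynkin diagrams of type A, D, E. -/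
inductive Dynkin : Type
  | A (N : ℕ)
  | D (N : ℕ)
  | E6
  | E7
  | E8

section RDP

variable (k : Type*) [Field k] (p : ℕ)

open MvPowerSeries in
/-- Artin's equation, in the variables `x = X 0`, `y = X 1`, `z = X 2`, of the rational double
point of type `S^0` in characteristic `p` (which is the only one of type `S` if `S` is taut). -/
def rdpEquation : Dynkin → MvPowerSeries (Fin 3) k
  | .A N => X 2 ^ (N + 1) - X 0 * X 1
  | .D N =>
      if p = 2 then
        if Even N then X 2 ^ 2 + X 0 ^ 2 * X 1 + X 0 * X 1 ^ (N / 2)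
        else X 2 ^ 2 + X 0 ^ 2 * X 1 + X 2 * X 1 ^ (N / 2)
      else X 2 ^ 2 + X 0 ^ 2 * X 1 + X 1 ^ (N - 1)
  | .E6 => if p = 2 then X 2 ^ 2 + X 0 ^ 3 + X 1 ^ 2 * X 2 else X 2 ^ 2 + X 0 ^ 3 + X 1 ^ 4
  | .E7 => X 2 ^ 2 + X 0 ^ 3 + X 0 * X 1 ^ 3
  | .E8 => X 2 ^ 2 + X 0 ^ 3 + X 1 ^ 5

/-- The local `k`-algebra `A` is a rational double point of type `S^0` in characteristic `p`: it is
Noetherian, and its completion is `k[[x, y, z]]/(f)` for the equation `f` above. -/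
def IsRDPZero (S : Dynkin) (A : Type*) [CommRing A] [IsLocalRing A] [Algebra k A] : Prop :=
  IsNoetherianRing A ∧
    Nonempty (AdicCompletion (IsLocalRing.maximalIdeal A) A ≃ₐ[k]
      (MvPowerSeries (Fin 3) k ⧸ Ideal.span {rdpEquation k p S}))

/-- The local `k`-algebra `B` is a smooth point of a surface: a two-dimensional regular local ring
with residue field `k`. -/
def IsSmoothPoint (B : Type*) [CommRing B] [IsLocalRing B] [Algebra k B] : Prop :=
  IsRegularLocalRing B ∧ ringKrullDim B = 2 ∧
    Function.Surjective (algebraMap k (IsLocalRing.ResidueField B))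

end RDP

end

end RDPWitt

open RDPWitt

/-! Let `Q` be the completion of `A`. In each case one of the three variables, called `W`, enters
the equation only through its `p`-th power, so `Q = k[[s,t,W]]/(W^p - N(s,t))`, and `∂/∂W` acts on
`Q`. The class sought is that of the Teichmüller representative `[W^(p-1)/(st)]`.

Its restriction to length one generates the socle of `H²(Q)`, because `Q/(s,t) = k[W]/(W^p)` has
socle `W^(p-1)` (`isTorsionGenerator_witness_one`). It is killed by `[s]` and `[t]` at once, and by
`[W]` because `[N/(st)]` is a coboundary. Also `V(u)·e = V(u·F e)`, where `F e = [N^(p-1)/(st)^p]`.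
The explicit addition law of Witt vectors gives `F e = V^(n-1)(c/(st))` with `c` an integer prime to
`p`, so `F e` vanishes in length `n-1` (`IsWitnessNorm`, `witness_mem_cohTorsion`).

For the pullback: `G` is infinitesimal of height one, so `B^p ⊆ A`, and there is `φ : B → A` for
which `π ∘ φ` and `φ ∘ π` are the Frobenius maps. Frobenius is injective on `H²(W_n B)` because `B`
is regular; hence `φ^*` is injective too. As `φ^* π^* e = F e = V^(n-1) η` with `η` corresponding to
`c/(st)`, the class `π^* e` vanishes in length `n-1`. So `π^* e = V^(n-1) e'` with `φ^* e' = η ≠ 0`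
(`exists_class_of_frobenius_factor`).

It remains that `𝔪_B` kills `e'`, which follows from `φ(𝔪_B) ⊆ (s,t)Q`
(`InsepModel.algebraMap_mem_span`). The action is given by a vector field `D` on `B`. The derivation
`δ = ∂/∂W ∘ φ` from `B` to `Q` kills `A`, so it is proportional to `D`. Since `D` vanishes only at
the closed point and `Q` has depth two, `D b` divides `δ b`. Hence `𝔪_B Q + (s,t)` is stable under
`∂/∂W`; but `k[W]/(W^p)` has no nonzero proper ideal stable under `d/dW`.

The class lives on `Q` with parameters `s, t`, while `A` has arbitrary `x, y`. Čech groups for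
different parameters are identified compatibly with all operators (`ParamPair.nonempty_cechEquiv`),
and so are those of `A` and `Q` (`IsCompletionMap.cechMap_bijective`). Both are reduced to length
one by the sequences `0 → H²(R) → H²(W_(n+1) R) → H²(W_n R) → 0`. -/

namespace RDPWitt

noncomputable section

open IsLocalRing

/-! ### Functoriality of the Čech cohomology groups -/

section CechMap

variable {p : ℕ} [hp : Fact p.Prime] {n : ℕ}
variable {R S T : Type*} [CommRing R] [CommRing S] [CommRing T]

/-- `g : R → S` carries `D(x'), D(y')` into `D(x), D(y)`, so that it induces maps of Čech complexes. -/
structure IsCechHom (g : R →+* S) (x y : R) (x' y' : S) : Prop where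
  left : IsUnit (algebraMap S (Localization.Away x') (g x))
  right : IsUnit (algebraMap S (Localization.Away y') (g y))

theorem isUnit_algebraMap_of_dvd {x s : S} (h : s ∣ x) :
    IsUnit (algebraMap S (Localization.Away x) s) :=
  isUnit_of_dvd_unit (map_dvd _ h) (IsLocalization.Away.algebraMap_isUnit x)

theorem isUnit_algebraMap_of_dvd_pow {x s : S} {k : ℕ} (h : s ∣ x ^ k) :
    IsUnit (algebraMap S (Localization.Away x) s) :=
  isUnit_of_dvd_unit (map_dvd _ h)
    (by rw [map_pow]; exact (IsLocalization.Away.algebraMap_isUnit x).pow k)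

theorem locLeft_algebraMap (x y a : R) :
    locLeft x y (algebraMap R _ a) = algebraMap R (Localization.Away (x * y)) a :=
  IsLocalization.Away.awayToAwayRight_eq x y a

theorem locRight_algebraMap (x y a : R) :
    locRight x y (algebraMap R _ a) = algebraMap R (Localization.Away (x * y)) a :=
  IsLocalization.Away.awayToAwayLeft_eq y x a

namespace IsCechHom

variable {g : R →+* S} {x y : R} {x' y' : S}

theorem mul (h : IsCechHom g x y x' y') :
    IsUnit (((algebraMap S (Localization.Away (x' * y'))).comp g) (x * y)) := by
  rw [RingHom.comp_apply, map_mul, map_mul]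
  refine IsUnit.mul ?_ ?_
  · rw [← locLeft_algebraMap]; exact h.left.map _
  · rw [← locRight_algebraMap]; exact h.right.map _

/-- The induced map `R[1/(xy)] → S[1/(x'y')]`. -/
def loc (h : IsCechHom g x y x' y') : Localization.Away (x * y) →+* Localization.Away (x' * y') :=
  IsLocalization.Away.lift (x * y) h.mul

/-- The induced map `R[1/x] → S[1/x']`. -/
def locL (h : IsCechHom g x y x' y') : Localization.Away x →+* Localization.Away x' :=
  IsLocalization.Away.lift x (g := (algebraMap S (Localization.Away x')).comp g) h.left

/-- The induced map `R[1/y] → S[1/y']`. -/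
def locR (h : IsCechHom g x y x' y') : Localization.Away y →+* Localization.Away y' :=
  IsLocalization.Away.lift y (g := (algebraMap S (Localization.Away y')).comp g) h.right

theorem loc_algebraMap (h : IsCechHom g x y x' y') (a : R) :
    h.loc (algebraMap R _ a) = algebraMap S _ (g a) := IsLocalization.Away.lift_eq _ _ a

theorem locL_algebraMap (h : IsCechHom g x y x' y') (a : R) :
    h.locL (algebraMap R _ a) = algebraMap S _ (g a) := IsLocalization.Away.lift_eq _ _ a

theorem locR_algebraMap (h : IsCechHom g x y x' y') (a : R) :
    h.locR (algebraMap R _ a) = algebraMap S _ (g a) := IsLocalization.Away.lift_eq _ _ a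

theorem loc_comp_locLeft (h : IsCechHom g x y x' y') :
    h.loc.comp (locLeft x y) = (locLeft x' y').comp h.locL := by
  apply IsLocalization.ringHom_ext (Submonoid.powers x)
  ext a
  simp only [RingHom.comp_apply, locLeft_algebraMap, loc_algebraMap, locL_algebraMap]

theorem loc_comp_locRight (h : IsCechHom g x y x' y') :
    h.loc.comp (locRight x y) = (locRight x' y').comp h.locR := by
  apply IsLocalization.ringHom_ext (Submonoid.powers y)
  ext a
  simp only [RingHom.comp_apply, locRight_algebraMap, loc_algebraMap, locR_algebraMap]

theorem loc_eq (h : IsCechHom g x y x' y')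
    (f : Localization.Away (x * y) →+* Localization.Away (x' * y'))
    (hf : ∀ a, f (algebraMap R _ a) = algebraMap S _ (g a)) : f = h.loc := by
  apply IsLocalization.ringHom_ext (Submonoid.powers (x * y))
  ext a
  simp only [RingHom.comp_apply, loc_algebraMap, hf]

theorem comp {f : S →+* T} {x'' y'' : T} (hf : IsCechHom f x' y' x'' y'')
    (h : IsCechHom g x y x' y') : IsCechHom (f.comp g) x y x'' y'' where
  left := by rw [RingHom.comp_apply, ← hf.locL_algebraMap]; exact h.left.map _
  right := by rw [RingHom.comp_apply, ← hf.locR_algebraMap]; exact h.right.map _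

theorem self_map (g : R →+* S) (x y : R) : IsCechHom g x y (g x) (g y) where
  left := IsLocalization.Away.algebraMap_isUnit _
  right := IsLocalization.Away.algebraMap_isUnit _

theorem of_dvd {x y x' y' : R} (hx : x ∣ x') (hy : y ∣ y') :
    IsCechHom (RingHom.id R) x y x' y' where
  left := isUnit_algebraMap_of_dvd hx
  right := isUnit_algebraMap_of_dvd hy

/-- The target keeps the parameters `x, y` instead of `x^p, y^p`, so that Frobenius becomes an
endomorphism of one and the same group. -/
theorem frobenius [CharP R p] (x y : R) : IsCechHom (_root_.frobenius R p) x y x y where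
  left := isUnit_algebraMap_of_dvd_pow (k := p) dvd_rfl
  right := isUnit_algebraMap_of_dvd_pow (k := p) dvd_rfl

end IsCechHom

variable (p n) in
/-- The map of Čech cohomology groups induced by a ring homomorphism. -/
def cechMap {g : R →+* S} {x y : R} {x' y' : S} (h : IsCechHom g x y x' y') :
    LocalH2 p n x y →+ LocalH2 p n x' y' :=
  quotMap _ _ (wittMap p n h.loc).toAddMonoidHom (by
    rintro _ ⟨b, c, rfl⟩
    refine ⟨wittMap p n h.locL b, wittMap p n h.locR c, ?_⟩
    change _ = wittMap p n h.loc _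
    rw [map_add, wittMap_wittMap, wittMap_wittMap, wittMap_wittMap, wittMap_wittMap,
      h.loc_comp_locLeft, h.loc_comp_locRight])

/-- The class of a Čech cocycle. -/
abbrev hmk {x y : R} (a : TruncatedWittVector p n (Localization.Away (x * y))) : LocalH2 p n x y :=
  Submodule.Quotient.mk a

theorem hmk_surj {x y : R} (z : LocalH2 p n x y) : ∃ a, hmk a = z :=
  Submodule.Quotient.mk_surjective _ z

theorem cechMap_hmk {g : R →+* S} {x y : R} {x' y' : S} (h : IsCechHom g x y x' y')
    (a : TruncatedWittVector p n (Localization.Away (x * y))) :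
    cechMap p n h (hmk a) = hmk (wittMap p n h.loc a) := rfl

theorem cohR_hmk {m : ℕ} (h : m ≤ n) {x y : R}
    (a : TruncatedWittVector p n (Localization.Away (x * y))) :
    cohR h x y (hmk a) = hmk (TruncatedWittVector.truncate h a) := rfl

theorem cohV_hmk {m : ℕ} (h : m ≤ n) {x y : R}
    (a : TruncatedWittVector p m (Localization.Away (x * y))) :
    cohV h x y (hmk a) = hmk (wittV h a) := rfl

theorem hmk_eq_zero_iff {x y : R} (a : TruncatedWittVector p n (Localization.Away (x * y))) :
    (hmk a : LocalH2 p n x y) = 0 ↔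
      ∃ b c, wittMap p n (locLeft x y) b + wittMap p n (locRight x y) c = a :=
  Submodule.Quotient.mk_eq_zero _

theorem hmk_add {x y : R} (a b : TruncatedWittVector p n (Localization.Away (x * y))) :
    (hmk (a + b) : LocalH2 p n x y) = hmk a + hmk b := rfl

theorem smul_hmk {x y : R} (r : TruncatedWittVector p n R)
    (a : TruncatedWittVector p n (Localization.Away (x * y))) :
    r • (hmk a : LocalH2 p n x y) = hmk (wittMap p n (algebraMap R _) r * a) := rfl

theorem cechMap_comp {g : R →+* S} {x y : R} {x' y' : S} {f : S →+* T} {x'' y'' : T}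
    (hf : IsCechHom f x' y' x'' y'') (h : IsCechHom g x y x' y') {k : R →+* T}
    (hk : IsCechHom k x y x'' y'') (e : ∀ a, f (g a) = k a) (z : LocalH2 p n x y) :
    cechMap p n hf (cechMap p n h z) = cechMap p n hk z := by
  obtain ⟨a, rfl⟩ := hmk_surj z
  rw [cechMap_hmk, cechMap_hmk, cechMap_hmk, wittMap_wittMap]
  congr 3
  exact hk.loc_eq _ fun a => by
    rw [RingHom.comp_apply, h.loc_algebraMap, hf.loc_algebraMap, e]

theorem cechMap_comm {S' : Type*} [CommRing S'] {x y : R} {x₁ y₁ : S} {x₂ y₂ : S'} {x₃ y₃ : T}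
    {f₁ : R →+* S} {g₁ : S →+* T} {f₂ : R →+* S'} {g₂ : S' →+* T}
    (hf₁ : IsCechHom f₁ x y x₁ y₁) (hg₁ : IsCechHom g₁ x₁ y₁ x₃ y₃)
    (hf₂ : IsCechHom f₂ x y x₂ y₂) (hg₂ : IsCechHom g₂ x₂ y₂ x₃ y₃)
    (e : ∀ a, g₁ (f₁ a) = g₂ (f₂ a)) (z : LocalH2 p n x y) :
    cechMap p n hg₁ (cechMap p n hf₁ z) = cechMap p n hg₂ (cechMap p n hf₂ z) := by
  rw [cechMap_comp hg₁ hf₁ (hg₁.comp hf₁) (fun _ => rfl),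
    cechMap_comp hg₂ hf₂ (hg₁.comp hf₁) (fun a => (e a).symm)]

theorem cechMap_cohR {m : ℕ} (hm : m ≤ n) {g : R →+* S} {x y : R} {x' y' : S}
    (h : IsCechHom g x y x' y') (z : LocalH2 p n x y) :
    cechMap p m h (cohR hm x y z) = cohR hm x' y' (cechMap p n h z) := by
  obtain ⟨a, rfl⟩ := hmk_surj z
  rw [cechMap_hmk, cohR_hmk, cohR_hmk, cechMap_hmk, truncate_wittMap]

theorem cechMap_cohV {m : ℕ} (hm : m ≤ n) {g : R →+* S} {x y : R} {x' y' : S}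
    (h : IsCechHom g x y x' y') (z : LocalH2 p m x y) :
    cechMap p n h (cohV hm x y z) = cohV hm x' y' (cechMap p m h z) := by
  obtain ⟨a, rfl⟩ := hmk_surj z
  rw [cechMap_hmk, cohV_hmk, cohV_hmk, cechMap_hmk, wittV_wittMap]

theorem cechMap_smul {g : R →+* S} {x y : R} {x' y' : S}
    (h : IsCechHom g x y x' y') (r : TruncatedWittVector p n R) (z : LocalH2 p n x y) :
    cechMap p n h (r • z) = wittMap p n g r • cechMap p n h z := by
  obtain ⟨a, rfl⟩ := hmk_surj z
  rw [smul_hmk, cechMap_hmk, cechMap_hmk, smul_hmk, map_mul, wittMap_wittMap, wittMap_wittMap]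
  congr 4
  ext a
  exact h.loc_algebraMap a

theorem cohPullback_eq_cechMap (f : R →+* S) (x y : R) (z : LocalH2 p n x y) :
    cohPullback p n f x y z = cechMap p n (IsCechHom.self_map f x y) z := by
  obtain ⟨a, rfl⟩ := hmk_surj z
  rw [cechMap_hmk]
  change hmk (wittMap p n (awayMul f x y) a) = _
  rw [(IsCechHom.self_map f x y).loc_eq (awayMul f x y) (awayMul_algebraMap f x y)]

theorem cohR_surjective {m : ℕ} (hm : m ≤ n) (x y : R) :
    Function.Surjective (cohR hm x y : LocalH2 p n x y → LocalH2 p m x y) := by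
  intro z
  obtain ⟨a, rfl⟩ := hmk_surj z
  obtain ⟨b, rfl⟩ := TruncatedWittVector.truncate_surjective hm a
  exact ⟨hmk b, cohR_hmk _ _⟩

/-! ### Coefficients in a subring -/

/-- The image of `R[1/x]` in `R[1/(xy)]`. -/
def leftRing (x y : R) : Subring (Localization.Away (x * y)) := (locLeft x y).range

/-- The image of `R[1/y]` in `R[1/(xy)]`. -/
def rightRing (x y : R) : Subring (Localization.Away (x * y)) := (locRight x y).range

/-- As a set `W_n` is a power of the ring, so lifting through `W_n(f)` is done component by
component, even though the ring operations are not componentwise. -/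
theorem exists_wittMap_eq (f : R →+* S) (a : TruncatedWittVector p n S)
    (h : ∀ i, a.coeff i ∈ f.range) : ∃ b, wittMap p n f b = a := by
  choose b hb using h
  refine ⟨TruncatedWittVector.mk p b, TruncatedWittVector.ext fun i => ?_⟩
  rw [coeff_wittMap, TruncatedWittVector.coeff_mk, hb]

theorem hmk_eq_zero_of_left {x y : R} (a : TruncatedWittVector p n (Localization.Away (x * y)))
    (h : ∀ i, a.coeff i ∈ leftRing x y) : (hmk a : LocalH2 p n x y) = 0 := by
  obtain ⟨b, rfl⟩ := exists_wittMap_eq (locLeft x y) a h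
  exact (hmk_eq_zero_iff _).2 ⟨b, 0, by rw [map_zero, add_zero]⟩

theorem hmk_eq_zero_of_right {x y : R} (a : TruncatedWittVector p n (Localization.Away (x * y)))
    (h : ∀ i, a.coeff i ∈ rightRing x y) : (hmk a : LocalH2 p n x y) = 0 := by
  obtain ⟨b, rfl⟩ := exists_wittMap_eq (locRight x y) a h
  exact (hmk_eq_zero_iff _).2 ⟨0, b, by rw [map_zero, zero_add]⟩

/-! ### Length one -/

variable (p) in
/-- `R = W_1(R)`. -/
def wittOne : R ≃+* TruncatedWittVector p 1 R where
  toFun r := WittVector.truncate 1 (WittVector.teichmuller p r)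
  invFun a := a.coeff 0
  left_inv r := by
    change TruncatedWittVector.coeff 0 _ = r
    rw [WittVector.coeff_truncate]
    exact WittVector.teichmuller_coeff_zero p r
  right_inv a := by
    apply TruncatedWittVector.ext
    intro i
    obtain rfl : i = 0 := Subsingleton.elim _ _
    rw [WittVector.coeff_truncate]
    exact WittVector.teichmuller_coeff_zero p _
  map_mul' a b := by rw [map_mul, map_mul]
  map_add' a b := by
    apply TruncatedWittVector.ext
    intro i
    obtain rfl : i = 0 := Subsingleton.elim _ _
    rw [← map_add, WittVector.coeff_truncate, WittVector.coeff_truncate]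
    change (WittVector.teichmuller p (a + b)).coeff 0 = (_ + _ : WittVector p R).coeff 0
    rw [WittVector.add_coeff_zero, WittVector.teichmuller_coeff_zero,
      WittVector.teichmuller_coeff_zero, WittVector.teichmuller_coeff_zero]

theorem coeff_wittOne (r : R) (i : Fin 1) : (wittOne p r).coeff i = r := by
  obtain rfl : i = 0 := Subsingleton.elim _ _
  exact (wittOne p).left_inv r

theorem wittMap_wittOne (f : R →+* S) (r : R) : wittMap p 1 f (wittOne p r) = wittOne p (f r) := by
  apply TruncatedWittVector.ext
  intro i
  rw [coeff_wittMap, coeff_wittOne, coeff_wittOne]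

theorem wittOne_surj (a : TruncatedWittVector p 1 R) : ∃ r, wittOne p r = a :=
  (wittOne p).surjective a

variable (p) in
/-- The class in `H²_𝔪(R)` of an element of `R[1/(xy)]`. -/
def cls (x y : R) : Localization.Away (x * y) →+ LocalH2 p 1 x y where
  toFun f := hmk (wittOne p f)
  map_zero' := by rw [map_zero]; rfl
  map_add' a b := by rw [map_add]; rfl

theorem cls_apply (x y : R) (f : Localization.Away (x * y)) : cls p x y f = hmk (wittOne p f) := rfl

theorem cls_surj {x y : R} (z : LocalH2 p 1 x y) : ∃ f, cls p x y f = z := by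
  obtain ⟨a, rfl⟩ := hmk_surj z
  obtain ⟨f, rfl⟩ := wittOne_surj a
  exact ⟨f, rfl⟩

theorem cls_eq_zero_iff (x y : R) (f : Localization.Away (x * y)) :
    cls p x y f = 0 ↔ ∃ b c, locLeft x y b + locRight x y c = f := by
  rw [cls_apply, hmk_eq_zero_iff]
  constructor
  · rintro ⟨b, c, h⟩
    obtain ⟨b, rfl⟩ := wittOne_surj b
    obtain ⟨c, rfl⟩ := wittOne_surj c
    refine ⟨b, c, (wittOne p).injective ?_⟩
    rw [← h, map_add, wittMap_wittOne, wittMap_wittOne]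
  · rintro ⟨b, c, rfl⟩
    exact ⟨wittOne p b, wittOne p c, by rw [wittMap_wittOne, wittMap_wittOne, map_add]⟩

theorem cls_eq_zero_of_left {x y : R} {f : Localization.Away (x * y)} (h : f ∈ leftRing x y) :
    cls p x y f = 0 := by
  obtain ⟨b, rfl⟩ := h
  exact (cls_eq_zero_iff _ _ _).2 ⟨b, 0, by rw [map_zero, add_zero]⟩

theorem cls_eq_zero_of_right {x y : R} {f : Localization.Away (x * y)} (h : f ∈ rightRing x y) :
    cls p x y f = 0 := by
  obtain ⟨b, rfl⟩ := h
  exact (cls_eq_zero_iff _ _ _).2 ⟨0, b, by rw [map_zero, zero_add]⟩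

theorem smul_cls (x y r : R) (f : Localization.Away (x * y)) :
    wittOne p r • cls p x y f = cls p x y (algebraMap R _ r * f) := by
  rw [cls_apply, smul_hmk, wittMap_wittOne, cls_apply, map_mul]

theorem cechMap_cls {g : R →+* S} {x y : R} {x' y' : S} (h : IsCechHom g x y x' y')
    (f : Localization.Away (x * y)) : cechMap p 1 h (cls p x y f) = cls p x' y' (h.loc f) := by
  rw [cls_apply, cechMap_hmk, wittMap_wittOne, cls_apply]

theorem mem_wittIdeal_one (I : Ideal R) (r : R) : wittOne p r ∈ wittIdeal p 1 I ↔ r ∈ I := by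
  rw [mem_wittIdeal_iff le_rfl, coeff_wittOne]

theorem mem_cohTorsion_one {x y : R} {I : Ideal R} {z : LocalH2 p 1 x y} :
    z ∈ cohTorsion p 1 x y I ↔ ∀ r ∈ I, wittOne p r • z = 0 := by
  rw [cohTorsion, Submodule.mem_torsionBySet_iff]
  constructor
  · intro h r hr
    exact h ⟨wittOne p r, (mem_wittIdeal_one I r).2 hr⟩
  · rintro h ⟨a, ha⟩
    obtain ⟨r, rfl⟩ := wittOne_surj a
    exact h r ((mem_wittIdeal_one I r).1 ha)

theorem isTorsionGenerator_iff {x y : R} {I : Ideal R} {e : LocalH2 p 1 x y} :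
    IsTorsionGenerator p x y I e ↔ (∀ r ∈ I, wittOne p r • e = 0) ∧
      ∀ z : LocalH2 p 1 x y, (∀ r ∈ I, wittOne p r • z = 0) → ∃ r : R, z = wittOne p r • e := by
  rw [IsTorsionGenerator]
  constructor
  · intro h
    refine ⟨mem_cohTorsion_one.1 (h ▸ Submodule.mem_span_singleton_self e), fun z hz => ?_⟩
    have := mem_cohTorsion_one.2 hz
    rw [← h, Submodule.mem_span_singleton] at this
    obtain ⟨a, rfl⟩ := this
    obtain ⟨r, rfl⟩ := wittOne_surj a
    exact ⟨r, rfl⟩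
  · rintro ⟨h₁, h₂⟩
    apply le_antisymm
    · rw [Submodule.span_singleton_le_iff_mem]
      exact mem_cohTorsion_one.2 h₁
    · intro z hz
      obtain ⟨r, rfl⟩ := h₂ z (mem_cohTorsion_one.1 hz)
      exact Submodule.mem_span_singleton.2 ⟨_, rfl⟩

end CechMap

/-! ### Fractions and coboundaries for a regular pair -/

section RegPair

variable {R : Type*} [CommRing R]

/-- `x, y` is a regular sequence in either order. -/
structure RegPair (x y : R) : Prop where
  nzl : ∀ a, x * a = 0 → a = 0
  nzr : ∀ a, y * a = 0 → a = 0
  dvd : ∀ a b, y * a = x * b → x ∣ a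

namespace RegPair

variable {x y : R}

theorem cancel_left (h : RegPair x y) {a b : R} (e : x * a = x * b) : a = b := by
  have := h.nzl (a - b) (by rw [mul_sub, e, sub_self])
  exact sub_eq_zero.1 this

theorem symm (h : RegPair x y) : RegPair y x where
  nzl := h.nzr
  nzr := h.nzl
  dvd a b e := by
    obtain ⟨c, rfl⟩ := h.dvd b a e.symm
    exact ⟨c, h.cancel_left (by rw [e]; ring)⟩

theorem mul_right {y' : R} (h : RegPair x y) (h' : RegPair x y') : RegPair x (y * y') where
  nzl := h.nzl
  nzr a e := h'.nzr a (h.nzr _ (by rw [← mul_assoc, e]))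
  dvd a b e := by
    obtain ⟨c, hc⟩ := h.dvd (y' * a) b (by rw [← mul_assoc, e])
    exact h'.dvd a c hc

theorem mul_left {x' : R} (h : RegPair x y) (h' : RegPair x' y) : RegPair (x * x') y :=
  (h.symm.mul_right h'.symm).symm

theorem one_right (h : RegPair x y) : RegPair x 1 where
  nzl := h.nzl
  nzr a e := by rwa [one_mul] at e
  dvd a b e := ⟨b, by rw [← e, one_mul]⟩

theorem pow_right (h : RegPair x y) (j : ℕ) : RegPair x (y ^ j) := by
  induction j with
  | zero => rw [pow_zero]; exact h.one_right
  | succ j ih => rw [pow_succ]; exact ih.mul_right h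

theorem pow (h : RegPair x y) (i j : ℕ) : RegPair (x ^ i) (y ^ j) :=
  ((h.pow_right j).symm.pow_right i).symm

theorem nz_mul (h : RegPair x y) (a : R) (e : x * y * a = 0) : a = 0 :=
  h.nzr _ (h.nzl _ (by rw [← mul_assoc, e]))

theorem algebraMap_injective (h : RegPair x y) :
    Function.Injective (algebraMap R (Localization.Away (x * y))) := by
  refine IsLocalization.injective _ (M := Submonoid.powers (x * y)) ?_
  rintro _ ⟨k, rfl⟩
  rw [mem_nonZeroDivisors_iff_right]
  intro a ha
  simp only [mul_pow] at ha
  exact (h.pow k k).nz_mul a (by rw [← ha]; ring)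

end RegPair

/-- The inverse of `x` in `R[1/(xy)]`. -/
def invL (x y : R) : Localization.Away (x * y) :=
  locLeft x y (IsLocalization.Away.invSelf x)

/-- The inverse of `y` in `R[1/(xy)]`. -/
def invR (x y : R) : Localization.Away (x * y) :=
  locRight x y (IsLocalization.Away.invSelf y)

theorem algebraMap_mul_invL (x y : R) : algebraMap R _ x * invL x y = 1 := by
  rw [invL, ← locLeft_algebraMap, ← map_mul, IsLocalization.Away.mul_invSelf, map_one]

theorem algebraMap_mul_invR (x y : R) : algebraMap R _ y * invR x y = 1 := by
  rw [invR, ← locRight_algebraMap, ← map_mul, IsLocalization.Away.mul_invSelf, map_one]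

theorem invL_mem (x y : R) : invL x y ∈ leftRing x y := ⟨_, rfl⟩

theorem invR_mem (x y : R) : invR x y ∈ rightRing x y := ⟨_, rfl⟩

theorem algebraMap_mem_left (x y a : R) : algebraMap R _ a ∈ leftRing x y :=
  ⟨_, locLeft_algebraMap x y a⟩

theorem algebraMap_mem_right (x y a : R) : algebraMap R _ a ∈ rightRing x y :=
  ⟨_, locRight_algebraMap x y a⟩

/-- The fraction `a / (x^i y^j)`. -/
def frac (x y a : R) (i j : ℕ) : Localization.Away (x * y) :=
  algebraMap R _ a * invL x y ^ i * invR x y ^ j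

theorem frac_add (x y a b : R) (i j : ℕ) :
    frac x y (a + b) i j = frac x y a i j + frac x y b i j := by
  rw [frac, frac, frac, map_add]; ring

theorem algebraMap_mul_frac (x y r a : R) (i j : ℕ) :
    algebraMap R _ r * frac x y a i j = frac x y (r * a) i j := by
  rw [frac, frac, map_mul]; ring

theorem frac_mul_left (x y a : R) (i j k : ℕ) : frac x y (x ^ k * a) (i + k) j = frac x y a i j := by
  have := algebraMap_mul_invL x y
  rw [frac, frac, map_mul, map_pow, pow_add]
  calc _ = algebraMap R _ a * invL x y ^ i * invR x y ^ j
        * (algebraMap R _ x * invL x y) ^ k := by ring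
    _ = _ := by rw [this]; ring

theorem frac_mul_right (x y a : R) (i j k : ℕ) :
    frac x y (y ^ k * a) i (j + k) = frac x y a i j := by
  have := algebraMap_mul_invR x y
  rw [frac, frac, map_mul, map_pow, pow_add]
  calc _ = algebraMap R _ a * invL x y ^ i * invR x y ^ j
        * (algebraMap R _ y * invR x y) ^ k := by ring
    _ = _ := by rw [this]; ring

theorem exists_frac (x y : R) (f : Localization.Away (x * y)) : ∃ a i, f = frac x y a i i := by
  obtain ⟨k, a, h⟩ := IsLocalization.Away.surj (x * y) f
  refine ⟨a, k, ?_⟩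
  have hx := algebraMap_mul_invL x y
  have hy := algebraMap_mul_invR x y
  rw [frac, ← h]
  simp only [map_mul]
  calc f = f * (algebraMap R _ x * invL x y) ^ k * (algebraMap R _ y * invR x y) ^ k := by
        rw [hx, hy]; ring
    _ = _ := by ring

theorem exists_left (x y : R) (f : Localization.Away (x * y)) (h : f ∈ leftRing x y) :
    ∃ a i, f = frac x y a i 0 := by
  obtain ⟨b, rfl⟩ := h
  obtain ⟨k, a, h⟩ := IsLocalization.Away.surj x b
  refine ⟨a, k, ?_⟩
  have hx := algebraMap_mul_invL x y
  have h' := congrArg (locLeft x y) h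
  simp only [map_mul, map_pow, locLeft_algebraMap] at h'
  rw [frac, ← h', pow_zero, mul_one]
  calc locLeft x y b = locLeft x y b * (algebraMap R _ x * invL x y) ^ k := by rw [hx]; ring
    _ = _ := by ring

theorem exists_right (x y : R) (f : Localization.Away (x * y)) (h : f ∈ rightRing x y) :
    ∃ a i, f = frac x y a 0 i := by
  obtain ⟨b, rfl⟩ := h
  obtain ⟨k, a, h⟩ := IsLocalization.Away.surj y b
  refine ⟨a, k, ?_⟩
  have hx := algebraMap_mul_invR x y
  have h' := congrArg (locRight x y) h
  simp only [map_mul, map_pow, locRight_algebraMap] at h'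
  rw [frac, ← h', pow_zero, mul_one]
  calc locRight x y b = locRight x y b * (algebraMap R _ y * invR x y) ^ k := by rw [hx]; ring
    _ = _ := by ring

theorem frac_mem_left (x y a : R) (i : ℕ) : frac x y a i 0 ∈ leftRing x y := by
  rw [frac, pow_zero, mul_one]
  exact mul_mem (algebraMap_mem_left x y a) (pow_mem (invL_mem x y) i)

theorem frac_mem_right (x y a : R) (i : ℕ) : frac x y a 0 i ∈ rightRing x y := by
  rw [frac, pow_zero, mul_one]
  exact mul_mem (algebraMap_mem_right x y a) (pow_mem (invR_mem x y) i)

theorem frac_zero_zero (x y a : R) : frac x y a 0 0 = algebraMap R _ a := by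
  rw [frac, pow_zero, pow_zero, mul_one, mul_one]

theorem mul_frac (x y a : R) (i j : ℕ) :
    algebraMap R _ (x ^ i * y ^ j) * frac x y a i j = algebraMap R _ a := by
  have h := frac_mul_left x y (y ^ j * a) 0 j i
  have h' := frac_mul_right x y a 0 0 j
  rw [zero_add] at h h'
  rw [algebraMap_mul_frac, mul_assoc, h, h', frac_zero_zero]

/-- The vanishing of `H¹`: from `a/x^i = b/y^j` follows `y^j a = x^i b`, and regularity gives `x^i ∣
a`. -/
theorem RegPair.exists_of_mem_left_of_mem_right {x y : R} (h : RegPair x y)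
    {f : Localization.Away (x * y)} (hl : f ∈ leftRing x y) (hr : f ∈ rightRing x y) :
    ∃ a : R, f = algebraMap R _ a := by
  obtain ⟨a, i, rfl⟩ := exists_left x y f hl
  obtain ⟨b, j, e⟩ := exists_right x y _ hr
  have h1 : y ^ j * a = x ^ i * b := by
    apply h.algebraMap_injective
    rw [map_mul, map_mul]
    have h1 := mul_frac x y a i 0
    have h2 := mul_frac x y b 0 j
    rw [← e] at h2
    rw [← h1, ← h2]
    simp only [map_pow, pow_zero, mul_one, one_mul]
    ring
  obtain ⟨c, rfl⟩ := (h.pow i j).dvd a b h1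
  refine ⟨c, ?_⟩
  have := frac_mul_left x y c 0 0 i
  rw [zero_add] at this
  rw [this, frac_zero_zero]

variable {p : ℕ} [hp : Fact p.Prime] {n : ℕ}

theorem cls_frac_eq_zero {x y : R} (α β : R) (i j : ℕ) :
    cls p x y (frac x y (x ^ i * α + y ^ j * β) i j) = 0 := by
  have h1 := frac_mul_left x y α 0 j i
  have h2 := frac_mul_right x y β i 0 j
  rw [zero_add] at h1 h2
  rw [frac_add, h1, h2, map_add, cls_eq_zero_of_right (frac_mem_right ..),
    cls_eq_zero_of_left (frac_mem_left ..), add_zero]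

/-- In other words, `R/(x^i, y^j)` embeds into `H²`. If `a/(x^i y^j) = β/x^N + γ/y^M`, regularity
shows that `x^i y^j γ/y^M` lies in `R` and is divisible by `x^i`, and that `x^i y^j β/x^N` lies in
`R` and is divisible by `y^j`. They add up to `a`. -/
theorem RegPair.cls_frac_eq_zero_iff {x y : R} (h : RegPair x y) (a : R) (i j : ℕ) :
    cls p x y (frac x y a i j) = 0 ↔ ∃ α β, a = x ^ i * α + y ^ j * β := by
  constructor
  · intro e
    obtain ⟨b, c, e⟩ := (cls_eq_zero_iff _ _ _).1 e
    obtain ⟨β, N, hb⟩ := exists_left x y (locLeft x y b) ⟨_, rfl⟩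
    obtain ⟨γ, M, hc⟩ := exists_right x y (locRight x y c) ⟨_, rfl⟩
    rw [hb, hc] at e
    have e1 : x ^ N * y ^ M * a = x ^ i * y ^ j * (y ^ M * β) + x ^ i * y ^ j * (x ^ N * γ) := by
      apply h.algebraMap_injective
      have h1 := mul_frac x y a i j
      have h2 := mul_frac x y β N 0
      have h3 := mul_frac x y γ 0 M
      rw [← e] at h1
      simp only [map_mul, map_add, map_pow, pow_zero, mul_one, one_mul] at h1 h2 h3 ⊢
      rw [← h1, ← h2, ← h3]
      ring
    obtain ⟨γ', hγ⟩ := (h.pow N M).symm.dvd (y ^ M * a - x ^ i * y ^ j * γ) (x ^ i * y ^ j * β)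
      (by linear_combination e1)
    obtain ⟨β', hβ⟩ := (h.pow N M).dvd (x ^ N * a - x ^ i * y ^ j * β) (x ^ i * y ^ j * γ)
      (by linear_combination e1)
    obtain ⟨u, hu⟩ := (h.pow i M).dvd (a - γ') (y ^ j * γ) (by linear_combination hγ)
    obtain ⟨v, hv⟩ := (h.pow N j).symm.dvd (a - β') (x ^ i * β) (by linear_combination hβ)
    -- Here `a - γ'` is `x^i y^j γ/y^M` and `a - β'` is `x^i y^j β/x^N`.
    have : a = (a - γ') + (a - β') := by
      have : x ^ N * y ^ M * (a - ((a - γ') + (a - β'))) = 0 := by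
        linear_combination e1 - x ^ N * hγ - y ^ M * hβ
      have := (h.pow N M).nz_mul _ this
      linear_combination this
    exact ⟨u, v, by rw [← hu, ← hv]; exact this⟩
  · rintro ⟨α, β, rfl⟩
    exact cls_frac_eq_zero α β i j

end RegPair

/-! ### The short exact sequence of Verschiebung and restriction -/

section Exact

variable {p : ℕ} [hp : Fact p.Prime] {n : ℕ} {R S : Type*} [CommRing R] [CommRing S]

theorem eq_wittV_of_truncate_eq_zero (a : TruncatedWittVector p (n + 1) R)
    (h : TruncatedWittVector.truncate n.le_succ a = 0) :
    a = wittV (Nat.le_add_left 1 n) (wittOne p (a.coeff (Fin.last n))) := by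
  apply TruncatedWittVector.ext
  intro i
  rw [coeff_wittV]
  split_ifs with hi
  · rw [coeff_wittOne]
    congr
    apply Fin.ext
    have := i.2
    rw [Fin.val_last]
    omega
  · have hi' : (i : ℕ) < n := by omega
    have := congrArg (TruncatedWittVector.coeff ⟨i, hi'⟩) h
    rw [TruncatedWittVector.coeff_truncate, TruncatedWittVector.coeff_zero] at this
    exact this

theorem truncate_wittV (a : TruncatedWittVector p 1 R) :
    TruncatedWittVector.truncate n.le_succ (wittV (Nat.le_add_left 1 n) a) = 0 := by
  apply TruncatedWittVector.ext
  intro i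
  rw [TruncatedWittVector.coeff_truncate, coeff_wittV, dif_neg, TruncatedWittVector.coeff_zero]
  have := i.2
  simp only [Fin.val_castLE]
  omega

theorem cohR_cohV {x y : R} (z : LocalH2 p 1 x y) :
    cohR n.le_succ x y (cohV (Nat.le_add_left 1 n) x y z) = 0 := by
  obtain ⟨a, rfl⟩ := hmk_surj z
  rw [cohV_hmk, cohR_hmk, truncate_wittV]
  rfl

/-- A cochain that bounds the restriction lifts to length `n + 1`; subtracting its coboundary leaves
a cocycle with only the last component nonzero. -/
theorem exists_cohV_eq_of_cohR_eq_zero {x y : R} (z : LocalH2 p (n + 1) x y)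
    (h : cohR n.le_succ x y z = 0) : ∃ w, cohV (Nat.le_add_left 1 n) x y w = z := by
  obtain ⟨a, rfl⟩ := hmk_surj z
  rw [cohR_hmk, hmk_eq_zero_iff] at h
  obtain ⟨b, c, h⟩ := h
  obtain ⟨b, rfl⟩ := TruncatedWittVector.truncate_surjective n.le_succ b
  obtain ⟨c, rfl⟩ := TruncatedWittVector.truncate_surjective n.le_succ c
  rw [← truncate_wittMap, ← truncate_wittMap, ← map_add] at h
  set d := wittMap p (n + 1) (locLeft x y) b + wittMap p (n + 1) (locRight x y) c with hd
  have h0 : TruncatedWittVector.truncate n.le_succ (a - d) = 0 := by rw [map_sub, h, sub_self]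
  refine ⟨hmk (wittOne p ((a - d).coeff (Fin.last n))), ?_⟩
  rw [cohV_hmk, ← eq_wittV_of_truncate_eq_zero _ h0]
  have : a = (a - d) + d := by abel
  conv_rhs => rw [this]
  rw [hmk_add, (hmk_eq_zero_iff d).2 ⟨b, c, rfl⟩, add_zero]

/-- The obstruction is `H¹(W_n R)`, which vanishes for a regular pair. If `V^n f = b + c`, the
truncations of `b` and `-c` agree, hence have components in `R[1/x] ∩ R[1/y] = R`. Correcting `b`
and `c` by a lift `D` over `R` moves both into the image of `V^n`, where last components can be
compared. -/
theorem cohV_injective {x y : R} (hxy : RegPair x y) :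
    Function.Injective (cohV (Nat.le_add_left 1 n) x y : LocalH2 p 1 x y → LocalH2 p (n + 1) x y) := by
  rw [injective_iff_map_eq_zero]
  intro z hz
  obtain ⟨f, rfl⟩ := cls_surj z
  rw [cls_apply, cohV_hmk, hmk_eq_zero_iff] at hz
  obtain ⟨b, c, e⟩ := hz
  have e' := congrArg (TruncatedWittVector.truncate n.le_succ) e
  rw [truncate_wittV, map_add, add_eq_zero_iff_eq_neg, truncate_wittMap, truncate_wittMap,
    ← map_neg, ← map_neg] at e'
  have hd : ∀ i, ∃ d : R, algebraMap R (Localization.Away (x * y)) d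
      = (wittMap p n (locLeft x y) (TruncatedWittVector.truncate n.le_succ b)).coeff i := by
    intro i
    obtain ⟨d, hd⟩ := hxy.exists_of_mem_left_of_mem_right
      (f := (wittMap p n (locLeft x y) (TruncatedWittVector.truncate n.le_succ b)).coeff i)
      ⟨_, (coeff_wittMap ..).symm⟩ (by rw [e']; exact ⟨_, (coeff_wittMap ..).symm⟩)
    exact ⟨d, hd.symm⟩
  choose d hd using hd
  obtain ⟨D, hD⟩ := TruncatedWittVector.truncate_surjective n.le_succ
    (TruncatedWittVector.mk p d : TruncatedWittVector p n R)
  have hD' : wittMap p n (algebraMap R (Localization.Away (x * y)))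
      (TruncatedWittVector.truncate n.le_succ D)
      = wittMap p n (locLeft x y) (TruncatedWittVector.truncate n.le_succ b) := by
    apply TruncatedWittVector.ext
    intro i
    rw [hD, coeff_wittMap, TruncatedWittVector.coeff_mk, hd]
  set Dl := wittMap p (n + 1) (algebraMap R (Localization.Away x)) D with hDl
  set Dr := wittMap p (n + 1) (algebraMap R (Localization.Away y)) D with hDr
  have hl : wittMap p (n + 1) (locLeft x y) Dl = wittMap p (n + 1) (algebraMap R _) D := by
    rw [hDl, wittMap_wittMap, locLeft_comp]
  have hr : wittMap p (n + 1) (locRight x y) Dr = wittMap p (n + 1) (algebraMap R _) D := by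
    rw [hDr, wittMap_wittMap, locRight_comp]
  have hb := eq_wittV_of_truncate_eq_zero (wittMap p (n + 1) (locLeft x y) (b - Dl)) (by
    rw [map_sub, hl, map_sub, truncate_wittMap, truncate_wittMap, hD', sub_self])
  have hc := eq_wittV_of_truncate_eq_zero (wittMap p (n + 1) (locRight x y) (c + Dr)) (by
    rw [map_add, hr, map_add, truncate_wittMap, truncate_wittMap, hD', e', map_neg, map_neg,
      add_neg_cancel])
  have key : wittV (Nat.le_add_left 1 n) (wittOne p f)
      = wittMap p (n + 1) (locLeft x y) (b - Dl) + wittMap p (n + 1) (locRight x y) (c + Dr) := by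
    rw [← e, map_sub, map_add, hl, hr]; abel
  rw [hb, hc, ← map_add, ← map_add] at key
  have := congrArg (TruncatedWittVector.coeff (Fin.last n)) key
  rw [coeff_wittV, coeff_wittV, dif_pos (by simp), dif_pos (by simp), coeff_wittOne,
    coeff_wittOne, coeff_wittMap, coeff_wittMap] at this
  rw [this]
  exact (cls_eq_zero_iff _ _ _).2 ⟨_, _, rfl⟩

theorem subsingleton_zero {x y : R} (z w : LocalH2 p 0 x y) : z = w := by
  obtain ⟨a, rfl⟩ := hmk_surj z
  obtain ⟨b, rfl⟩ := hmk_surj w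
  congr 1
  exact TruncatedWittVector.ext fun i => i.elim0

/-- Four-lemma induction along the sequence of `V^n` and restriction. The target pair must be
regular so that `V^n` is injective there; the surjective counterpart needs only exactness in the
middle and surjectivity of restriction. -/
theorem cechMap_injective_of_one {g : R →+* S} {x y : R} {x' y' : S} (h : IsCechHom g x y x' y')
    (hxy : RegPair x' y') (h1 : Function.Injective (cechMap p 1 h)) :
    ∀ n, Function.Injective (cechMap p n h) := by
  intro n
  induction n with
  | zero => exact fun a b _ => subsingleton_zero a b
  | succ n ih =>
    rw [injective_iff_map_eq_zero] at h1 ih ⊢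
    intro z hz
    have hR : cohR n.le_succ x y z = 0 := ih _ (by rw [cechMap_cohR, hz, map_zero])
    obtain ⟨w, rfl⟩ := exists_cohV_eq_of_cohR_eq_zero z hR
    rw [cechMap_cohV] at hz
    rw [h1 w (cohV_injective hxy (by rw [hz, map_zero])), map_zero]

theorem cechMap_surjective_of_one {g : R →+* S} {x y : R} {x' y' : S} (h : IsCechHom g x y x' y')
    (h1 : Function.Surjective (cechMap p 1 h)) :
    ∀ n, Function.Surjective (cechMap p n h) := by
  intro n
  induction n with
  | zero => exact fun a => ⟨0, subsingleton_zero _ a⟩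
  | succ n ih =>
    intro z
    obtain ⟨w, hw⟩ := ih (cohR n.le_succ x' y' z)
    obtain ⟨w, rfl⟩ := cohR_surjective n.le_succ x y w
    obtain ⟨v, hv⟩ := exists_cohV_eq_of_cohR_eq_zero (z - cechMap p (n + 1) h w) (by
      rw [map_sub, ← cechMap_cohR, hw, sub_self])
    obtain ⟨v, rfl⟩ := h1 v
    refine ⟨w + cohV (Nat.le_add_left 1 n) x y v, ?_⟩
    rw [map_add, cechMap_cohV, hv]
    abel

end Exact

/-! ### Independence of the choice of parameters -/

section ChangeOfParameters

variable {p : ℕ} [hp : Fact p.Prime] {n : ℕ} {R S : Type*} [CommRing R] [CommRing S]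

/-- The fraction `a/d` has both `x` and `y` as denominators, so regularity of the pair makes it an
element of the ring. -/
theorem RegPair.dvd_of_dvd_mul {x y d a : R} (h : RegPair x y) (hd : ∀ b, d * b = 0 → b = 0)
    (hx : d ∣ x * a) (hy : d ∣ y * a) : d ∣ a := by
  obtain ⟨u, hu⟩ := hx
  obtain ⟨v, hv⟩ := hy
  have h1 : y * u = x * v := by
    have := hd (y * u - x * v) (by linear_combination y * (-hu) + x * hv)
    linear_combination this
  obtain ⟨c, rfl⟩ := h.dvd u v h1
  exact ⟨c, h.cancel_left (by rw [hu]; ring)⟩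

theorem RegPair.one_left {x y : R} (h : RegPair x y) : RegPair 1 y where
  nzl a e := by rwa [one_mul] at e
  nzr := h.nzr
  dvd a _ _ := one_dvd a

theorem IsCechHom.loc_frac_self_map (g : R →+* S) (x y a : R) (i j : ℕ) :
    (IsCechHom.self_map g x y).loc (frac x y a i j) = frac (g x) (g y) (g a) i j := by
  set h := IsCechHom.self_map g x y
  have h1 : h.loc (invL x y) = invL (g x) (g y) := by
    have e := congrArg h.loc (algebraMap_mul_invL x y)
    rw [map_mul, h.loc_algebraMap, map_one] at e
    have e' := algebraMap_mul_invL (g x) (g y)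
    linear_combination invL (g x) (g y) * e - h.loc (invL x y) * e'
  have h2 : h.loc (invR x y) = invR (g x) (g y) := by
    have e := congrArg h.loc (algebraMap_mul_invR x y)
    rw [map_mul, h.loc_algebraMap, map_one] at e
    have e' := algebraMap_mul_invR (g x) (g y)
    linear_combination invR (g x) (g y) * e - h.loc (invR x y) * e'
  rw [frac, frac, map_mul, map_mul, map_pow, map_pow, h1, h2, h.loc_algebraMap]

theorem loc_frac_of_dvd {x y x' y' c d : R} (hx : x' = x * c) (hy : y' = y * d) (a : R) (i j : ℕ) :
    (IsCechHom.of_dvd (Dvd.intro c hx.symm) (Dvd.intro d hy.symm)).loc (frac x y a i j)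
      = frac x' y' (c ^ i * d ^ j * a) i j := by
  set h := IsCechHom.of_dvd (Dvd.intro c hx.symm) (Dvd.intro d hy.symm)
  have h1 : h.loc (invL x y) = algebraMap R _ c * invL x' y' := by
    have e := congrArg h.loc (algebraMap_mul_invL x y)
    rw [map_mul, h.loc_algebraMap, map_one, RingHom.id_apply] at e
    have e' := algebraMap_mul_invL x' y'
    rw [hx, map_mul, ← hx] at e'
    linear_combination algebraMap R _ c * invL x' y' * e - h.loc (invL x y) * e'
  have h2 : h.loc (invR x y) = algebraMap R _ d * invR x' y' := by
    have e := congrArg h.loc (algebraMap_mul_invR x y)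
    rw [map_mul, h.loc_algebraMap, map_one, RingHom.id_apply] at e
    have e' := algebraMap_mul_invR x' y'
    rw [hy, map_mul, ← hy] at e'
    linear_combination algebraMap R _ d * invR x' y' * e - h.loc (invR x y) * e'
  rw [frac, frac, map_mul, map_mul, map_pow, map_pow, h1, h2, h.loc_algebraMap]
  simp only [map_mul, map_pow, RingHom.id_apply]
  ring

/-- The map sends `a/(x^i y^i)` to `c^i d^i a/(x'^i y'^i)`. Membership of the new numerator in
`(x'^i, y'^i)` descends to `a ∈ (x^i, y^i)` by cancelling first `c^i`, then `d^i`. -/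
theorem cechMap_of_dvd_injective {x y x' y' c d : R} (hx : x' = x * c) (hy : y' = y * d)
    (h : RegPair x y) (h' : RegPair x' y') (hc : RegPair c y') (hd : RegPair d x) :
    Function.Injective
      (cechMap p 1 (IsCechHom.of_dvd (Dvd.intro c hx.symm) (Dvd.intro d hy.symm))) := by
  rw [injective_iff_map_eq_zero]
  intro z hz
  obtain ⟨f, rfl⟩ := cls_surj z
  obtain ⟨a, i, rfl⟩ := exists_frac x y f
  rw [cechMap_cls, loc_frac_of_dvd hx hy, h'.cls_frac_eq_zero_iff] at hz
  obtain ⟨α, β, e⟩ := hz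
  rw [h.cls_frac_eq_zero_iff]
  rw [hx, mul_pow] at e
  obtain ⟨β', rfl⟩ := (hc.pow i i).dvd β (d ^ i * a - x ^ i * α) (by linear_combination -e)
  have e2 : d ^ i * a = x ^ i * α + y' ^ i * β' := by
    apply (hc.pow i 1).cancel_left
    linear_combination e
  rw [hy, mul_pow] at e2
  obtain ⟨α', rfl⟩ := (hd.pow i i).dvd α (a - y ^ i * β') (by linear_combination -e2)
  refine ⟨α', β', (hd.pow i 1).cancel_left ?_⟩
  linear_combination e2

/-- By the hypothesis, once the exponents are enlarged by `m`, a numerator over `x', y'` becomes a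
multiple of `c^(i+m) d^(i+m)`, the shape of the numerators coming from `x, y`, up to an element of
`(x'^(i+m), y'^(i+m))`. -/
theorem cechMap_of_dvd_surjective {x y x' y' c d : R} (hx : x' = x * c) (hy : y' = y * d)
    (h : ∀ i, ∃ m α β γ, x ^ m * y ^ m =
      c ^ i * d ^ i * α + x ^ (i + m) * c ^ i * β + y ^ (i + m) * d ^ i * γ) :
    Function.Surjective
      (cechMap p 1 (IsCechHom.of_dvd (Dvd.intro c hx.symm) (Dvd.intro d hy.symm))) := by
  intro z
  obtain ⟨f, rfl⟩ := cls_surj z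
  obtain ⟨a, i, rfl⟩ := exists_frac x' y' f
  obtain ⟨m, α, β, γ, e⟩ := h i
  refine ⟨cls p x y (frac x y (a * α) (i + m) (i + m)), ?_⟩
  rw [cechMap_cls, loc_frac_of_dvd hx hy]
  rw [← frac_mul_left x' y' a i i m, ← frac_mul_right x' y' _ (i + m) i m]
  have e2 : y' ^ m * (x' ^ m * a) = c ^ (i + m) * d ^ (i + m) * (a * α)
      + (x' ^ (i + m) * (β * a * d ^ m) + y' ^ (i + m) * (γ * a * c ^ m)) := by
    rw [hx, hy]
    simp only [mul_pow, pow_add] at e ⊢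
    linear_combination c ^ m * d ^ m * a * e
  rw [e2, frac_add, map_add, cls_frac_eq_zero, add_zero]

theorem wittMap_id (r : TruncatedWittVector p n R) : wittMap p n (RingHom.id R) r = r := by
  apply TruncatedWittVector.ext
  intro i
  rw [coeff_wittMap, RingHom.id_apply]

/-- Krull's principal ideal theorem in a quotient by a prime. -/
theorem not_chain_of_mem_minimalPrimes [IsNoetherianRing R] {P₀ P M : Ideal R} [P₀.IsPrime]
    [P.IsPrime] [M.IsPrime] {y : R} (hm : M ∈ (P₀ ⊔ Ideal.span {y}).minimalPrimes) (h₀ : P₀ < P)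
    (h₁ : P < M) : False := by
  have hht := Ideal.map_height_le_one_of_mem_minimalPrimes hm
  have hker : RingHom.ker (Ideal.Quotient.mk P₀) = P₀ := Ideal.mk_ker
  have hsurj := Ideal.Quotient.mk_surjective (I := P₀)
  have hPP : (P.map (Ideal.Quotient.mk P₀)).IsPrime :=
    Ideal.map_isPrime_of_surjective hsurj (by rw [hker]; exact h₀.le)
  have hmP : (M.map (Ideal.Quotient.mk P₀)).IsPrime :=
    Ideal.map_isPrime_of_surjective hsurj (by rw [hker]; exact h₀.le.trans h₁.le)
  have key : ∀ {I J : Ideal R}, P₀ ≤ I → I < J →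
      I.map (Ideal.Quotient.mk P₀) < J.map (Ideal.Quotient.mk P₀) := by
    intro I J hI hIJ
    refine lt_of_le_of_ne (Ideal.map_mono hIJ.le) fun h0 => hIJ.ne ?_
    have := congrArg (Ideal.comap (Ideal.Quotient.mk P₀)) h0
    rwa [Ideal.comap_map_of_surjective' _ hsurj, Ideal.comap_map_of_surjective' _ hsurj, hker,
      sup_eq_left.2 hI, sup_eq_left.2 (hI.trans hIJ.le)] at this
  have h3 := Ideal.height_add_one_le_of_lt_of_isPrime (lt_of_le_of_lt bot_le (key le_rfl h₀))
  have h4 := Ideal.height_add_one_le_of_lt_of_isPrime (key h₀.le h₁)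
  have h5 : (⊥ : Ideal (R ⧸ P₀)).height + 1 + 1 ≤ 1 := (add_le_add_left h3 1).trans (h4.trans hht)
  have h6 : (0 : ℕ∞) + 1 + 1 ≤ 1 := le_trans (by gcongr; exact zero_le) h5
  norm_num at h6

variable (p) in
/-- A family of isomorphisms between the groups `H²(W_n R)` computed with `x, y` and with `x', y'`,
compatible with all the structure. -/
structure CechEquiv [CharP R p] (x y x' y' : R) where
  /-- the isomorphism in length `n` -/
  equiv : ∀ n, LocalH2 p n x y ≃+ LocalH2 p n x' y'
  smul : ∀ n (r : TruncatedWittVector p n R) z, equiv n (r • z) = r • equiv n z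
  restr : ∀ {m n} (h : m ≤ n) z, equiv m (cohR h x y z) = cohR h x' y' (equiv n z)
  versch : ∀ {m n} (h : m ≤ n) z, equiv n (cohV h x y z) = cohV h x' y' (equiv m z)
  frob : ∀ n z, equiv n (cechMap p n (IsCechHom.frobenius x y) z)
    = cechMap p n (IsCechHom.frobenius x' y') (equiv n z)

namespace CechEquiv

variable [CharP R p] {x y x' y' x'' y'' : R}

/-- The inverse family. -/
def symm (e : CechEquiv p x y x' y') : CechEquiv p x' y' x y where
  equiv n := (e.equiv n).symm
  smul n r z := by
    obtain ⟨z, rfl⟩ := (e.equiv n).surjective z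
    rw [← e.smul, AddEquiv.symm_apply_apply, AddEquiv.symm_apply_apply]
  restr {m n} h z := by
    obtain ⟨z, rfl⟩ := (e.equiv n).surjective z
    rw [← e.restr, AddEquiv.symm_apply_apply, AddEquiv.symm_apply_apply]
  versch {m n} h z := by
    obtain ⟨z, rfl⟩ := (e.equiv m).surjective z
    rw [← e.versch, AddEquiv.symm_apply_apply, AddEquiv.symm_apply_apply]
  frob n z := by
    obtain ⟨z, rfl⟩ := (e.equiv n).surjective z
    rw [← e.frob, AddEquiv.symm_apply_apply, AddEquiv.symm_apply_apply]

/-- The composite family. -/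
def trans (e : CechEquiv p x y x' y') (f : CechEquiv p x' y' x'' y'') :
    CechEquiv p x y x'' y'' where
  equiv n := (e.equiv n).trans (f.equiv n)
  smul n r z := by simp only [AddEquiv.trans_apply, e.smul, f.smul]
  restr h z := by simp only [AddEquiv.trans_apply, e.restr, f.restr]
  versch h z := by simp only [AddEquiv.trans_apply, e.versch, f.versch]
  frob n z := by simp only [AddEquiv.trans_apply, e.frob, f.frob]

/-- The family of maps induced by a refinement that is an isomorphism in length one. -/
def ofCechMap (h : IsCechHom (RingHom.id R) x y x' y') (hr : RegPair x' y')
    (hi : Function.Injective (cechMap p 1 h)) (hs : Function.Surjective (cechMap p 1 h)) :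
    CechEquiv p x y x' y' where
  equiv n := AddEquiv.ofBijective (cechMap p n h)
    ⟨cechMap_injective_of_one h hr hi n, cechMap_surjective_of_one h hs n⟩
  smul n r z := by
    change cechMap p n h (r • z) = r • cechMap p n h z
    rw [cechMap_smul, wittMap_id]
  restr hm z := cechMap_cohR hm h z
  versch hm z := cechMap_cohV hm h z
  frob n z := cechMap_comm (IsCechHom.frobenius x y) h h (IsCechHom.frobenius x' y')
    (fun _ => rfl) z

end CechEquiv

/-- `x, y` is a regular system of length two that generates an ideal primary for the maximal
ideal. -/
structure ParamPair [IsLocalRing R] (x y : R) : Prop extends RegPair x y where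
  memL : x ∈ maximalIdeal R
  memR : y ∈ maximalIdeal R
  primary : ∃ N, maximalIdeal R ^ N ≤ Ideal.span {x, y}

namespace ParamPair

variable [IsLocalRing R] {x y s t : R}

theorem exists_pow_mem (h : ParamPair x y) {a : R} (ha : a ∈ maximalIdeal R) (i j : ℕ) :
    ∃ N, a ^ N ∈ Ideal.span {x ^ i, y ^ j} := by
  obtain ⟨N, hN⟩ := h.primary
  obtain ⟨α, β, e⟩ := Ideal.mem_span_pair.1 (hN (Ideal.pow_mem_pow ha N))
  refine ⟨N * (i + j), ?_⟩
  rw [pow_mul, ← e]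
  apply Ideal.add_pow_mem_of_pow_mem_of_le _ (m := i) (n := j)
  · rw [mul_pow]
    exact Ideal.mul_mem_left _ _ (Ideal.subset_span (by simp))
  · rw [mul_pow]
    exact Ideal.mul_mem_left _ _ (Ideal.subset_span (by simp))
  · omega

theorem primary_pow (h : ParamPair x y) (hfg : (maximalIdeal R).FG) (i j : ℕ) :
    ∃ N, maximalIdeal R ^ N ≤ Ideal.span {x ^ i, y ^ j} := by
  apply Ideal.exists_pow_le_of_le_radical_of_fg _ hfg
  intro a ha
  exact h.exists_pow_mem ha i j

/-- Multiplying the second parameter by another one. -/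
def refineRight [CharP R p] {y' Y : R} (hY : Y = y * y') (h : ParamPair x y) (h' : ParamPair x y') :
    CechEquiv p x y x Y := by
  have hr : RegPair x Y := hY ▸ h.toRegPair.mul_right h'.toRegPair
  have hx : x = x * 1 := (mul_one x).symm
  refine CechEquiv.ofCechMap (IsCechHom.of_dvd (Dvd.intro 1 hx.symm) (Dvd.intro y' hY.symm)) hr
    (cechMap_of_dvd_injective hx hY h.toRegPair hr (hr.one_left) h'.toRegPair.symm)
    (cechMap_of_dvd_surjective hx hY fun i => ?_)
  obtain ⟨m, hm⟩ := h'.exists_pow_mem h.memR i i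
  obtain ⟨α, β, e⟩ := Ideal.mem_span_pair.1 hm
  refine ⟨m, x ^ m * β, α, 0, ?_⟩
  rw [← e, one_pow, pow_add]
  ring

/-- Multiplying the first parameter by another one. -/
def refineLeft [CharP R p] {x' X : R} (hX : X = x * x') (h : ParamPair x y) (h' : ParamPair x' y) :
    CechEquiv p x y X y := by
  have hr : RegPair X y := hX ▸ h.toRegPair.mul_left h'.toRegPair
  have hy : y = y * 1 := (mul_one y).symm
  refine CechEquiv.ofCechMap (IsCechHom.of_dvd (Dvd.intro x' hX.symm) (Dvd.intro 1 hy.symm)) hr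
    (cechMap_of_dvd_injective hX hy h.toRegPair hr h'.toRegPair h.toRegPair.symm.one_left)
    (cechMap_of_dvd_surjective hX hy fun i => ?_)
  obtain ⟨m, hm⟩ := h'.exists_pow_mem h.memL i i
  obtain ⟨α, β, e⟩ := Ideal.mem_span_pair.1 hm
  refine ⟨m, y ^ m * α, 0, β, ?_⟩
  rw [← e, one_pow, pow_add]
  ring

/-- Changing the second parameter. -/
def changeRight [CharP R p] {y' : R} (h : ParamPair x y) (h' : ParamPair x y') :
    CechEquiv p x y x y' :=
  (refineRight rfl h h').trans (refineRight (mul_comm y y') h' h).symm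

/-- Changing the first parameter. -/
def changeLeft [CharP R p] {x' : R} (h : ParamPair x y) (h' : ParamPair x' y) :
    CechEquiv p x y x' y :=
  (refineLeft rfl h h').trans (refineLeft (mul_comm x x') h' h).symm

/-- Depth two does not depend on the pair: if `t a = s b`, then `s` divides `r^N a` for every `r ∈
𝔪`, in particular for `r = x` and `r = y`, hence divides `a`. -/
theorem of_primary_of_nz (h : ParamPair x y) (hs : s ∈ maximalIdeal R) (ht : t ∈ maximalIdeal R)
    (hp : ∃ N, maximalIdeal R ^ N ≤ Ideal.span {s, t}) (hs0 : ∀ a, s * a = 0 → a = 0)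
    (ht0 : ∀ a, t * a = 0 → a = 0) : ParamPair s t := by
  refine ⟨⟨hs0, ht0, fun a b e => ?_⟩, hs, ht, hp⟩
  obtain ⟨N, hN⟩ := hp
  have key : ∀ r ∈ maximalIdeal R, s ∣ r ^ N * a := by
    intro r hr
    obtain ⟨α, β, e'⟩ := Ideal.mem_span_pair.1 (hN (Ideal.pow_mem_pow hr N))
    exact ⟨α * a + β * b, by rw [← e']; linear_combination β * e⟩
  exact (h.toRegPair.pow N N).dvd_of_dvd_mul hs0 (key x h.memL) (key y h.memR)

/-- In a Noetherian local ring, the first element of an `𝔪`-primary pair may be kept and the second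
replaced by any element of `𝔪` that lies in no minimal prime of the first. -/
theorem of_notMem_minimalPrimes [IsNoetherianRing R] {w : R} (h : ParamPair x y)
    (hw : w ∈ maximalIdeal R) (hmin : ∀ P ∈ (Ideal.span {x}).minimalPrimes, w ∉ P) :
    ParamPair x w := by
  have hprim : ∃ N, maximalIdeal R ^ N ≤ Ideal.span {x, w} := by
    apply Ideal.exists_pow_le_of_le_radical_of_fg _ (IsNoetherian.noetherian _)
    rw [Ideal.radical_eq_sInf]
    refine le_sInf ?_
    rintro P ⟨hP, hPp⟩
    -- A prime `P` over `(x, w)` strictly contains a minimal prime `P₀` of `(x)`, while `𝔪` is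
    -- minimal over `P₀ + (y)`. If `P ≠ 𝔪`, the chain `P₀ < P < 𝔪` contradicts the principal ideal
    -- theorem.
    obtain ⟨P₀, hP₀, hle⟩ := Ideal.exists_minimalPrimes_le
      (show Ideal.span {x} ≤ P from le_trans (Ideal.span_mono (by simp)) hP)
    have hwP : w ∈ P := hP (Ideal.subset_span (by simp))
    have hwP₀ := hmin P₀ hP₀
    have hxP₀ : x ∈ P₀ := hP₀.1.2 (Ideal.subset_span rfl)
    have := hP₀.1.1
    by_contra hne
    have hlt : P < maximalIdeal R := lt_of_le_not_ge (le_maximalIdeal hPp.ne_top) hne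
    have hm : maximalIdeal R ∈ (P₀ ⊔ Ideal.span {y}).minimalPrimes := by
      refine ⟨⟨inferInstance, sup_le (le_maximalIdeal hP₀.1.1.ne_top)
        ((Ideal.span_singleton_le_iff_mem _).2 h.memR)⟩, ?_⟩
      rintro J ⟨hJ, hJ'⟩ -
      obtain ⟨N, hN⟩ := h.primary
      refine hJ.le_of_pow_le (hN.trans ?_)
      rw [Ideal.span_le]
      rintro z (rfl | rfl)
      · exact hJ' (Ideal.mem_sup_left hxP₀)
      · exact hJ' (Ideal.mem_sup_right (Ideal.subset_span rfl))
    exact not_chain_of_mem_minimalPrimes hm (lt_of_le_of_ne hle fun e => hwP₀ (e ▸ hwP)) hlt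
  have hw0 : ∀ a, w * a = 0 → a = 0 := by
    intro a ha
    obtain ⟨N, hN⟩ := hprim
    obtain ⟨α, β, e⟩ := Ideal.mem_span_pair.1 (hN (Ideal.pow_mem_pow h.memR N))
    -- If `w b = 0`, then `y^N b = α x b`, so `x ∣ b` and the quotient is again killed by `w`.
    -- Iterating puts `a` into every power of `𝔪`, and Krull's intersection theorem applies.
    have key : ∀ i : ℕ, ∃ b, a = x ^ i * b ∧ w * b = 0 := by
      intro i
      induction i with
      | zero => exact ⟨a, by rw [pow_zero, one_mul], ha⟩
      | succ i ih =>
        obtain ⟨b, rfl, hb⟩ := ih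
        obtain ⟨c, rfl⟩ := (h.toRegPair.pow_right N).dvd b (α * b)
          (by rw [← e]; linear_combination β * hb)
        exact ⟨c, by ring, h.nzl _ (by linear_combination hb)⟩
    have hbot := Ideal.iInf_pow_eq_bot_of_isLocalRing (maximalIdeal R) (maximalIdeal.isMaximal R).ne_top
    rw [← Ideal.mem_bot, ← hbot, Ideal.mem_iInf]
    intro i
    obtain ⟨b, rfl, -⟩ := key i
    exact Ideal.mul_mem_right _ _ (Ideal.pow_mem_pow h.memL i)
  exact h.of_primary_of_nz h.memL hw hprim h.nzl hw0

/-- Prime avoidance for the finitely many minimal primes of `(x)` and `(s)`. None of them is `𝔪`,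
since otherwise a power of the second parameter would be a multiple of the first. -/
theorem exists_common [IsNoetherianRing R] (h : ParamPair x y) (h' : ParamPair s t) :
    ∃ w, ParamPair x w ∧ ParamPair s w := by
  have hf := (Ideal.finite_minimalPrimes_of_isNoetherianRing R (Ideal.span {x})).union
    (Ideal.finite_minimalPrimes_of_isNoetherianRing R (Ideal.span {s}))
  have hne : ∀ {x y : R}, ParamPair x y → ∀ P ∈ (Ideal.span {x}).minimalPrimes,
      ¬ maximalIdeal R ≤ P := by
    intro x y h P hP hle
    have hPp := hP.1.1
    obtain rfl : P = maximalIdeal R := le_antisymm (le_maximalIdeal hPp.ne_top) hle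
    have hy : y ∈ (Ideal.span {x}).radical := by
      rw [Ideal.radical_eq_sInf, Submodule.mem_sInf]
      rintro J ⟨hJ, hJ'⟩
      exact hP.2 ⟨hJ', hJ⟩ (le_maximalIdeal hJ'.ne_top) h.memR
    obtain ⟨k, hk⟩ := hy
    obtain ⟨c, hc⟩ := Ideal.mem_span_singleton'.1 hk
    have := (h.toRegPair.pow_right k).dvd 1 c (by rw [← hc]; ring)
    exact (mem_nonunits_iff.1 ((mem_maximalIdeal x).1 h.memL)) (isUnit_of_dvd_one this)
  have hnot : ¬ ((maximalIdeal R : Set R) ⊆ ⋃ i ∈ (↑hf.toFinset : Set (Ideal R)), (i : Set R)) := by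
    intro hsub
    refine absurd ((Ideal.subset_union_prime (s := hf.toFinset) (f := fun i : Ideal R => i) ⊥ ⊥ ?_).1
      hsub) ?_
    rotate_left
    · rintro ⟨P, hP, hle⟩
      rw [Set.Finite.mem_toFinset] at hP
      rcases hP with hP | hP
      · exact hne h P hP hle
      · exact hne h' P hP hle
    · intro P hP _ _
      rw [Set.Finite.mem_toFinset] at hP
      rcases hP with hP | hP <;> exact hP.1.1
  obtain ⟨w, hw, hw'⟩ := Set.not_subset.1 hnot
  simp only [Set.mem_iUnion, not_exists, Set.Finite.coe_toFinset] at hw'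
  exact ⟨w, h.of_notMem_minimalPrimes hw fun P hP => hw' P (Or.inl hP),
    h'.of_notMem_minimalPrimes hw fun P hP => hw' P (Or.inr hP)⟩

/-- One parameter changes at a time: `(x, y)`, `(x, w)`, `(s, w)`, `(s, t)`. -/
theorem nonempty_cechEquiv [IsNoetherianRing R] [CharP R p] (h : ParamPair x y)
    (h' : ParamPair s t) : Nonempty (CechEquiv p x y s t) := by
  obtain ⟨w, h₁, h₂⟩ := h.exists_common h'
  exact ⟨(changeRight h h₁).trans ((changeLeft h₁ h₂).trans (changeRight h₂ h'))⟩

end ParamPair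

end ChangeOfParameters

/-! ### Socles, and injectivity of Frobenius for regular rings -/

section Socle

variable {p : ℕ} [hp : Fact p.Prime] {n : ℕ} {R : Type*} [CommRing R]

theorem loc_frobenius_frac [CharP R p] (x y a : R) (i j : ℕ) :
    (IsCechHom.frobenius (p := p) x y).loc (frac x y a i j) = frac x y (a ^ p) (i * p) (j * p) := by
  set h := IsCechHom.frobenius (p := p) x y
  have hx := algebraMap_mul_invL x y
  have hy := algebraMap_mul_invR x y
  have h1 : h.loc (invL x y) = invL x y ^ p := by
    have e := congrArg h.loc hx
    rw [map_mul, h.loc_algebraMap, map_one, frobenius_def, map_pow] at e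
    have e' : algebraMap R _ x ^ p * invL x y ^ p = 1 := by rw [← mul_pow, hx, one_pow]
    linear_combination invL x y ^ p * e - h.loc (invL x y) * e'
  have h2 : h.loc (invR x y) = invR x y ^ p := by
    have e := congrArg h.loc hy
    rw [map_mul, h.loc_algebraMap, map_one, frobenius_def, map_pow] at e
    have e' : algebraMap R _ y ^ p * invR x y ^ p = 1 := by rw [← mul_pow, hy, one_pow]
    linear_combination invR x y ^ p * e - h.loc (invR x y) * e'
  rw [frac, frac, map_mul, map_mul, map_pow, map_pow, h1, h2, h.loc_algebraMap, frobenius_def,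
    ← pow_mul, ← pow_mul, mul_comm p i, mul_comm p j]

/-- A class killed by both parameters is of the form `α / (st)`. -/
theorem RegPair.exists_cls_frac_one_one {s t : R} (h : RegPair s t) (z : LocalH2 p 1 s t)
    (hs : wittOne p s • z = 0) (ht : wittOne p t • z = 0) :
    ∃ α, z = cls p s t (frac s t α 1 1) := by
  obtain ⟨f, rfl⟩ := cls_surj z
  obtain ⟨q, i, rfl⟩ := exists_frac s t f
  rw [← frac_mul_left s t q i i 1, ← frac_mul_right s t _ (i + 1) i 1] at hs ht ⊢
  generalize t ^ 1 * (s ^ 1 * q) = q at hs ht ⊢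
  rw [smul_cls, algebraMap_mul_frac, h.cls_frac_eq_zero_iff] at hs
  obtain ⟨α, β, e⟩ := hs
  obtain ⟨β', rfl⟩ := (h.pow_right (i + 1)).dvd β (q - s ^ i * α) (by linear_combination -e)
  have hq : q = s ^ i * α + t ^ (i + 1) * β' := h.cancel_left (by linear_combination e)
  have hz : cls p s t (frac s t q (i + 1) (i + 1)) = cls p s t (frac s t α 1 (i + 1)) := by
    have h1 := frac_mul_left s t α 1 (i + 1) i
    have h2 := frac_mul_right s t β' (i + 1) 0 (i + 1)
    rw [add_comm 1 i] at h1
    rw [zero_add] at h2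
    rw [hq, frac_add, map_add, h1, h2, cls_eq_zero_of_left (frac_mem_left ..), add_zero]
  rw [hz] at ht ⊢
  rw [smul_cls, algebraMap_mul_frac, h.cls_frac_eq_zero_iff] at ht
  obtain ⟨γ, δ, e⟩ := ht
  obtain ⟨ε, hε⟩ := h.dvd (α - t ^ i * δ) γ (by linear_combination e)
  refine ⟨δ, ?_⟩
  have hα : α = s ^ 1 * ε + t ^ i * δ := by linear_combination hε
  have h1 := frac_mul_left s t ε 0 (i + 1) 1
  have h2 := frac_mul_right s t δ 1 1 i
  rw [zero_add] at h1
  rw [add_comm 1 i] at h2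
  rw [hα, frac_add, map_add, h1, h2, cls_eq_zero_of_right (frac_mem_right ..), zero_add]

theorem ParamPair.exists_pow_smul_eq_zero [IsLocalRing R] {s t : R} (h : ParamPair s t)
    (hfg : (maximalIdeal R).FG) (z : LocalH2 p 1 s t) :
    ∃ N, ∀ r ∈ maximalIdeal R ^ N, wittOne p r • z = 0 := by
  obtain ⟨f, rfl⟩ := cls_surj z
  obtain ⟨q, i, rfl⟩ := exists_frac s t f
  obtain ⟨N, hN⟩ := h.primary_pow hfg i i
  refine ⟨N, fun r hr => ?_⟩
  obtain ⟨α, β, rfl⟩ := Ideal.mem_span_pair.1 (hN hr)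
  rw [smul_cls, algebraMap_mul_frac,
    show (α * s ^ i + β * t ^ i) * q = s ^ i * (α * q) + t ^ i * (β * q) by ring, cls_frac_eq_zero]

/-- A nonzero class has a nonzero multiple killed by the maximal ideal. -/
theorem ParamPair.exists_smul_socle [IsLocalRing R] {s t : R} (h : ParamPair s t)
    (hfg : (maximalIdeal R).FG) (z : LocalH2 p 1 s t) (hz : z ≠ 0) :
    ∃ c : R, wittOne p c • z ≠ 0 ∧ ∀ r ∈ maximalIdeal R, wittOne p r • (wittOne p c • z) = 0 := by
  classical
  have hex := h.exists_pow_smul_eq_zero hfg z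
  have hN := Nat.find_spec hex
  have hmin := fun m => @Nat.find_min _ _ hex m
  set N := Nat.find hex
  have hN0 : N ≠ 0 := by
    intro h0
    rw [h0, pow_zero, Ideal.one_eq_top] at hN
    have := hN 1 trivial
    rw [map_one, one_smul] at this
    exact hz this
  obtain ⟨M, hM⟩ := Nat.exists_eq_succ_of_ne_zero hN0
  have := hmin M (by omega)
  push Not at this
  obtain ⟨c, hc, hcz⟩ := this
  refine ⟨c, hcz, fun r hr => ?_⟩
  rw [smul_smul, ← map_mul]
  apply hN
  rw [hM, pow_succ']
  exact Ideal.mul_mem_mul hr hc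

section Regular

variable [IsLocalRing R] {u v : R} (h : RegPair u v) (hm : maximalIdeal R = Ideal.span {u, v})
include h hm

theorem RegPair.paramPair_of_span_eq : ParamPair u v where
  toRegPair := h
  memL := hm ▸ Ideal.subset_span (by simp)
  memR := hm ▸ Ideal.subset_span (by simp)
  primary := ⟨1, by rw [pow_one, hm]⟩

/-- Since `R/(u, v)` is the residue field, a numerator over `uv` that is not a unit gives the zero
class. -/
theorem exists_unit_cls_frac (z : LocalH2 p 1 u v) (hz : z ≠ 0)
    (hz' : ∀ r ∈ maximalIdeal R, wittOne p r • z = 0) :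
    ∃ α, IsUnit α ∧ z = cls p u v (frac u v α 1 1) := by
  have hP := h.paramPair_of_span_eq hm
  obtain ⟨α, rfl⟩ := h.exists_cls_frac_one_one z (hz' u hP.memL) (hz' v hP.memR)
  refine ⟨α, ?_, rfl⟩
  by_contra hα
  have : α ∈ maximalIdeal R := (mem_maximalIdeal α).2 hα
  rw [hm] at this
  obtain ⟨a, b, rfl⟩ := Ideal.mem_span_pair.1 this
  apply hz
  have := cls_frac_eq_zero (p := p) (x := u) (y := v) a b 1 1
  rwa [show u ^ 1 * a + v ^ 1 * b = a * u + b * v by ring] at this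

theorem exists_smul_eq_of_socle (e z : LocalH2 p 1 u v) (he : e ≠ 0)
    (he' : ∀ r ∈ maximalIdeal R, wittOne p r • e = 0)
    (hz' : ∀ r ∈ maximalIdeal R, wittOne p r • z = 0) : ∃ r : R, z = wittOne p r • e := by
  have hP := h.paramPair_of_span_eq hm
  obtain ⟨α, hα, rfl⟩ := exists_unit_cls_frac h hm e he he'
  obtain ⟨β, rfl⟩ := h.exists_cls_frac_one_one z (hz' u hP.memL) (hz' v hP.memR)
  obtain ⟨γ, hγ⟩ := hα.dvd (a := β)
  exact ⟨γ, by rw [smul_cls, algebraMap_mul_frac, hγ, mul_comm γ α]⟩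

/-- A nonzero class in the kernel has a nonzero multiple `α/(uv)` in the socle, with `α` a unit, and
by semilinearity this is in the kernel too. Its image `α^p/(uv)^p` vanishes only if `α^p ∈ (u^p,
v^p)`, which is impossible for a unit. -/
theorem frobenius_injective_of_regular [CharP R p] :
    Function.Injective (cechMap p 1 (IsCechHom.frobenius (p := p) u v)) := by
  have hP := h.paramPair_of_span_eq hm
  have hp0 := hp.out.pos
  rw [injective_iff_map_eq_zero]
  intro z hz
  by_contra hne
  obtain ⟨c, hc, hc'⟩ := hP.exists_smul_socle (hm ▸ Submodule.fg_span (Set.toFinite _)) z hne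
  obtain ⟨α, hα, e⟩ := exists_unit_cls_frac h hm _ hc hc'
  have h0 : cechMap p 1 (IsCechHom.frobenius (p := p) u v) (wittOne p c • z) = 0 := by
    rw [cechMap_smul, hz, smul_zero]
  rw [e, cechMap_cls, loc_frobenius_frac, h.cls_frac_eq_zero_iff, one_mul] at h0
  obtain ⟨β, γ, e⟩ := h0
  have : α ^ p ∈ maximalIdeal R := by
    rw [e]
    exact add_mem (Ideal.mul_mem_right _ _ (Ideal.pow_mem_of_mem _ hP.memL p hp0))
      (Ideal.mul_mem_right _ _ (Ideal.pow_mem_of_mem _ hP.memR p hp0))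
  exact (mem_nonunits_iff.1 ((mem_maximalIdeal _).1 this)) (hα.pow p)

variable {x y : R} (hxy : ParamPair x y) [IsNoetherianRing R] [CharP R p]
include hxy

theorem isTorsionGenerator_of_regular (e : LocalH2 p 1 x y) (he : e ≠ 0)
    (he' : ∀ r ∈ maximalIdeal R, wittOne p r • e = 0) :
    IsTorsionGenerator p x y (maximalIdeal R) e := by
  obtain ⟨E⟩ := hxy.nonempty_cechEquiv (p := p) (h.paramPair_of_span_eq hm)
  refine isTorsionGenerator_iff.2 ⟨he', fun z hz => ?_⟩
  obtain ⟨r, hr⟩ := exists_smul_eq_of_socle h hm (E.equiv 1 e) (E.equiv 1 z)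
    (by rwa [Ne, map_eq_zero_iff _ (E.equiv 1).injective])
    (fun r hr => by rw [← E.smul, he' r hr, map_zero])
    (fun r hr => by rw [← E.smul, hz r hr, map_zero])
  exact ⟨r, (E.equiv 1).injective (by rw [hr, E.smul])⟩

/-- Dévissage reduces to length one, and the change of parameters, which commutes with Frobenius,
reduces to generators of the maximal ideal. -/
theorem frobenius_injective (n : ℕ) :
    Function.Injective (cechMap p n (IsCechHom.frobenius (p := p) x y)) := by
  apply cechMap_injective_of_one _ hxy.toRegPair
  obtain ⟨E⟩ := hxy.nonempty_cechEquiv (p := p) (h.paramPair_of_span_eq hm)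
  intro a b hab
  apply (E.equiv 1).injective
  apply frobenius_injective_of_regular h hm
  rw [← E.frob, ← E.frob, hab]

end Regular

end Socle

/-! ### Two-dimensional regular local rings are domains with a regular pair of generators -/

section RegularLocal

variable {R : Type*} [CommRing R] [IsLocalRing R] [IsNoetherianRing R]

theorem exists_eq_unit_mul_pow {v a : R} (hm : maximalIdeal R = Ideal.span {v}) (ha : a ≠ 0) :
    ∃ n u, IsUnit u ∧ a = u * v ^ n := by
  classical
  have hbot := Ideal.iInf_pow_eq_bot_of_isLocalRing (maximalIdeal R) (maximalIdeal.isMaximal R).ne_top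
  have hex : ∃ n, a ∉ maximalIdeal R ^ n := by
    by_contra! h
    exact ha (by rw [← Ideal.mem_bot, ← hbot, Ideal.mem_iInf]; exact h)
  have h0 : Nat.find hex ≠ 0 := by
    intro h0
    have := Nat.find_spec hex
    rw [h0, pow_zero, Ideal.one_eq_top] at this
    exact this trivial
  obtain ⟨n, hn⟩ := Nat.exists_eq_succ_of_ne_zero h0
  have h1 : a ∈ maximalIdeal R ^ n := by
    by_contra h
    exact Nat.find_min hex (by omega) h
  have h2 := Nat.find_spec hex
  rw [hn] at h2
  rw [hm, Ideal.span_singleton_pow, Ideal.mem_span_singleton'] at h1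
  obtain ⟨u, rfl⟩ := h1
  refine ⟨n, u, ?_, rfl⟩
  by_contra hu
  apply h2
  rw [Nat.succ_eq_add_one, pow_succ']
  exact Ideal.mul_mem_mul ((mem_maximalIdeal u).2 hu)
    (Ideal.pow_mem_pow (hm ▸ Ideal.mem_span_singleton_self v) n)

/-- A local ring whose maximal ideal is generated by a non-nilpotent element is a domain. -/
theorem isDomain_of_maximalIdeal_eq_span {v : R} (hm : maximalIdeal R = Ideal.span {v})
    (hv : ¬ IsNilpotent v) : IsDomain R := by
  have : NoZeroDivisors R := by
    refine ⟨fun {a b} hab => ?_⟩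
    by_contra! h
    obtain ⟨n, u, hu, rfl⟩ := exists_eq_unit_mul_pow hm h.1
    obtain ⟨n', u', hu', rfl⟩ := exists_eq_unit_mul_pow hm h.2
    refine hv ⟨n + n', (hu.mul hu').mul_right_eq_zero.1 ?_⟩
    rw [← hab]; ring
  exact NoZeroDivisors.to_isDomain R

/-- The quotient by `u` has maximal ideal generated by the image of `v`. That image is not
nilpotent: otherwise `𝔪` would be minimal over `(u)` and have height at most one. -/
theorem isPrime_span_of_height_two {u v : R} (hm : maximalIdeal R = Ideal.span {u, v})
    (hht : (maximalIdeal R).height = 2) : (Ideal.span {u}).IsPrime := by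
  have hu : u ∈ maximalIdeal R := hm ▸ Ideal.subset_span (by simp)
  have hle : Ideal.span {u} ≤ maximalIdeal R := (Ideal.span_singleton_le_iff_mem _).2 hu
  have hne : Ideal.span {u} ≠ ⊤ := fun h => (maximalIdeal.isMaximal R).ne_top (top_le_iff.1 (h ▸ hle))
  have : Nontrivial (R ⧸ Ideal.span {u}) := Ideal.Quotient.nontrivial_iff.2 hne
  have : IsLocalRing (R ⧸ Ideal.span {u}) :=
    IsLocalRing.of_surjective' _ Ideal.Quotient.mk_surjective
  rw [← Ideal.Quotient.isDomain_iff_prime]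
  apply isDomain_of_maximalIdeal_eq_span (v := Ideal.Quotient.mk _ v)
  · have h1 : maximalIdeal (R ⧸ Ideal.span {u}) = (maximalIdeal R).map (Ideal.Quotient.mk _) :=
      (IsLocalRing.map_maximalIdeal_of_surjective _ Ideal.Quotient.mk_surjective).symm
    rw [h1, hm, Ideal.map_span, Set.image_pair,
      Ideal.Quotient.eq_zero_iff_mem.2 (Ideal.mem_span_singleton_self u), Ideal.span_insert_zero]
  · rintro ⟨n, hn⟩
    rw [← map_pow, Ideal.Quotient.eq_zero_iff_mem] at hn
    have hmin : maximalIdeal R ∈ (Ideal.span {u}).minimalPrimes := by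
      refine ⟨⟨inferInstance, hle⟩, ?_⟩
      rintro J ⟨hJ, hJ'⟩ -
      rw [hm, Ideal.span_le]
      rintro z (rfl | rfl)
      · exact hJ' (Ideal.mem_span_singleton_self z)
      · exact hJ.mem_of_pow_mem n (hJ' hn)
    have := Ideal.height_le_one_of_isPrincipal_of_mem_minimalPrimes _ _ hmin
    rw [hht] at this
    norm_num at this

/-- A two-dimensional Noetherian local ring whose maximal ideal has two generators is a domain. -/
theorem isDomain_of_height_two {u v : R} (hm : maximalIdeal R = Ideal.span {u, v})
    (hht : (maximalIdeal R).height = 2) : IsDomain R := by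
  have hpu := isPrime_span_of_height_two hm hht
  have hu : u ∈ maximalIdeal R := hm ▸ Ideal.subset_span (by simp)
  have hle : Ideal.span {u} ≤ maximalIdeal R := (Ideal.span_singleton_le_iff_mem _).2 hu
  obtain ⟨P, hPp, hP, hP0⟩ : ∃ P : Ideal R, P.IsPrime ∧ P < maximalIdeal R ∧ ¬ P ∈ minimalPrimes R := by
    by_contra! h
    have : (maximalIdeal R).height ≤ 1 := by
      rw [← Nat.cast_one, Ideal.height_le_iff]
      intro q hq hqm
      rw [Ideal.height_eq_zero_iff.2 (h q hq hqm)]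
      norm_num
    rw [hht] at this
    norm_num at this
  obtain ⟨P₀, hP₀, hP₀P⟩ := Ideal.exists_minimalPrimes_le (bot_le : ⊥ ≤ P)
  have hlt : P₀ < P := lt_of_le_of_ne hP₀P fun e => hP0 (by rw [← e]; exact hP₀)
  have hP₀p : P₀.IsPrime := hP₀.1.1
  -- an ideal that contains `u` and an element outside `(u)` is `𝔪`-primary
  have key : ∀ J : Ideal R, J.IsPrime → u ∈ J → ∀ a ∈ J, a ∉ Ideal.span {u} → maximalIdeal R ≤ J := by
    intro J hJ huJ a haJ hau
    have : Nontrivial (R ⧸ Ideal.span {u}) := Ideal.Quotient.nontrivial_iff.2 hpu.ne_top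
    have : IsLocalRing (R ⧸ Ideal.span {u}) :=
      IsLocalRing.of_surjective' _ Ideal.Quotient.mk_surjective
    have h1 : maximalIdeal (R ⧸ Ideal.span {u}) = (maximalIdeal R).map (Ideal.Quotient.mk _) :=
      (IsLocalRing.map_maximalIdeal_of_surjective _ Ideal.Quotient.mk_surjective).symm
    rw [hm, Ideal.map_span, Set.image_pair,
      Ideal.Quotient.eq_zero_iff_mem.2 (Ideal.mem_span_singleton_self u), Ideal.span_insert_zero] at h1
    obtain ⟨n, w, hw, e⟩ := exists_eq_unit_mul_pow h1
      (a := Ideal.Quotient.mk _ a) (by rwa [Ne, Ideal.Quotient.eq_zero_iff_mem])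
    obtain ⟨w', hw'⟩ := hw.exists_left_inv
    obtain ⟨w', rfl⟩ := Ideal.Quotient.mk_surjective w'
    have h2 : Ideal.Quotient.mk (Ideal.span {u}) (w' * a) = Ideal.Quotient.mk _ (v ^ n) := by
      rw [map_mul, e, ← mul_assoc, hw', one_mul, map_pow]
    rw [Ideal.Quotient.eq, Ideal.mem_span_singleton'] at h2
    obtain ⟨c, hc⟩ := h2
    have hvn : v ^ n ∈ J := by
      have : v ^ n = w' * a - c * u := by rw [hc]; ring
      rw [this]
      exact sub_mem (Ideal.mul_mem_left _ _ haJ) (Ideal.mul_mem_left _ _ huJ)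
    rw [hm, Ideal.span_le]
    rintro z (rfl | rfl)
    · exact huJ
    · exact hJ.mem_of_pow_mem n hvn
  -- Otherwise `𝔪` is minimal over `P₀ + (u)`, and the chain `P₀ < P < 𝔪` contradicts the principal
  -- ideal theorem.
  have hP₀u : P₀ ≤ Ideal.span {u} := by
    by_contra hnot
    obtain ⟨a, ha, hau⟩ := Set.not_subset.1 hnot
    refine not_chain_of_mem_minimalPrimes (M := maximalIdeal R) (y := u) ⟨⟨inferInstance,
      sup_le (hlt.le.trans hP.le) hle⟩, ?_⟩ hlt hP
    rintro J ⟨hJ, hJ'⟩ -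
    exact key J hJ (hJ' (Ideal.mem_sup_right (Ideal.mem_span_singleton_self u))) a
      (hJ' (Ideal.mem_sup_left ha)) hau
  have huP₀ : u ∉ P₀ := by
    intro huP₀
    obtain ⟨a, ha, haP⟩ := Set.exists_of_ssubset hlt
    exact hP.not_ge (key P hPp (hP₀P huP₀) a ha fun h => haP ((Ideal.span_singleton_le_iff_mem _).2 huP₀ h))
  -- As `P₀ ⊆ (u)` and `u ∉ P₀`, primality gives `P₀ = u P₀`, so Nakayama's lemma applies.
  have hbot : P₀ = ⊥ := by
    refine Submodule.eq_bot_of_le_smul_of_le_jacobson_bot (Ideal.span {u}) P₀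
      (IsNoetherian.noetherian _) ?_ (hle.trans (maximalIdeal_le_jacobson ⊥))
    intro a ha
    obtain ⟨b, rfl⟩ := Ideal.mem_span_singleton'.1 (hP₀u ha)
    rw [mul_comm]
    exact Submodule.smul_mem_smul (Ideal.mem_span_singleton_self u)
      ((hP₀p.mem_or_mem ha).resolve_right huP₀)
  have : (⊥ : Ideal R).IsPrime := hbot ▸ hP₀p
  exact IsDomain.of_bot_isPrime R

theorem regPair_of_height_two {u v : R} (hm : maximalIdeal R = Ideal.span {u, v})
    (hht : (maximalIdeal R).height = 2) : RegPair u v := by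
  have := isDomain_of_height_two hm hht
  have hpu := isPrime_span_of_height_two hm hht
  have hnot : ∀ w : R, maximalIdeal R ≠ Ideal.span {w} := by
    intro w hw
    have := Ideal.height_le_one_of_isPrincipal_of_mem_minimalPrimes (Ideal.span {w}) (maximalIdeal R)
      ⟨⟨inferInstance, hw.ge⟩, fun J hJ _ => hw ▸ hJ.2⟩
    rw [hht] at this
    norm_num at this
  have hu0 : u ≠ 0 := by
    rintro rfl
    rw [Ideal.span_insert_zero] at hm
    exact hnot v hm
  have hv0 : v ≠ 0 := by
    rintro rfl
    rw [Set.pair_comm, Ideal.span_insert_zero] at hm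
    exact hnot u hm
  refine ⟨fun a ha => (mul_eq_zero.1 ha).resolve_left hu0,
    fun a ha => (mul_eq_zero.1 ha).resolve_left hv0, fun a b e => ?_⟩
  have h1 : v * a ∈ Ideal.span {u} := by rw [e]; exact Ideal.mem_span_singleton.2 (Dvd.intro _ rfl)
  refine Ideal.mem_span_singleton.1 ((hpu.mem_or_mem h1).resolve_left fun hv => hnot u ?_)
  rw [hm]
  apply le_antisymm
  · rw [Ideal.span_le]
    rintro z (rfl | rfl)
    · exact Ideal.mem_span_singleton_self z
    · exact hv
  · exact Ideal.span_mono (by simp)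

theorem exists_params_of_isRegularLocalRing (B : Type*) [CommRing B] [IsLocalRing B]
    (hB : IsRegularLocalRing B) (hdim : ringKrullDim B = 2) :
    IsDomain B ∧ ∃ u v : B, maximalIdeal B = Ideal.span {u, v} ∧ RegPair u v := by
  have hht : (maximalIdeal B).height = 2 := by
    have := maximalIdeal_height_eq_ringKrullDim (R := B)
    rw [hdim] at this
    exact WithBot.coe_injective this
  have h2 : (maximalIdeal B).spanFinrank = 2 := by
    have := hB.spanFinrank_maximalIdeal
    rw [hdim] at this
    exact_mod_cast this
  obtain ⟨s, hs, hs'⟩ := Submodule.FG.exists_span_finset_card_eq_spanFinrank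
    (IsNoetherian.noetherian (maximalIdeal B))
  classical
  rw [h2, Finset.card_eq_two] at hs
  obtain ⟨u, v, -, rfl⟩ := hs
  have hm : maximalIdeal B = Ideal.span {u, v} := by
    rw [← hs']; simp [Ideal.span]
  exact ⟨isDomain_of_height_two hm hht, u, v, hm, regPair_of_height_two hm hht⟩

end RegularLocal

/-! ### Actions of `μ_p` and `α_p` and their vector fields -/

section HeightOne

variable {k : Type*} [Field k] {H : Type*} [CommRing H] [HopfAlgebra k H]
variable {B : Type*} [CommRing B] [Algebra k B]

/-- Contraction of the second factor with a functional. -/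
def contract (B : Type*) [CommRing B] [Algebra k B] (l : H →ₗ[k] k) : B ⊗[k] H →ₗ[k] B :=
  (TensorProduct.rid k B).toLinearMap ∘ₗ LinearMap.lTensor B l

theorem contract_tmul (l : H →ₗ[k] k) (b : B) (h : H) : contract B l (b ⊗ₜ h) = l h • b := by
  simp [contract]

/-- The invariant operator on `H` attached to a functional. -/
def invOp (l : H →ₗ[k] k) : H →ₗ[k] H := contract H l ∘ₗ Coalgebra.comul

theorem contract_mul {l : H →ₗ[k] k} (hl : ∀ a b, l (a * b) =
      Coalgebra.counit (R := k) a * l b + Coalgebra.counit (R := k) b * l a) (z w : B ⊗[k] H) :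
    contract B l (z * w) = contract B (Coalgebra.counit (R := k)) z * contract B l w
      + contract B (Coalgebra.counit (R := k)) w * contract B l z := by
  induction z using TensorProduct.induction_on with
  | zero => simp
  | add z z' h h' => rw [add_mul, map_add, map_add, map_add, h, h']; ring
  | tmul b h =>
    induction w using TensorProduct.induction_on with
    | zero => simp
    | add w w' h h' => rw [mul_add, map_add, map_add, map_add, h, h']; ring
    | tmul b' h' =>
      rw [Algebra.TensorProduct.tmul_mul_tmul]
      simp only [contract_tmul, hl, Algebra.smul_def, map_add, map_mul]
      ring

/-- Coassociativity with the last factor of `B ⊗ H ⊗ H` contracted. It reduces the coaction on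
contracted elements to a computation in `H`. -/
theorem coact_contract (ρ : GroupSchemeAction k H B) (l : H →ₗ[k] k) (b : B) :
    ρ.coact (contract B l (ρ.coact b)) = LinearMap.lTensor B (invOp l) (ρ.coact b) := by
  have h1 : ∀ x : B ⊗[k] H, ∀ h : H, LinearMap.lTensor B (contract H l)
      (Algebra.TensorProduct.assoc k k k B H H (x ⊗ₜ h)) = l h • x := by
    intro x h
    induction x using TensorProduct.induction_on with
    | zero => simp
    | add x y hx hy => rw [TensorProduct.add_tmul, map_add, map_add, hx, hy, smul_add]
    | tmul b g =>
      rw [Algebra.TensorProduct.assoc_tmul, LinearMap.lTensor_tmul, contract_tmul,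
        TensorProduct.tmul_smul]
  have h2 : ∀ z : B ⊗[k] H, LinearMap.lTensor B (contract H l)
      (Algebra.TensorProduct.assoc k k k B H H
        (Algebra.TensorProduct.map ρ.coact (AlgHom.id k H) z)) = ρ.coact (contract B l z) := by
    intro z
    induction z using TensorProduct.induction_on with
    | zero => simp
    | add x y hx hy => simp only [map_add, hx, hy]
    | tmul b h =>
      rw [Algebra.TensorProduct.map_tmul, h1, contract_tmul, map_smul]
      rfl
  have h3 : ∀ z : B ⊗[k] H, LinearMap.lTensor B (contract H l)
      (Algebra.TensorProduct.map (AlgHom.id k B) (Bialgebra.comulAlgHom k H) z)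
        = LinearMap.lTensor B (invOp l) z := by
    intro z
    induction z using TensorProduct.induction_on with
    | zero => simp
    | add x y hx hy => simp only [map_add, hx, hy]
    | tmul b h =>
      rw [Algebra.TensorProduct.map_tmul, LinearMap.lTensor_tmul, LinearMap.lTensor_tmul]
      rfl
  rw [← h2, ρ.coassoc, h3]

theorem contract_counit (ρ : GroupSchemeAction k H B) (b : B) :
    contract B (Coalgebra.counit (R := k)) (ρ.coact b) = b := by
  have h : ∀ z : B ⊗[k] H, contract B (Coalgebra.counit (R := k)) z
      = Algebra.TensorProduct.rid k k B
        (Algebra.TensorProduct.map (AlgHom.id k B) (Bialgebra.counitAlgHom k H) z) := by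
    intro z
    induction z using TensorProduct.induction_on with
    | zero => simp
    | add x y hx hy => simp only [map_add, hx, hy]
    | tmul b h =>
      rw [contract_tmul, Algebra.TensorProduct.map_tmul, Algebra.TensorProduct.rid_tmul]
      rfl
  rw [h, ρ.counit]

/-- `H = k[t]/(t^p - c)`, where `c = ε(t) ∈ {0, 1}`. -/
structure HeightOneGen (p : ℕ) (t : H) (c : k) : Prop where
  counit : Coalgebra.counit (R := k) t = c
  surj : Function.Surjective (Polynomial.aeval (R := k) t)
  ker : RingHom.ker (Polynomial.aeval (R := k) t)
    = Ideal.span {(Polynomial.X ^ p - Polynomial.C c : Polynomial k)}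
  pow_eq : c ^ p = c

namespace HeightOneGen

variable {p : ℕ} [hp : Fact p.Prime] {t : H} {c : k} (ht : HeightOneGen p t c)
include ht

theorem exists_basis : ∃ bas : Module.Basis (Fin p) k H, ∀ i, bas i = t ^ (i : ℕ) := by
  have hmon : (Polynomial.X ^ p - Polynomial.C c : Polynomial k).Monic :=
    Polynomial.monic_X_pow_sub_C c hp.out.ne_zero
  have hdeg : (Polynomial.X ^ p - Polynomial.C c : Polynomial k).natDegree = p :=
    Polynomial.natDegree_X_pow_sub_C
  let e : AdjoinRoot (Polynomial.X ^ p - Polynomial.C c : Polynomial k) ≃ₐ[k] H :=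
    (Ideal.quotientEquivAlgOfEq k ht.ker.symm).trans (Ideal.quotientKerAlgEquivOfSurjective ht.surj)
  let b := (AdjoinRoot.powerBasis' hmon).basis.map e.toLinearEquiv
  refine ⟨b.reindex (finCongr hdeg), fun i => ?_⟩
  rw [Module.Basis.reindex_apply, Module.Basis.map_apply, PowerBasis.basis_eq_pow]
  have : e (AdjoinRoot.root _) = t := Polynomial.aeval_X t
  rw [AdjoinRoot.powerBasis'_gen]
  exact (map_pow e _ _).trans (congrArg (· ^ _) this)

omit hp in
theorem pow_p : t ^ p = algebraMap k H c := by
  have : (Polynomial.X ^ p - Polynomial.C c : Polynomial k)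
      ∈ RingHom.ker (Polynomial.aeval (R := k) t) := by
    rw [ht.ker]; exact Ideal.mem_span_singleton_self _
  rw [RingHom.mem_ker, map_sub, map_pow, Polynomial.aeval_X, Polynomial.aeval_C, sub_eq_zero] at this
  exact this

omit hp in
/-- The tangent vector at the identity. -/
theorem exists_pointDerivation [CharP k p] : ∃ l : H →ₗ[k] k, l t = 1 ∧ ∀ a b, l (a * b) =
      Coalgebra.counit (R := k) a * l b + Coalgebra.counit (R := k) b * l a := by
  -- `P ↦ P'(c)` descends to `k[X]/(X^p - c)`: the derivative of `X^p - c` vanishes in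
  -- characteristic `p`, and so does its value at `c`, because `c^p = c`.
  let L : Polynomial k →ₗ[k] k := (Polynomial.leval c) ∘ₗ Polynomial.derivative
  have hL : ∀ P, L P = (Polynomial.derivative P).eval c := fun _ => rfl
  have hker : LinearMap.ker (Polynomial.aeval (R := k) t).toLinearMap ≤ LinearMap.ker L := by
    intro P hP
    have hP' : P ∈ RingHom.ker (Polynomial.aeval (R := k) t) := hP
    rw [ht.ker] at hP'
    obtain ⟨Q, rfl⟩ := Ideal.mem_span_singleton'.1 hP'
    rw [LinearMap.mem_ker, hL]
    simp [ht.pow_eq, Polynomial.derivative_X_pow]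
  have hs : Function.Surjective (Polynomial.aeval (R := k) t).toLinearMap := ht.surj
  let e := LinearMap.quotKerEquivOfSurjective _ hs
  let l : H →ₗ[k] k := (Submodule.liftQ _ L hker) ∘ₗ e.symm.toLinearMap
  have hl : ∀ P, l (Polynomial.aeval t P) = (Polynomial.derivative P).eval c := by
    intro P
    have : e.symm (Polynomial.aeval t P) = Submodule.Quotient.mk P := by
      rw [LinearEquiv.symm_apply_eq]; rfl
    change Submodule.liftQ _ L hker (e.symm (Polynomial.aeval t P)) = _
    rw [this, Submodule.liftQ_apply, hL]
  have he : ∀ P : Polynomial k, Coalgebra.counit (R := k) (Polynomial.aeval t P) = P.eval c := by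
    intro P
    change Bialgebra.counitAlgHom k H (Polynomial.aeval t P) = _
    rw [← Polynomial.aeval_algHom_apply]
    change Polynomial.aeval (Coalgebra.counit (R := k) t) P = _
    rw [ht.counit, Polynomial.coe_aeval_eq_eval]
  refine ⟨l, ?_, fun a b => ?_⟩
  · have := hl Polynomial.X
    simpa using this
  · obtain ⟨P, rfl⟩ := ht.surj a
    obtain ⟨Q, rfl⟩ := ht.surj b
    rw [← map_mul, hl, hl, hl, he, he, Polynomial.derivative_mul]
    simp only [Polynomial.eval_add, Polynomial.eval_mul]
    ring

-- For primitive `t` the invariant operator is `d/dt`, being a derivation of `H` that takes `t` to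
-- `1`.
omit hp ht in
theorem invOp_pow_of_prim (h : Coalgebra.comul (R := k) t = t ⊗ₜ[k] 1 + 1 ⊗ₜ[k] t) {l : H →ₗ[k] k}
    (h1 : l t = 1) (hl : ∀ a b, l (a * b) =
      Coalgebra.counit (R := k) a * l b + Coalgebra.counit (R := k) b * l a) (i : ℕ) :
    invOp l (t ^ i) = (i : k) • t ^ (i - 1) := by
  have hl0 : l 1 = 0 := by simpa using hl 1 1
  have hmul : ∀ a b, invOp l (a * b) = a * invOp l b + b * invOp l a := by
    intro a b
    have hc : ∀ a : H, contract H (Coalgebra.counit (R := k)) (Coalgebra.comul (R := k) a) = a := by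
      intro a
      rw [contract, LinearMap.comp_apply, Coalgebra.lTensor_counit_comul]
      simp
    rw [invOp, LinearMap.comp_apply, Bialgebra.comul_mul, contract_mul hl, hc, hc]
    rfl
  have ht1 : invOp l t = 1 := by
    rw [invOp, LinearMap.comp_apply, h, map_add, contract_tmul, contract_tmul, hl0, h1]
    simp
  induction i with
  | zero =>
    have := hmul 1 1
    simp only [one_mul] at this
    simpa using this
  | succ i ih =>
    rw [pow_succ, hmul, ht1, ih, Nat.add_sub_cancel]
    cases i with
    | zero => simp
    | succ i =>
      simp only [Nat.add_sub_cancel, Algebra.smul_def, map_natCast]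
      push_cast
      ring

end HeightOneGen

section Coaction

variable {p : ℕ} [hp : Fact p.Prime] {t : H}

theorem eq_sum_contract {ι : Type*} [Fintype ι] (bas : Module.Basis ι k H) (z : B ⊗[k] H) :
    z = ∑ i, contract B (bas.coord i) z ⊗ₜ[k] bas i := by
  induction z using TensorProduct.induction_on with
  | zero => simp
  | add z w hz hw =>
    simp only [map_add, TensorProduct.add_tmul, Finset.sum_add_distrib]
    rw [← hz, ← hw]
  | tmul b h =>
    simp only [contract_tmul]
    conv_lhs => rw [← bas.sum_repr h, TensorProduct.tmul_sum]
    exact Finset.sum_congr rfl fun i _ => by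
      rw [TensorProduct.tmul_smul, TensorProduct.smul_tmul', Module.Basis.coord_apply]

/-- The vector field attached to a tangent vector at the identity. -/
def vectorField (ρ : GroupSchemeAction k H B) (l : H →ₗ[k] k) (hl : ∀ a b, l (a * b) =
      Coalgebra.counit (R := k) a * l b + Coalgebra.counit (R := k) b * l a) : Derivation k B B :=
  Derivation.mk' (contract B l ∘ₗ ρ.coact.toLinearMap) fun a b => by
    simp only [LinearMap.comp_apply, AlgHom.toLinearMap_apply, map_mul]
    rw [contract_mul hl, contract_counit, contract_counit]
    rfl

theorem vectorField_mem_fixedIdeal (ρ : GroupSchemeAction k H B) {l : H →ₗ[k] k}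
    (hl : ∀ a b, l (a * b) =
      Coalgebra.counit (R := k) a * l b + Coalgebra.counit (R := k) b * l a) (b : B) :
    vectorField ρ l hl b ∈ ρ.fixedIdeal := by
  refine Ideal.subset_span ⟨b, l, ?_⟩
  have hl0 : l 1 = 0 := by simpa using hl 1 1
  change contract B l _ = contract B l _
  rw [map_sub, contract_tmul, hl0, zero_smul, sub_zero]
  rfl

/-- The group has height one: if `b` has coaction `∑ b_i ⊗ t^i`, then `b^p` has coaction `∑ b_i^p ⊗
t^(p i)`, and `t^p` is a scalar, so the result lies in `B ⊗ 1`. The counit identifies its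
coefficient with `b^p`. -/
theorem pow_mem_range_of_isQuotient {c : k} (ht : HeightOneGen p t c) [CharP k p] [Nontrivial B]
    (ρ : GroupSchemeAction k H B) {A : Type*} [CommRing A] [Algebra k A] {π : A →ₐ[k] B}
    (hq : ρ.IsQuotient π) (b : B) : b ^ p ∈ Set.range π := by
  obtain ⟨bas, hbas⟩ := ht.exists_basis
  have : Nontrivial (B ⊗[k] H) :=
    ((Algebra.TensorProduct.rid k k B).toRingHom.comp
      (Algebra.TensorProduct.map (AlgHom.id k B)
        (Bialgebra.counitAlgHom k H)).toRingHom).domain_nontrivial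
  have : CharP (B ⊗[k] H) p := charP_of_injective_algebraMap (algebraMap k (B ⊗[k] H)).injective p
  have hz : ρ.coact (b ^ p)
      = (∑ i : Fin p, c ^ (i : ℕ) • contract B (bas.coord i) (ρ.coact b) ^ p) ⊗ₜ[k] 1 := by
    rw [map_pow]
    conv_lhs => rw [eq_sum_contract bas (ρ.coact b)]
    rw [sum_pow_char, TensorProduct.sum_tmul]
    refine Finset.sum_congr rfl fun i _ => ?_
    rw [Algebra.TensorProduct.tmul_pow, hbas, ← pow_mul, mul_comm (i : ℕ), pow_mul, ht.pow_p,
      ← map_pow (algebraMap k H), Algebra.algebraMap_eq_smul_one, TensorProduct.tmul_smul, TensorProduct.smul_tmul']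
  have hb := contract_counit ρ (b ^ p)
  rw [hz, contract_tmul, Bialgebra.counit_one, one_smul] at hb
  rw [hq.2, hz, hb]

omit hp in
theorem contract_coord_pow {bas : Module.Basis (Fin p) k H} (hbas : ∀ i, bas i = t ^ (i : ℕ))
    (b : B) {i : ℕ} (hi : i < p) (j : Fin p) :
    contract B (bas.coord j) (b ⊗ₜ[k] (t ^ i) : B ⊗[k] H) = if i = j then b else 0 := by
  have : t ^ i = bas ⟨i, hi⟩ := (hbas ⟨i, hi⟩).symm
  rw [contract_tmul, this, Module.Basis.coord_apply, Module.Basis.repr_self, Finsupp.single_apply]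
  simp only [Fin.ext_iff]
  split_ifs <;> simp

omit hp in
theorem natCast_ne_zero_of_lt [CharP k p] {i : ℕ} (h0 : i ≠ 0) (hi : i < p) : (i : k) ≠ 0 := by
  rw [Ne, CharP.cast_eq_zero_iff k p]
  exact fun h => absurd (Nat.le_of_dvd (Nat.pos_of_ne_zero h0) h) (not_le.2 hi)

/-- In the case of `μ_p`, all derivations that kill the invariants are proportional to the vector
field of the action. -/
theorem exists_vectorField_of_isMuP [CharP k p] [IsDomain B] (hH : IsMuP k p H)
    (ρ : GroupSchemeAction k H B) {A : Type*} [CommRing A] [Algebra k A] {π : A →ₐ[k] B}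
    (hq : ρ.IsQuotient π) {Q : Type*} [CommRing Q] [Algebra B Q]
    (hnz : ∀ b : B, b ≠ 0 → ∀ q : Q, algebraMap B Q b * q = 0 → q = 0) (δ : Derivation ℤ B Q)
    (hδ : ∀ a, δ (π a) = 0) :
    ∃ D : Derivation k B B, ρ.fixedIdeal ≤ Ideal.span (Set.range D) ∧
      (∀ b, D b ∈ ρ.fixedIdeal) ∧
      ∀ b b', D b • δ b' = D b' • δ b := by
  obtain ⟨t, hco, hct, hs, hk⟩ := hH
  have ht : HeightOneGen p t (1 : k) := ⟨hct, hs, by rw [hk, map_one], one_pow _⟩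
  obtain ⟨bas, hbas⟩ := ht.exists_basis
  obtain ⟨l, hl1, hl⟩ := ht.exists_pointDerivation
  have hcounit : ∀ i : ℕ, Coalgebra.counit (R := k) (t ^ i) = 1 := fun i => by
    rw [Bialgebra.counit_pow, hct, one_pow]
  have hlt : ∀ i : ℕ, l (t ^ i) = i := by
    intro i
    induction i with
    | zero => simpa using hl 1 1
    | succ i ih => rw [pow_succ, hl, ih, hcounit, hct, hl1]; push_cast; ring
  have heig : ∀ (b : B) (j : Fin p), ρ.coact (contract B (bas.coord j) (ρ.coact b))
      = contract B (bas.coord j) (ρ.coact b) ⊗ₜ (t ^ (j : ℕ)) := by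
    intro b j
    rw [coact_contract]
    conv_lhs => rw [eq_sum_contract bas (ρ.coact b)]
    rw [map_sum, Finset.sum_eq_single j]
    · rw [LinearMap.lTensor_tmul, invOp, LinearMap.comp_apply, hbas, Bialgebra.comul_pow, hco,
        Algebra.TensorProduct.tmul_pow, contract_coord_pow (B := H) hbas _ j.2, if_pos rfl]
    · intro i _ hij
      rw [LinearMap.lTensor_tmul, invOp, LinearMap.comp_apply, hbas, Bialgebra.comul_pow, hco,
        Algebra.TensorProduct.tmul_pow, contract_coord_pow (B := H) hbas _ i.2,
        if_neg (fun h => hij (Fin.ext h)), TensorProduct.tmul_zero]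
    · exact fun h => absurd (Finset.mem_univ _) h
  have hsum : ∀ b : B, b = ∑ j, contract B (bas.coord j) (ρ.coact b) := by
    intro b
    conv_lhs => rw [← contract_counit ρ b, eq_sum_contract bas (ρ.coact b), map_sum]
    exact Finset.sum_congr rfl fun i _ => by rw [contract_tmul, hbas, hcounit, one_smul]
  have hDeig : ∀ (b : B) (j : ℕ), ρ.coact b = b ⊗ₜ (t ^ j) → vectorField ρ l hl b = (j : k) • b := by
    intro b j h
    change contract B l (ρ.coact b) = _
    rw [h, contract_tmul, hlt]
  refine ⟨vectorField ρ l hl, ?_, vectorField_mem_fixedIdeal ρ hl, ?_⟩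
  · rw [GroupSchemeAction.fixedIdeal, Ideal.span_le]
    rintro _ ⟨b, l', rfl⟩
    change contract B l' _ ∈ _
    have he : contract B l' (ρ.coact b - b ⊗ₜ[k] 1) = ∑ j, (contract B l'
        (contract B (bas.coord j) (ρ.coact b) ⊗ₜ[k] bas j)
          - l' 1 • contract B (bas.coord j) (ρ.coact b)) := by
      rw [Finset.sum_sub_distrib, ← map_sum, ← eq_sum_contract bas (ρ.coact b), ← Finset.smul_sum,
        ← hsum b, map_sub, contract_tmul]
    rw [he]
    refine Ideal.sum_mem _ fun j _ => ?_
    rw [contract_tmul, ← sub_smul, hbas]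
    -- Weight zero contributes nothing to the fixed ideal; in weight `0 < j < p` the scalar `j` is
    -- invertible, so the component is a value of `D`.
    by_cases hj : (j : ℕ) = 0
    · rw [hj, pow_zero, sub_self, zero_smul]
      exact Ideal.zero_mem _
    · have h1 := hDeig _ _ (heig b j)
      have h2 : contract B (bas.coord j) (ρ.coact b) = ((j : ℕ) : k)⁻¹ •
          vectorField ρ l hl (contract B (bas.coord j) (ρ.coact b)) := by
        rw [h1, smul_smul, inv_mul_cancel₀ (natCast_ne_zero_of_lt hj j.2), one_smul]
      rw [h2, smul_smul, Algebra.smul_def]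
      exact Ideal.mul_mem_left _ _ (Ideal.subset_span ⟨_, rfl⟩)
  · have key : ∀ (b b' : B) (i j : ℕ), i < p → ρ.coact b = b ⊗ₜ (t ^ i) → ρ.coact b' = b' ⊗ₜ (t ^ j) →
        vectorField ρ l hl b • δ b' = vectorField ρ l hl b' • δ b := by
      intro b b' i j hi hb hb'
      rw [hDeig _ _ hb, hDeig _ _ hb']
      rcases Nat.eq_zero_or_pos j with rfl | hj
      · rw [pow_zero] at hb'
        obtain ⟨a, rfl⟩ := (hq.2 b').2 hb'
        rw [hδ]
        simp
      by_cases hb0 : b = 0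
      · simp [hb0]
      by_cases hb0' : b' = 0
      · simp [hb0']
      -- This monomial has weight `i j + j (p - i) = p j`, hence is invariant and killed by `δ`.
      -- Expanding by the Leibniz rule and cancelling `b^(j-1) b'^(p-i-1)` gives `i b δ(b') = j b'
      -- δ(b)`.
      have hu : ρ.coact (b ^ j * b' ^ (p - i)) = (b ^ j * b' ^ (p - i)) ⊗ₜ 1 := by
        rw [map_mul, map_pow, map_pow, hb, hb', Algebra.TensorProduct.tmul_pow,
          Algebra.TensorProduct.tmul_pow, Algebra.TensorProduct.tmul_mul_tmul, ← pow_mul, ← pow_mul,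
          ← pow_add]
        have : i * j + j * (p - i) = p * j := by
          rw [mul_comm i, ← mul_add, Nat.add_sub_cancel' hi.le, mul_comm]
        rw [this, pow_mul, ht.pow_p, map_one, one_pow]
      obtain ⟨a, ha⟩ := (hq.2 _).2 hu
      have h0 : δ (b ^ j * b' ^ (p - i)) = 0 := by rw [← ha, hδ]
      obtain ⟨m, hm⟩ : ∃ m, p - i = m + 1 := ⟨p - i - 1, by omega⟩
      obtain ⟨j, rfl⟩ : ∃ j', j = j' + 1 := ⟨j - 1, by omega⟩
      have hpi : ((m + 1 : ℕ) : B) = - (i : B) := by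
        have : CharP B p := charP_of_injective_algebraMap (algebraMap k B).injective p
        rw [← hm, Nat.cast_sub hi.le, CharP.cast_eq_zero, zero_sub]
      rw [Derivation.leibniz, Derivation.leibniz_pow, Derivation.leibniz_pow, hm] at h0
      simp only [Nat.add_sub_cancel, ← Nat.cast_smul_eq_nsmul B, hpi] at h0
      have hne : b ^ j * b' ^ m ≠ 0 := mul_ne_zero (pow_ne_zero _ hb0) (pow_ne_zero _ hb0')
      have h1 := hnz _ hne (algebraMap B Q ((i : B) * b) * δ b'
        - algebraMap B Q (((j + 1 : ℕ) : B) * b') * δ b) (by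
          rw [← neg_eq_zero, ← h0]
          simp only [Algebra.smul_def, map_mul, map_pow, map_neg]
          ring)
      rw [sub_eq_zero] at h1
      simpa only [Algebra.smul_def, map_mul, map_natCast, ← mul_assoc] using h1
    intro b b'
    have h1 := hsum b
    have h2 := hsum b'
    conv_lhs => rw [h1, h2]
    conv_rhs => rw [h1, h2]
    simp only [map_sum, Finset.sum_smul, Finset.smul_sum]
    rw [Finset.sum_comm]
    exact Finset.sum_congr rfl fun i _ => Finset.sum_congr rfl fun j _ =>
      key _ _ _ _ i.2 (heig b i) (heig b' j)

omit hp in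
/-- A locally nilpotent derivation `D` whose constants are killed by `δ` is proportional to `δ`. -/
theorem proportional_of_nilpotent [CharP k p] [IsDomain B] (D : Derivation k B B)
    (hp0 : ∀ b, D^[p] b = 0) {Q : Type*} [CommRing Q] [Algebra B Q]
    (hnz : ∀ b : B, b ≠ 0 → ∀ q : Q, algebraMap B Q b * q = 0 → q = 0) (δ : Derivation ℤ B Q)
    (hδ : ∀ b, D b = 0 → δ b = 0) (b b' : B) : D b • δ b' = D b' • δ b := by
  by_cases hD : ∀ b, D b = 0
  · rw [hD, hD, zero_smul, zero_smul]
  push Not at hD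
  obtain ⟨b₀, hb₀⟩ := hD
  -- `b₁` serves as a coordinate along `D`: it is the last iterate of `b₀` that is not a constant.
  obtain ⟨b₁, hr, hDr⟩ : ∃ b₁, D b₁ ≠ 0 ∧ D (D b₁) = 0 := by
    have hex : ∃ m, D^[m + 2] b₀ = 0 := by
      refine ⟨p, ?_⟩
      rw [add_comm, Function.iterate_add_apply, hp0]
      simp
    classical
    have h1 := Nat.find_spec hex
    rcases hm : Nat.find hex with _ | m
    · rw [hm] at h1
      exact ⟨b₀, hb₀, h1⟩
    · have h2 := Nat.find_min hex (m := m) (by omega)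
      rw [hm] at h1
      refine ⟨D^[m + 1] b₀, ?_, ?_⟩
      · rwa [← Function.iterate_succ_apply' D]
      · rwa [← Function.iterate_succ_apply' D, ← Function.iterate_succ_apply' D]
  have hkey : ∀ m, m ≤ p → ∀ b, D^[m] b = 0 → D b₁ • δ b = D b • δ b₁ := by
    intro m
    induction m with
    | zero =>
      intro _ b hb
      have : b = 0 := hb
      simp [this]
    | succ m ih =>
      intro hm b hb
      rcases Nat.eq_zero_or_pos m with rfl | hm0
      · have : D b = 0 := hb
        rw [this, hδ b this, smul_zero, zero_smul]
      have hDm : ∀ f, D^[m] (f * b₁) = D^[m] f * b₁ + (m : B) * D b₁ * D^[m - 1] f := by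
        intro f
        clear hm hm0 hb ih
        induction m with
        | zero => simp
        | succ m ih =>
          rw [Function.iterate_succ_apply', ih, Nat.add_sub_cancel]
          cases m with
          | zero => simp; ring
          | succ m =>
            simp only [Nat.add_sub_cancel, map_add, Derivation.leibniz, smul_eq_mul, hDr,
              Derivation.map_natCast, Function.iterate_succ_apply']
            push_cast
            ring
      have hDr' : ∀ f, D^[m] (D b₁ * f) = D b₁ * D^[m] f := by
        intro f
        clear hm hm0 hb ih hDm
        induction m with
        | zero => simp
        | succ m ih =>
          rw [Function.iterate_succ_apply', ih, Derivation.leibniz, hDr, Function.iterate_succ_apply']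
          simp
      have hDn : ∀ f, D^[m] ((m : B) * f) = (m : B) * D^[m] f := by
        intro f
        have : ∀ j, D^[j] ((m : B) * f) = (m : B) * D^[j] f := by
          intro j
          induction j with
          | zero => simp
          | succ j ih =>
            rw [Function.iterate_succ_apply', ih, Derivation.leibniz, Function.iterate_succ_apply']
            simp
        exact this m
      have hDsub : ∀ j f g, D^[j] (f - g) = D^[j] f - D^[j] g := fun j f g =>
        iterate_map_sub D j f g
      have hsucc : D^[m - 1] (D b) = D^[m] b := by
        rw [← Function.iterate_succ_apply, Nat.succ_eq_add_one, Nat.sub_add_cancel hm0]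
      -- The combination is chosen so that `D^m` kills it: `D^m (D b · b₁) = D^(m+1) b · b₁ + m · D
      -- b₁ · D^m b`, where the first term is zero. The induction hypothesis for it and for `D b`
      -- yields the claim for `b` times `m · D b₁`, which can be cancelled as `0 < m < p`.
      have h1 := ih (by omega) ((m : B) * (D b₁ * b) - D b * b₁) (by
        rw [hDsub, hDn, hDr', hDm, hsucc, ← Function.iterate_succ_apply, hb]
        ring)
      have h2 := ih (by omega) (D b) (by rwa [← Function.iterate_succ_apply])
      have h3 : δ (D b₁) = 0 := hδ _ hDr
      have hm' : (m : B) ≠ 0 := by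
        rw [← map_natCast (algebraMap k B)]
        exact (map_ne_zero _).2 (natCast_ne_zero_of_lt hm0.ne' hm)
      have h4 := hnz ((m : B) * D b₁) (mul_ne_zero hm' hr)
        (algebraMap B Q (D b₁) * δ b - algebraMap B Q (D b) * δ b₁) (by
          simp only [map_sub, Derivation.leibniz, h3, hDr, Derivation.map_natCast, smul_eq_mul,
            Algebra.smul_def, map_mul, map_add, mul_zero, add_zero, map_natCast] at h1 h2 ⊢
          linear_combination h1 + algebraMap B Q b₁ * h2)
      rwa [sub_eq_zero, ← Algebra.smul_def, ← Algebra.smul_def] at h4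
  have h1 := hkey p le_rfl b (hp0 b)
  have h2 := hkey p le_rfl b' (hp0 b')
  have h := hnz _ hr (algebraMap B Q (D b) * δ b' - algebraMap B Q (D b') * δ b) (by
    simp only [Algebra.smul_def] at h1 h2
    linear_combination algebraMap B Q (D b) * h2 - algebraMap B Q (D b') * h1)
  rwa [sub_eq_zero, ← Algebra.smul_def, ← Algebra.smul_def] at h

/-- In the case of `α_p`, all derivations that kill the invariants are proportional to the vector
field of the action. -/
theorem exists_vectorField_of_isAlphaP [CharP k p] [IsDomain B] (hH : IsAlphaP k p H)
    (ρ : GroupSchemeAction k H B) {A : Type*} [CommRing A] [Algebra k A] {π : A →ₐ[k] B}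
    (hq : ρ.IsQuotient π) {Q : Type*} [CommRing Q] [Algebra B Q]
    (hnz : ∀ b : B, b ≠ 0 → ∀ q : Q, algebraMap B Q b * q = 0 → q = 0) (δ : Derivation ℤ B Q)
    (hδ : ∀ a, δ (π a) = 0) :
    ∃ D : Derivation k B B, ρ.fixedIdeal ≤ Ideal.span (Set.range D) ∧
      (∀ b, D b ∈ ρ.fixedIdeal) ∧
      ∀ b b', D b • δ b' = D b' • δ b := by
  obtain ⟨t, hco, hct, hs, hk⟩ := hH
  have ht : HeightOneGen p t (0 : k) :=
    ⟨hct, hs, by rw [hk, map_zero, sub_zero], zero_pow hp.out.ne_zero⟩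
  obtain ⟨bas, hbas⟩ := ht.exists_basis
  obtain ⟨l, hl1, hl⟩ := ht.exists_pointDerivation
  have hcounit : ∀ i : ℕ, Coalgebra.counit (R := k) (t ^ i) = if i = 0 then 1 else 0 := fun i => by
    rw [Bialgebra.counit_pow, hct, zero_pow_eq]
  -- The value `0` for `i ≥ p` keeps the recursion `c_i (D b) = (i + 1) c_(i+1) b` valid at `i = p -
  -- 1`, and yields `D^p = 0`.
  let c : ℕ → B → B := fun i b => if h : i < p then contract B (bas.coord ⟨i, h⟩) (ρ.coact b) else 0
  let D := vectorField ρ l hl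
  have hexp : ∀ b, ρ.coact b = ∑ i : Fin p, c i b ⊗ₜ[k] (t ^ (i : ℕ)) := by
    intro b
    conv_lhs => rw [eq_sum_contract bas (ρ.coact b)]
    exact Finset.sum_congr rfl fun i _ => by rw [hbas]; simp only [c, dif_pos i.2]
  have hc0 : ∀ b, c 0 b = b := by
    intro b
    conv_rhs => rw [← contract_counit ρ b, hexp b, map_sum]
    rw [Finset.sum_eq_single ⟨0, hp.out.pos⟩]
    · rw [contract_tmul, hcounit, if_pos rfl, one_smul]
    · intro i _ hi
      rw [contract_tmul, hcounit, if_neg (fun h => hi (Fin.ext h)), zero_smul]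
    · exact fun h => absurd (Finset.mem_univ _) h
  have hcD : ∀ b i, c i (D b) = ((i + 1 : ℕ) : k) • c (i + 1) b := by
    intro b i
    by_cases hi : i < p
    · have h1 : ρ.coact (D b) = LinearMap.lTensor B (invOp l) (ρ.coact b) := coact_contract ρ l b
      have h2 : ∀ j : Fin p, contract B (bas.coord ⟨i, hi⟩)
          (LinearMap.lTensor B (invOp l) (c j b ⊗ₜ[k] (t ^ (j : ℕ))))
          = if (j : ℕ) = i + 1 then ((i + 1 : ℕ) : k) • c (i + 1) b else 0 := by
        intro j
        rw [LinearMap.lTensor_tmul, HeightOneGen.invOp_pow_of_prim hco hl1 hl, TensorProduct.tmul_smul,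
          map_smul, contract_coord_pow hbas _ (by have := j.2; omega)]
        have hj := j.2
        rcases hj0 : (j : ℕ) with _ | j'
        · simp
        · rw [Nat.add_sub_cancel]
          by_cases h : j' = i
          · rw [h, if_pos rfl, if_pos rfl]
          · rw [if_neg h, if_neg (by omega), smul_zero]
      have h3 : c i (D b) = contract B (bas.coord ⟨i, hi⟩) (ρ.coact (D b)) := dif_pos hi
      rw [h3, h1, hexp b, map_sum, map_sum, Finset.sum_congr rfl fun j _ => h2 j]
      by_cases hi' : i + 1 < p
      · rw [Finset.sum_eq_single ⟨i + 1, hi'⟩]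
        · rw [if_pos rfl]
        · intro j _ hj
          rw [if_neg (fun h => hj (Fin.ext h))]
        · exact fun h => absurd (Finset.mem_univ _) h
      · rw [Finset.sum_eq_zero fun j _ => if_neg (by have := j.2; omega)]
        simp only [c, dif_neg hi', smul_zero]
    · simp only [c, dif_neg hi, dif_neg (show ¬ i + 1 < p by omega), smul_zero]
  -- Thus the coaction is the truncated exponential `∑ D^i(b)/i! ⊗ t^i`, and its coefficients with
  -- `0 < i < p` are multiples of values of `D`.
  have hfac : ∀ i b, D^[i] b = ((Nat.factorial i : ℕ) : k) • c i b := by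
    intro i
    induction i with
    | zero => intro b; simp [hc0]
    | succ i ih =>
      intro b
      rw [Function.iterate_succ_apply, ih, hcD, smul_smul, ← Nat.cast_mul, Nat.factorial_succ,
        mul_comm]
  have hmem : ∀ i, i ≠ 0 → i < p → ∀ b, c i b ∈ Ideal.span (Set.range D) := by
    intro i hi hip b
    have hne : ((Nat.factorial i : ℕ) : k) ≠ 0 := by
      rw [Ne, CharP.cast_eq_zero_iff k p, hp.out.dvd_factorial]
      omega
    have : c i b = ((Nat.factorial i : ℕ) : k)⁻¹ • D^[i] b := by
      rw [hfac, smul_smul, inv_mul_cancel₀ hne, one_smul]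
    rw [this, Algebra.smul_def]
    refine Ideal.mul_mem_left _ _ ?_
    obtain ⟨j, rfl⟩ := Nat.exists_eq_succ_of_ne_zero hi
    rw [Function.iterate_succ_apply']
    exact Ideal.subset_span ⟨_, rfl⟩
  refine ⟨D, ?_, vectorField_mem_fixedIdeal ρ hl, proportional_of_nilpotent (p := p) D ?_ hnz δ ?_⟩
  · rw [GroupSchemeAction.fixedIdeal, Ideal.span_le]
    rintro _ ⟨b, l', rfl⟩
    change contract B l' _ ∈ _
    have hz : ρ.coact b - b ⊗ₜ[k] 1
        = ∑ i : Fin p, if (i : ℕ) = 0 then 0 else c i b ⊗ₜ[k] (t ^ (i : ℕ)) := by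
      rw [hexp b, sub_eq_iff_eq_add,
        ← Finset.add_sum_erase _ _ (Finset.mem_univ (⟨0, hp.out.pos⟩ : Fin p)), hc0, pow_zero,
        add_comm,
        ← Finset.add_sum_erase (f := fun i : Fin p => if (i : ℕ) = 0 then 0 else
          c i b ⊗ₜ[k] (t ^ (i : ℕ))) _ (Finset.mem_univ (⟨0, hp.out.pos⟩ : Fin p)), if_pos rfl,
        zero_add]
      congr 1
      refine Finset.sum_congr rfl fun i hi => ?_
      rw [if_neg (fun h => (Finset.mem_erase.1 hi).1 (Fin.ext h))]
    rw [hz, map_sum]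
    refine Ideal.sum_mem _ fun i _ => ?_
    split_ifs with h
    · rw [map_zero]; exact Ideal.zero_mem _
    · rw [contract_tmul, Algebra.smul_def]
      exact Ideal.mul_mem_left _ _ (hmem i h i.2 b)
  · intro b
    rw [hfac]
    simp only [c, dif_neg (lt_irrefl p), smul_zero]
  · intro b hb
    have : ρ.coact b = b ⊗ₜ 1 := by
      rw [hexp b, Finset.sum_eq_single ⟨0, hp.out.pos⟩]
      · rw [hc0, pow_zero]
      · intro i _ hi
        obtain ⟨j, hj⟩ := Nat.exists_eq_succ_of_ne_zero (fun h => hi (Fin.ext h) : (i : ℕ) ≠ 0)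
        have h1 := hcD b j
        have h2 : c j (D b) = 0 := by
          simp only [hb, c, map_zero, dite_eq_right_iff, implies_true]
        rw [h2, eq_comm, smul_eq_zero] at h1
        have hi2 := i.2
        rw [hj, (h1.resolve_left (natCast_ne_zero_of_lt (by omega) (by omega)) : c (j + 1) b = 0),
          TensorProduct.zero_tmul]
      · exact fun h => absurd (Finset.mem_univ _) h
    obtain ⟨a, rfl⟩ := (hq.2 b).2 this
    exact hδ a

end Coaction

end HeightOne

/-! ### Purely inseparable hypersurfaces and stability under `∂/∂W` -/

section Inseparable

variable {p : ℕ} {Q : Type*} [CommRing Q] [IsLocalRing Q]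

/-- A local ring with maximal ideal `(s, t, W)`, where `W ^ p ∈ (s, t)`, and a derivation `∂/∂W`. -/
structure InsepModel (p : ℕ) (s t W : Q) (d : Derivation ℤ Q Q) : Prop where
  dl : d s = 0
  dr : d t = 0
  dW : d W = 1
  span_eq : maximalIdeal Q = Ideal.span {s, t, W}
  pow_mem : W ^ p ∈ Ideal.span {s, t}

variable {s t W : Q} {d : Derivation ℤ Q Q} (M : InsepModel p s t W d)
include M

namespace InsepModel

/-- Modulo `(s, t)` the maximal ideal is generated by `W`. If no unit ever appeared as coefficient,
one could extract the factor `W` from `q` `p` times, and `W^p ∈ (s, t)`. -/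
theorem exists_unit_mul_pow (q : Q) (hq : q ∉ Ideal.span {s, t}) :
    ∃ i < p, ∃ u : Q, IsUnit u ∧ q - u * W ^ i ∈ Ideal.span {s, t} := by
  by_contra! hcon
  have : ∀ i ≤ p, ∃ a, q - a * W ^ i ∈ Ideal.span {s, t} := by
    intro i
    induction i with
    | zero => exact fun _ => ⟨q, by simp⟩
    | succ i ih =>
      intro hi
      obtain ⟨a, ha⟩ := ih (by omega)
      have hau : a ∈ maximalIdeal Q := by
        rw [mem_maximalIdeal]
        exact fun hu => hcon i (by omega) a hu ha
      rw [M.span_eq, Ideal.mem_span_insert] at hau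
      obtain ⟨b, z, hz, rfl⟩ := hau
      rw [Ideal.mem_span_pair] at hz
      obtain ⟨b', c, rfl⟩ := hz
      refine ⟨c, ?_⟩
      have h1 : s ∈ Ideal.span {s, t} := Ideal.subset_span (by simp)
      have h2 : t ∈ Ideal.span {s, t} := Ideal.subset_span (by simp)
      have := Ideal.add_mem _ ha (Ideal.add_mem _ (Ideal.mul_mem_left _ (b * W ^ i) h1)
        (Ideal.mul_mem_left _ (b' * W ^ i) h2))
      convert this using 1
      ring
  obtain ⟨a, ha⟩ := this p le_rfl
  refine hq ?_
  have := Ideal.add_mem _ ha (Ideal.mul_mem_left _ a M.pow_mem)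
  simpa using this

/-- A proper ideal that contains `s, t` and is stable under `∂/∂W` is `(s, t)`. -/
theorem le_span_of_stable (hp : p.Prime) [CharP Q p] {J : Ideal Q} (hJ : J ≠ ⊤)
    (hst : Ideal.span {s, t} ≤ J) (hd : ∀ q ∈ J, d q ∈ J) : J ≤ Ideal.span {s, t} := by
  intro q hq
  by_contra hcon
  obtain ⟨i, hi, u, hu, hqu⟩ := M.exists_unit_mul_pow q hcon
  have h1 : W ^ i ∈ J := by
    have h2 : u * W ^ i ∈ J := by
      have := J.sub_mem hq (hst hqu)
      rwa [sub_sub_cancel] at this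
    exact (Ideal.unit_mul_mem_iff_mem J hu).1 h2
  -- Each application of `d` lowers the exponent by one; the factor `i - j` is a unit, since it is
  -- positive and less than `p`.
  have h2 : ∀ j ≤ i, W ^ (i - j) ∈ J := by
    intro j
    induction j with
    | zero => exact fun _ => h1
    | succ j ih =>
      intro hj
      have h3 := hd _ (ih (by omega))
      rw [Derivation.leibniz_pow, M.dW, smul_eq_mul, mul_one, nsmul_eq_mul] at h3
      have h4 : IsUnit ((i - j : ℕ) : Q) := by
        rw [CharP.isUnit_natCast_iff hp]
        exact fun h => absurd (Nat.le_of_dvd (by omega) h) (by omega)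
      have h5 := (Ideal.unit_mul_mem_iff_mem J h4).1 h3
      rwa [Nat.sub_sub] at h5
  have h3 := h2 i le_rfl
  rw [Nat.sub_self, pow_zero] at h3
  exact hJ ((Ideal.eq_top_iff_one J).2 h3)

end InsepModel

/-- Along an action whose fixed locus is the closed point, the `p`-th powers of elements of `𝔪_B`
lie in the parameter ideal `(s, t)`. -/
theorem InsepModel.algebraMap_mem_span [hp : Fact p.Prime] [CharP Q p]
    {k : Type*} [Field k] [CharP k p] {H : Type*} [CommRing H] [HopfAlgebra k H]
    (hH : IsMuP k p H ∨ IsAlphaP k p H)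
    {B : Type*} [CommRing B] [IsDomain B] [IsLocalRing B] [Algebra k B]
    (ρ : GroupSchemeAction k H B) {A : Type*} [CommRing A] [Algebra k A] {π : A →ₐ[k] B}
    (hq : ρ.IsQuotient π) (hfix : ρ.fixedLocus = {closedPoint B})
    [Algebra B Q] (hnz : ∀ b : B, b ≠ 0 → ∀ q : Q, algebraMap B Q b * q = 0 → q = 0)
    (hloc : ∀ b ∈ maximalIdeal B, algebraMap B Q b ∈ maximalIdeal Q)
    (hpow : ∀ a : A, ∃ q : Q, algebraMap B Q (π a) = q ^ p)
    {x y : B} (hx : x ∈ maximalIdeal B) (hy : y ∈ maximalIdeal B)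
    (hxy : RegPair (algebraMap B Q x) (algebraMap B Q y)) (b : B) (hb : b ∈ maximalIdeal B) :
    algebraMap B Q b ∈ Ideal.span {s, t} := by
  let δ : Derivation ℤ B Q := Derivation.mk' (d.toLinearMap ∘ₗ
    (algebraMap B Q).toAddMonoidHom.toIntLinearMap) fun a b => by
      change d (algebraMap B Q (a * b)) = a • d (algebraMap B Q b) + b • d (algebraMap B Q a)
      rw [map_mul, Derivation.leibniz]
      simp only [Algebra.smul_def]
      rfl
  have hδ' : ∀ b, δ b = d (algebraMap B Q b) := fun _ => rfl
  -- Invariants become `p`-th powers in `Q`, which every derivation kills.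
  have hδ : ∀ a, δ (π a) = 0 := by
    intro a
    obtain ⟨q, hq⟩ := hpow a
    rw [hδ', hq, Derivation.leibniz_pow, ← Nat.cast_smul_eq_nsmul Q, CharP.cast_eq_zero, zero_smul]
  obtain ⟨D, hD, hDmem, hprop⟩ : ∃ D : Derivation k B B, ρ.fixedIdeal ≤ Ideal.span (Set.range D) ∧
      (∀ b, D b ∈ ρ.fixedIdeal) ∧ ∀ b b', D b • δ b' = D b' • δ b := by
    rcases hH with hH | hH
    · exact exists_vectorField_of_isMuP hH ρ hq hnz δ hδ
    · exact exists_vectorField_of_isAlphaP hH ρ hq hnz δ hδ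
  have hle : ρ.fixedIdeal ≤ maximalIdeal B := by
    have : closedPoint B ∈ ρ.fixedLocus := by rw [hfix]; exact rfl
    exact this
  have hrad : maximalIdeal B ≤ ρ.fixedIdeal.radical := by
    rw [← PrimeSpectrum.vanishingIdeal_zeroLocus_eq_radical]
    change _ ≤ PrimeSpectrum.vanishingIdeal ρ.fixedLocus
    rw [hfix, PrimeSpectrum.vanishingIdeal_singleton]
    exact le_rfl
  -- The fixed ideal is `𝔪_B`-primary, so `z^N` is a combination of values `D b'`, and `D b' · δ b =
  -- D b · δ b'`.
  have hdiv : ∀ z ∈ maximalIdeal B, ∃ N, ∀ b, algebraMap B Q (D b) ∣ algebraMap B Q z ^ N * δ b := by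
    intro z hz
    obtain ⟨N, hN⟩ := hrad hz
    refine ⟨N, fun b => ?_⟩
    have h1 := hD hN
    rw [← map_pow]
    generalize z ^ N = w at h1
    clear hN
    induction h1 using Submodule.span_induction with
    | mem w hw =>
      obtain ⟨b', rfl⟩ := hw
      refine ⟨δ b', ?_⟩
      have := hprop b' b
      rwa [Algebra.smul_def, Algebra.smul_def] at this
    | zero => simp
    | add w w' _ _ h h' => rw [map_add, add_mul]; exact dvd_add h h'
    | smul c w _ h =>
      rw [smul_eq_mul, map_mul, mul_assoc]
      exact h.mul_left _
  -- Depth two removes the powers of `x` and `y`: the pole of `δ/D` could lie only at the closed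
  -- point.
  have hdvd : ∀ b, algebraMap B Q (D b) ∣ δ b := by
    intro b
    obtain ⟨N, hN⟩ := hdiv x hx
    obtain ⟨N', hN'⟩ := hdiv y hy
    have hR := hxy.pow N N'
    by_cases h0 : D b = 0
    · have h1 := hN b
      rw [h0, map_zero, zero_dvd_iff] at h1
      rw [hR.nzl _ h1]
      exact dvd_zero _
    · exact hR.dvd_of_dvd_mul (hnz _ h0) (hN b) (hN' b)
  -- This ideal is `d`-stable: on the image of `b ∈ 𝔪_B`, `d` takes the value `δ b`, a multiple of
  -- `D b`, which lies in the fixed ideal and so in `𝔪_B`.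
  let J : Ideal Q := (maximalIdeal B).map (algebraMap B Q) ⊔ Ideal.span {s, t}
  have hst : Ideal.span {s, t} ≤ maximalIdeal Q := by
    rw [M.span_eq]
    exact Ideal.span_mono (by intro z hz; simp only [Set.mem_insert_iff, Set.mem_singleton_iff] at hz ⊢; tauto)
  have hJm : J ≤ maximalIdeal Q := by
    refine sup_le (Ideal.map_le_iff_le_comap.2 hloc) hst
  refine M.le_span_of_stable hp.out (J := J) ?_ le_sup_right ?_
    (Ideal.mem_sup_left (Ideal.mem_map_of_mem _ hb))
  · exact fun h => (maximalIdeal.isMaximal Q).ne_top (top_le_iff.1 (h ▸ hJm))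
  · intro q hq
    have hJs : J = Ideal.span (algebraMap B Q '' (maximalIdeal B) ∪ {s, t}) := by
      rw [Ideal.span_union]
      rfl
    rw [hJs] at hq
    induction hq using Submodule.span_induction with
    | mem q hq =>
      rcases hq with ⟨b, hb, rfl⟩ | hq
      · obtain ⟨c, hc⟩ := hdvd b
        rw [← hδ', hc]
        exact Ideal.mul_mem_right _ _ (Ideal.mem_sup_left (Ideal.mem_map_of_mem _ (hle (hDmem b))))
      · rcases hq with rfl | rfl
        · rw [M.dl]; exact J.zero_mem
        · rw [M.dr]; exact J.zero_mem
    | zero => rw [map_zero]; exact J.zero_mem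
    | add q q' _ _ h h' => rw [map_add]; exact J.add_mem h h'
    | smul c q hq h =>
      rw [smul_eq_mul, Derivation.leibniz]
      refine J.add_mem (J.mul_mem_left _ h) ?_
      rw [smul_eq_mul]
      refine J.mul_mem_right _ ?_
      rw [hJs]
      exact hq

end Inseparable

/-! ### Passage to the completion -/

section Completion

open RingTheory.Sequence
open scoped Pointwise

theorem isWeaklyRegular_pair_iff {R : Type*} [CommRing R] {x y : R} :
    IsWeaklyRegular R [x, y] ↔ (∀ a, x * a = 0 → a = 0) ∧ ∀ a b, y * a = x * b → x ∣ a := by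
  rw [isWeaklyRegular_cons_iff, isWeaklyRegular_cons_iff, isSMulRegular_iff_right_eq_zero_of_smul,
    isSMulRegular_iff_right_eq_zero_of_smul]
  have hmem : ∀ a : R, a ∈ x • (⊤ : Submodule R R) ↔ x ∣ a := by
    intro a
    rw [Submodule.mem_smul_pointwise_iff_exists]
    constructor
    · rintro ⟨b, -, rfl⟩; exact ⟨b, rfl⟩
    · rintro ⟨b, rfl⟩; exact ⟨b, trivial, rfl⟩
  refine and_congr Iff.rfl ⟨fun h a b hab => ?_, fun h => ⟨fun a ha => ?_, IsWeaklyRegular.nil _ _⟩⟩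
  · rw [← hmem, ← Submodule.Quotient.mk_eq_zero]
    apply h.1
    rw [← Submodule.Quotient.mk_smul, Submodule.Quotient.mk_eq_zero, hmem]
    exact ⟨b, hab⟩
  · obtain ⟨a, rfl⟩ := Submodule.Quotient.mk_surjective _ a
    rw [← Submodule.Quotient.mk_smul, Submodule.Quotient.mk_eq_zero, hmem] at ha
    obtain ⟨b, hb⟩ := ha
    rw [Submodule.Quotient.mk_eq_zero, hmem]
    exact h a b hb

theorem regPair_of_isRegular {R : Type*} [CommRing R] [IsDomain R] {x y : R}
    (h : IsRegular R [x, y]) : RegPair x y := by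
  obtain ⟨h1, h2⟩ := isWeaklyRegular_pair_iff.1 h.toIsWeaklyRegular
  refine ⟨h1, fun a ha => (mul_eq_zero.1 ha).resolve_left ?_, h2⟩
  rintro rfl
  refine h.top_ne_smul (Eq.symm ?_)
  obtain ⟨c, hc⟩ := h2 1 0 (by simp)
  rw [smul_eq_mul, Ideal.mul_top, Ideal.eq_top_iff_one, hc]
  exact Ideal.mul_mem_right _ _ (Ideal.subset_span (by simp))

/-- The properties of the map from a Noetherian local ring to its completion. -/
structure IsCompletionMap {A Q : Type*} [CommRing A] [IsLocalRing A] [CommRing Q] [IsLocalRing Q]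
    (g : A →+* Q) : Prop where
  approx : ∀ N q, ∃ a, q - g a ∈ maximalIdeal Q ^ N
  reflect : ∀ N a, g a ∈ maximalIdeal Q ^ N → a ∈ maximalIdeal A ^ N
  le_map : maximalIdeal Q ≤ (maximalIdeal A).map g
  nz : ∀ a, (∀ b, a * b = 0 → b = 0) → ∀ q, g a * q = 0 → q = 0
  regPair : ∀ x y, RegPair x y → RegPair (g x) (g y)

/-- The statements on powers hold because, for Noetherian `A`, the `N`-th power of the maximal ideal
of the completion is the kernel of the projection to `A/𝔪^N`; those on regularity follow from
flatness. -/
theorem isCompletionMap_algebraMap (A : Type*) [CommRing A] [IsLocalRing A] [IsNoetherianRing A] :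
    IsCompletionMap (algebraMap A (AdicCompletion (maximalIdeal A) A)) := by
  have hmem : ∀ N (q : AdicCompletion (maximalIdeal A) A),
      q ∈ maximalIdeal (AdicCompletion (maximalIdeal A) A) ^ N ↔
        AdicCompletion.eval (maximalIdeal A) A N q = 0 := by
    intro N q
    rw [AdicCompletion.maximalIdeal_eq_map, ← Ideal.map_pow, ← Submodule.restrictScalars_mem A,
      ← Ideal.smul_top_eq_map, AdicCompletion.pow_smul_top_eq_ker_eval
        (maximalIdeal A).fg_of_isNoetherianRing, LinearMap.mem_ker]
  have heval : ∀ N a, AdicCompletion.eval (maximalIdeal A) A N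
      (algebraMap A (AdicCompletion (maximalIdeal A) A) a) = Submodule.Quotient.mk a := fun N a => rfl
  have hnz : ∀ a : A, (∀ b, a * b = 0 → b = 0) →
      ∀ q, algebraMap A (AdicCompletion (maximalIdeal A) A) a * q = 0 → q = 0 := by
    intro a ha q hq
    have h1 : IsSMulRegular A a := isSMulRegular_iff_right_eq_zero_of_smul.2 ha
    have h2 : IsSMulRegular (AdicCompletion (maximalIdeal A) A)
      (algebraMap A (AdicCompletion (maximalIdeal A) A) a) := h1.of_flat
    exact isSMulRegular_iff_right_eq_zero_of_smul.1 h2 q hq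
  refine ⟨fun N q => ?_, fun N a ha => ?_, AdicCompletion.maximalIdeal_eq_map.le, hnz, ?_⟩
  · obtain ⟨a, ha⟩ := Submodule.Quotient.mk_surjective _ (AdicCompletion.eval (maximalIdeal A) A N q)
    exact ⟨a, by rw [hmem, map_sub, heval, ha, sub_self]⟩
  · rw [hmem, heval, Submodule.Quotient.mk_eq_zero] at ha
    simpa using ha
  · intro x y h
    have h1 : IsWeaklyRegular A [x, y] := isWeaklyRegular_pair_iff.2 ⟨h.nzl, h.dvd⟩
    have h2 := isWeaklyRegular_pair_iff.1 (h1.of_flat (S := AdicCompletion (maximalIdeal A) A))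
    exact ⟨h2.1, hnz y h.nzr, h2.2⟩

namespace IsCompletionMap

variable {A Q : Type*} [CommRing A] [IsLocalRing A] [CommRing Q] [IsLocalRing Q]

variable {g : A →+* Q} (h : IsCompletionMap g)
include h

theorem mem_iff (a : A) : g a ∈ maximalIdeal Q ↔ a ∈ maximalIdeal A := by
  constructor
  · intro ha
    simpa using h.reflect 1 a (by simpa using ha)
  · intro ha
    rw [mem_maximalIdeal, mem_nonunits_iff]
    intro hu
    obtain ⟨q, hq⟩ := hu.exists_right_inv
    obtain ⟨b, hb⟩ := h.approx 1 q
    have h1 : g (1 - a * b) ∈ maximalIdeal Q ^ 1 := by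
      have := Ideal.mul_mem_left _ (g a) hb
      rwa [mul_sub, hq, ← map_mul, ← map_one g, ← map_sub] at this
    have h2 := h.reflect 1 _ h1
    rw [pow_one] at h2
    have h3 := Ideal.add_mem _ h2 (Ideal.mul_mem_right b _ ha)
    rw [sub_add_cancel] at h3
    exact (Ideal.ne_top_iff_one _).1 (maximalIdeal.isMaximal A).ne_top h3

theorem paramPair {x y : A} (hxy : ParamPair x y) : ParamPair (g x) (g y) where
  toRegPair := h.regPair x y hxy.toRegPair
  memL := (h.mem_iff x).2 hxy.memL
  memR := (h.mem_iff y).2 hxy.memR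
  primary := by
    obtain ⟨N, hN⟩ := hxy.primary
    refine ⟨N, (Ideal.pow_right_mono h.le_map N).trans ?_⟩
    rw [← Ideal.map_pow]
    refine (Ideal.map_mono hN).trans ?_
    rw [Ideal.map_span, Set.image_pair]

/-- In length one the numerator of `a/(x^i y^i)` matters only modulo `(x^i, y^i)`, which contains a
power of the maximal ideal, and modulo such a power `A` and `Q` agree. Dévissage gives the other
lengths. -/
theorem cechMap_bijective {p : ℕ} [Fact p.Prime] {x y : A} (hxy : ParamPair x y)
    (hfg : (maximalIdeal A).FG) (n : ℕ) :
    Function.Bijective (cechMap p n (IsCechHom.self_map g x y)) := by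
  have hQ := h.paramPair hxy
  have hfgQ : (maximalIdeal Q).FG := by
    have : maximalIdeal Q = (maximalIdeal A).map g :=
      le_antisymm h.le_map (Ideal.map_le_iff_le_comap.2 fun a ha => (h.mem_iff a).2 ha)
    rw [this]
    exact hfg.map g
  have hinj : Function.Injective (cechMap p 1 (IsCechHom.self_map g x y)) := by
    rw [injective_iff_map_eq_zero]
    intro z hz
    obtain ⟨f, rfl⟩ := cls_surj z
    obtain ⟨a, i, rfl⟩ := exists_frac x y f
    obtain ⟨N, hN⟩ := hxy.primary_pow hfg i i
    rw [cechMap_cls, IsCechHom.loc_frac_self_map, hQ.toRegPair.cls_frac_eq_zero_iff] at hz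
    obtain ⟨α, β, e⟩ := hz
    obtain ⟨a₁, h₁⟩ := h.approx N α
    obtain ⟨a₂, h₂⟩ := h.approx N β
    have h3 : a - x ^ i * a₁ - y ^ i * a₂ ∈ maximalIdeal A ^ N := by
      apply h.reflect
      simp only [map_sub, map_mul, map_pow, e]
      convert Ideal.add_mem _ (Ideal.mul_mem_left _ (g x ^ i) h₁)
        (Ideal.mul_mem_left _ (g y ^ i) h₂) using 1
      ring
    obtain ⟨c, d, h4⟩ := Ideal.mem_span_pair.1 (hN h3)
    exact (hxy.toRegPair.cls_frac_eq_zero_iff _ _ _).2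
      ⟨a₁ + c, a₂ + d, by linear_combination -h4⟩
  have hsurj : Function.Surjective (cechMap p 1 (IsCechHom.self_map g x y)) := by
    intro z
    obtain ⟨f, rfl⟩ := cls_surj z
    obtain ⟨q, i, rfl⟩ := exists_frac _ _ f
    obtain ⟨N, hN⟩ := hQ.primary_pow hfgQ i i
    obtain ⟨a, ha⟩ := h.approx N q
    obtain ⟨c, d, h4⟩ := Ideal.mem_span_pair.1 (hN ha)
    refine ⟨cls p x y (frac x y a i i), ?_⟩
    rw [cechMap_cls, IsCechHom.loc_frac_self_map]
    have : q = g a + (g x ^ i * c + g y ^ i * d) := by linear_combination -h4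
    rw [this, frac_add, map_add, cls_frac_eq_zero, add_zero]
  exact ⟨cechMap_injective_of_one _ hQ.toRegPair hinj n, cechMap_surjective_of_one _ hsurj n⟩

end IsCompletionMap

end Completion

/-! ### Variables as prime elements of a power series ring -/

section PowerSeries

variable {σ k : Type*} [Field k]

/-- The terms of a power series that do not involve a given variable. -/
def dropVar (i : σ) (φ : MvPowerSeries σ k) : MvPowerSeries σ k :=
  open Classical in fun m => if m i = 0 then MvPowerSeries.coeff m φ else 0

theorem coeff_dropVar (i : σ) (φ : MvPowerSeries σ k) (m : σ →₀ ℕ) [Decidable (m i = 0)] :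
    MvPowerSeries.coeff m (dropVar i φ) = if m i = 0 then MvPowerSeries.coeff m φ else 0 := by
  rw [MvPowerSeries.coeff_apply, dropVar]
  congr

theorem X_dvd_iff_dropVar (i : σ) (φ : MvPowerSeries σ k) :
    MvPowerSeries.X i ∣ φ ↔ dropVar i φ = 0 := by
  classical
  rw [MvPowerSeries.X_dvd_iff, MvPowerSeries.ext_iff]
  refine forall_congr' fun m => ?_
  rw [coeff_dropVar]
  split_ifs with h <;> simp [h]

theorem X_dvd_sub_dropVar (i : σ) (φ : MvPowerSeries σ k) :
    MvPowerSeries.X i ∣ φ - dropVar i φ := by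
  classical
  rw [MvPowerSeries.X_dvd_iff]
  intro m hm
  rw [map_sub, coeff_dropVar, if_pos hm, sub_self]

theorem dropVar_mul (i : σ) (φ ψ : MvPowerSeries σ k) :
    dropVar i (φ * ψ) = dropVar i φ * dropVar i ψ := by
  classical
  ext m
  rw [coeff_dropVar, MvPowerSeries.coeff_mul, MvPowerSeries.coeff_mul]
  have key : ∀ q ∈ Finset.HasAntidiagonal.antidiagonal m, q.1 i + q.2 i = m i := by
    intro q hq
    rw [Finset.HasAntidiagonal.mem_antidiagonal] at hq
    rw [← hq, Finsupp.add_apply]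
  split_ifs with h
  · refine Finset.sum_congr rfl fun q hq => ?_
    have := key q hq
    rw [coeff_dropVar, coeff_dropVar, if_pos (by omega), if_pos (by omega)]
  · refine (Finset.sum_eq_zero fun q hq => ?_).symm
    have := key q hq
    rw [coeff_dropVar, coeff_dropVar]
    split_ifs with h1 h2
    · omega
    · rw [mul_zero]
    · rw [zero_mul]
    · rw [zero_mul]

/-- Setting `X i = 0` is multiplicative with values in a domain. -/
theorem X_dvd_of_dvd_mul (i : σ) {φ ψ : MvPowerSeries σ k} (h : MvPowerSeries.X i ∣ φ * ψ)
    (hφ : ¬ MvPowerSeries.X i ∣ φ) : MvPowerSeries.X i ∣ ψ := by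
  rw [X_dvd_iff_dropVar] at *
  rw [dropVar_mul] at h
  exact (mul_eq_zero.1 h).resolve_left hφ

theorem maximalIdeal_mvPowerSeries_le {a b w : Fin 3} (hσ : ∀ i, i = a ∨ i = b ∨ i = w) :
    maximalIdeal (MvPowerSeries (Fin 3) k) ≤
      Ideal.span {MvPowerSeries.X a, MvPowerSeries.X b, MvPowerSeries.X w} := by
  classical
  intro φ hφ
  have hc : MvPowerSeries.constantCoeff φ = 0 := by
    by_contra h
    exact hφ (MvPowerSeries.isUnit_iff_constantCoeff.2 (isUnit_iff_ne_zero.2 h))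
  have hmem : ∀ i ψ, dropVar i ψ ∈ Ideal.span
      {MvPowerSeries.X a, MvPowerSeries.X b, (MvPowerSeries.X w : MvPowerSeries (Fin 3) k)} →
      ψ ∈ Ideal.span {MvPowerSeries.X a, MvPowerSeries.X b, MvPowerSeries.X w} := by
    intro i ψ h
    obtain ⟨c, hc⟩ := X_dvd_sub_dropVar i ψ
    rw [sub_eq_iff_eq_add.1 hc]
    refine Ideal.add_mem _ (Ideal.mul_mem_right _ _ (Ideal.subset_span ?_)) h
    rcases hσ i with rfl | rfl | rfl <;> simp
  apply hmem a
  apply hmem b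
  apply hmem w
  have : dropVar w (dropVar b (dropVar a φ)) = 0 := by
    ext m
    rw [coeff_dropVar, coeff_dropVar, coeff_dropVar]
    split_ifs with h1 h2 h3
    · have : m = 0 := by
        ext i
        rcases hσ i with rfl | rfl | rfl <;> assumption
      rw [this]
      exact hc
    all_goals simp
  rw [this]
  exact Ideal.zero_mem _

end PowerSeries

/-! ### The hypersurface `W^p = N(s, t)` -/

section Model

variable {k : Type*} [Field k] {p : ℕ} [hp : Fact p.Prime] [CharP k p]

/-- The hypersurface `W ^ p = N(s, t)` in `k[[s, t, W]]`. -/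
theorem exists_insepModel {a b w : Fin 3} (hσ : ∀ i, i = a ∨ i = b ∨ i = w) (haw : a ≠ w)
    (hbw : b ≠ w) {f N : MvPowerSeries (Fin 3) k} (hf : f = MvPowerSeries.X w ^ p - N)
    (hN : N ∈ Ideal.span {MvPowerSeries.X a, MvPowerSeries.X b})
    (hd : MvPowerSeries.pderiv k w N = 0) {Q : Type*} [CommRing Q]
    (e : (MvPowerSeries (Fin 3) k ⧸ Ideal.span {f}) ≃+* Q) :
    ∃ m : MvPowerSeries (Fin 3) k →+* Q, m N = m (MvPowerSeries.X w) ^ p ∧ CharP Q p ∧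
    IsNoetherianRing Q ∧
    ∃ (_ : IsLocalRing Q) (d : Derivation ℤ Q Q),
      InsepModel p (m (MvPowerSeries.X a)) (m (MvPowerSeries.X b)) (m (MvPowerSeries.X w)) d ∧
      (∀ q, m (MvPowerSeries.X a) * q = 0 → q = 0) ∧
      (∀ q, m (MvPowerSeries.X b) * q = 0 → q = 0) := by
  classical
  let m : MvPowerSeries (Fin 3) k →+* Q := (e : _ →+* Q).comp (Ideal.Quotient.mk (Ideal.span {f}))
  have hms : Function.Surjective m := e.surjective.comp Ideal.Quotient.mk_surjective
  have hm0 : ∀ φ, m φ = 0 ↔ f ∣ φ := by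
    intro φ
    change e (Ideal.Quotient.mk _ φ) = 0 ↔ _
    rw [map_eq_zero_iff e e.injective, Ideal.Quotient.eq_zero_iff_mem, Ideal.mem_span_singleton]
  have hmN : m N = m (MvPowerSeries.X w) ^ p := by
    rw [← map_pow, eq_comm, ← sub_eq_zero, ← map_sub, hm0, hf]
  have hNc : ∀ j : ℕ, MvPowerSeries.coeff (Finsupp.single w j) N = 0 := by
    intro j
    obtain ⟨α, β, rfl⟩ := Ideal.mem_span_pair.1 hN
    rw [map_add, MvPowerSeries.X_dvd_iff.1 (dvd_mul_left (MvPowerSeries.X a) α) _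
      (by rw [Finsupp.single_apply, if_neg haw.symm]),
      MvPowerSeries.X_dvd_iff.1 (dvd_mul_left (MvPowerSeries.X b) β) _
      (by rw [Finsupp.single_apply, if_neg hbw.symm]), add_zero]
  -- The pure power of `W` survives in `f`, so no other variable divides `f`; being prime, the other
  -- variables are nonzerodivisors modulo `f`.
  have hfc : MvPowerSeries.coeff (Finsupp.single w p) f = 1 := by
    rw [hf, map_sub, hNc, sub_zero, MvPowerSeries.X_pow_eq, MvPowerSeries.coeff_monomial_same]
  have hfX : ∀ i, i ≠ w → ¬ MvPowerSeries.X i ∣ f := by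
    intro i hi h
    have := MvPowerSeries.X_dvd_iff.1 h (Finsupp.single w p)
      (by rw [Finsupp.single_apply, if_neg hi.symm])
    rw [hfc] at this
    exact one_ne_zero this
  have hX0 : ∀ i, (MvPowerSeries.X i : MvPowerSeries (Fin 3) k) ≠ 0 := by
    intro i h
    have := MvPowerSeries.coeff_index_single_self_X (R := k) i
    rw [h, map_zero] at this
    exact zero_ne_one this
  have hnz : ∀ i, i ≠ w → ∀ q, m (MvPowerSeries.X i) * q = 0 → q = 0 := by
    intro i hi q hq
    obtain ⟨φ, rfl⟩ := hms q
    rw [← map_mul, hm0] at hq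
    obtain ⟨h, hh⟩ := hq
    obtain ⟨h', rfl⟩ := X_dvd_of_dvd_mul i ⟨φ, hh.symm⟩ (hfX i hi)
    rw [hm0]
    refine ⟨h', mul_left_cancel₀ (hX0 i) ?_⟩
    rw [hh]
    ring
  have hfm : f ∈ maximalIdeal (MvPowerSeries (Fin 3) k) := by
    rw [mem_maximalIdeal, mem_nonunits_iff, MvPowerSeries.isUnit_iff_constantCoeff, hf, map_sub,
      map_pow, MvPowerSeries.constantCoeff_X, zero_pow hp.out.ne_zero]
    have := hNc 0
    rw [Finsupp.single_zero] at this
    rw [← MvPowerSeries.coeff_zero_eq_constantCoeff_apply, this, sub_zero]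
    exact not_isUnit_zero
  have hnt : Nontrivial Q := by
    refine ⟨⟨m 1, 0, fun h => ?_⟩⟩
    rw [hm0] at h
    exact hfm (isUnit_of_dvd_one h)
  have hloc : IsLocalRing Q := IsLocalRing.of_surjective' m hms
  have hchar : CharP Q p :=
    charP_of_injective_ringHom (f := m.comp (MvPowerSeries.C (σ := Fin 3) (R := k)))
      (RingHom.injective _) p
  let D := MvPowerSeries.pderiv k w
  -- In characteristic `p` the term `W^p` has derivative zero, as has `N` by hypothesis. Hence
  -- `∂/∂W` preserves `(f)` and descends to `Q`.
  have hDf : D f = 0 := by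
    rw [hf, map_sub, hd, sub_zero, Derivation.leibniz_pow, ← Nat.cast_smul_eq_nsmul k,
      CharP.cast_eq_zero, zero_smul]
  have hD : ∀ φ ψ, m φ = m ψ → m (D φ) = m (D ψ) := by
    intro φ ψ h
    rw [← sub_eq_zero, ← map_sub, hm0] at h
    obtain ⟨c, hc⟩ := h
    rw [← sub_eq_zero, ← map_sub, ← map_sub, hc, Derivation.leibniz, hDf, smul_zero, add_zero,
      smul_eq_mul, hm0]
    exact dvd_mul_right _ _
  let s := Function.surjInv hms
  have hs : ∀ q, m (s q) = q := Function.surjInv_eq hms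
  have hdm : ∀ φ, m (D (s (m φ))) = m (D φ) := fun φ => hD _ _ (hs _)
  let d : Derivation ℤ Q Q := Derivation.mk' (AddMonoidHom.mk' (fun q => m (D (s q))) (by
      intro q q'
      obtain ⟨φ, rfl⟩ := hms q
      obtain ⟨ψ, rfl⟩ := hms q'
      rw [← map_add, hdm, hdm, hdm, map_add, map_add])).toIntLinearMap (by
      intro q q'
      obtain ⟨φ, rfl⟩ := hms q
      obtain ⟨ψ, rfl⟩ := hms q'
      change m (D (s (m φ * m ψ))) = m φ • m (D (s (m ψ))) + m ψ • m (D (s (m φ)))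
      rw [← map_mul, hdm, hdm, hdm, Derivation.leibniz, map_add]
      simp only [smul_eq_mul, map_mul])
  have hd' : ∀ φ, d (m φ) = m (D φ) := hdm
  refine ⟨m, hmN, hchar, isNoetherianRing_of_surjective _ _ m hms, hloc, d,
    ⟨?_, ?_, ?_, ?_, ?_⟩, hnz a haw, hnz b hbw⟩
  · rw [hd', MvPowerSeries.pderiv_X_of_ne haw, map_zero]
  · rw [hd', MvPowerSeries.pderiv_X_of_ne hbw, map_zero]
  · rw [hd', MvPowerSeries.pderiv_X_self, map_one]
  · refine le_antisymm (fun q hq => ?_) ?_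
    · obtain ⟨φ, rfl⟩ := hms q
      have h1 : φ ∈ maximalIdeal (MvPowerSeries (Fin 3) k) := by
        rw [mem_maximalIdeal, mem_nonunits_iff]
        exact fun h => hq (h.map m)
      have := Ideal.mem_map_of_mem m (maximalIdeal_mvPowerSeries_le hσ h1)
      rwa [Ideal.map_span, Set.image_insert_eq, Set.image_pair] at this
    · rw [Ideal.span_le]
      have hX : ∀ i, m (MvPowerSeries.X i) ∈ maximalIdeal Q := by
        intro i
        rw [mem_maximalIdeal, mem_nonunits_iff]
        intro hu
        obtain ⟨q, hq⟩ := hu.exists_right_inv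
        obtain ⟨φ, rfl⟩ := hms q
        rw [← map_mul, ← map_one m, ← sub_eq_zero, ← map_sub, hm0] at hq
        obtain ⟨c, hc⟩ := hq
        have h1 : MvPowerSeries.X i ∈ maximalIdeal (MvPowerSeries (Fin 3) k) := by
          rw [mem_maximalIdeal, mem_nonunits_iff, MvPowerSeries.isUnit_iff_constantCoeff,
            MvPowerSeries.constantCoeff_X]
          exact not_isUnit_zero
        have h2 := Ideal.sub_mem _ (Ideal.mul_mem_right φ _ h1) (Ideal.mul_mem_right c _ hfm)
        rw [← hc, sub_sub_cancel] at h2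
        exact (Ideal.ne_top_iff_one _).1 (maximalIdeal.isMaximal _).ne_top h2
      rintro _ (rfl | rfl | rfl) <;> exact hX _
  · rw [← hmN]
    have := Ideal.mem_map_of_mem m hN
    rwa [Ideal.map_span, Set.image_pair] at this

end Model

/-! ### Universal formulas for sums of Teichmüller representatives -/

section WittAddition

universe u

variable (p : ℕ) [hp : Fact p.Prime]

theorem ghostComponent_eq_sum {R : Type*} [CommRing R] (x : WittVector p R) (n : ℕ) :
    WittVector.ghostComponent n x
      = ∑ i ∈ Finset.range (n + 1), (p : R) ^ i * x.coeff i ^ p ^ (n - i) := by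
  rw [WittVector.ghostComponent_apply, aeval_wittPolynomial]

variable {p} in
theorem eq_of_ghostComponent_eq {R : Type*} [CommRing R] [IsDomain R] [CharZero R]
    {x y : WittVector p R} (h : ∀ n, WittVector.ghostComponent n x = WittVector.ghostComponent n y) :
    x = y := by
  ext n
  induction n using Nat.strong_induction_on with
  | _ n ih =>
    have h1 := h n
    rw [ghostComponent_eq_sum, ghostComponent_eq_sum, Finset.sum_range_succ, Finset.sum_range_succ,
      Finset.sum_congr rfl fun i hi => by rw [ih i (Finset.mem_range.1 hi)], add_right_inj,
      Nat.sub_self, pow_zero, pow_one, pow_one] at h1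
    exact mul_left_cancel₀ (pow_ne_zero _ (Nat.cast_ne_zero.2 hp.out.ne_zero)) h1

/-- The universal polynomials in `[a + b] = [a] + [b] + (P₀, P₁, …)`. -/
theorem exists_teichmuller_add : ∃ P : ℕ → MvPolynomial (Fin 2) ℤ,
    (∀ n, ∑ i ∈ Finset.range (n + 1), (p : MvPolynomial (Fin 2) ℤ) ^ i * P i ^ p ^ (n - i)
      = (MvPolynomial.X 0 + MvPolynomial.X 1) ^ p ^ n - MvPolynomial.X 0 ^ p ^ n
        - MvPolynomial.X 1 ^ p ^ n) ∧
    ∀ (R : Type u) [CommRing R] (a b : R), ∃ x : WittVector p R,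
      WittVector.teichmuller p (a + b)
        = WittVector.teichmuller p a + WittVector.teichmuller p b + x ∧
      ∀ i, x.coeff i = MvPolynomial.aeval ![a, b] (P i) := by
  let X : Fin 2 → MvPolynomial (Fin 2) ℤ := MvPolynomial.X
  let z := WittVector.teichmuller p (X 0 + X 1) - WittVector.teichmuller p (X 0)
    - WittVector.teichmuller p (X 1)
  refine ⟨z.coeff, fun n => ?_, fun R _ a b =>
    ⟨WittVector.map (MvPolynomial.aeval ![a, b]).toRingHom z, ?_, fun i => ?_⟩⟩
  · rw [← ghostComponent_eq_sum, map_sub, map_sub, WittVector.ghostComponent_teichmuller,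
      WittVector.ghostComponent_teichmuller, WittVector.ghostComponent_teichmuller]
  · simp only [z, map_sub, WittVector.map_teichmuller]
    simp [X]
  · rw [WittVector.map_coeff]; rfl

open Polynomial in
/-- `[τ (1 + β)] = [τ] + (τ θ₀(β), τ ^ p θ₁(β), …)`, where `θ_j` has leading term `β`. -/
theorem exists_teichmuller_one_add : ∃ ψ : ℕ → ℤ[X],
    ∀ (R : Type u) [CommRing R] (τ β : R), ∃ x : WittVector p R,
      WittVector.teichmuller p (τ * (1 + β)) = WittVector.teichmuller p τ + x ∧
      ∀ i, x.coeff i = τ ^ p ^ i * (β + β ^ 2 * eval₂RingHom (Int.castRingHom R) β (ψ i)) := by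
  let z := WittVector.teichmuller p (1 + X : ℤ[X]) - 1
  have hz : ∀ n, ∑ i ∈ Finset.range (n + 1), (p : ℤ[X]) ^ i * z.coeff i ^ p ^ (n - i)
      = (1 + X) ^ p ^ n - 1 := by
    intro n
    rw [← ghostComponent_eq_sum, map_sub, WittVector.ghostComponent_teichmuller, map_one]
  have hX : ∀ i, X ∣ z.coeff i := by
    intro i
    have h1 : WittVector.map (evalRingHom (0 : ℤ)) z = 0 := by
      simp only [z, map_sub, WittVector.map_teichmuller, map_one]
      simp
    have h2 := congrArg (fun w => WittVector.coeff w i) h1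
    rw [X_dvd_iff, coeff_zero_eq_eval_zero]
    simpa [WittVector.map_coeff] using h2
  have hpow : ∀ m : ℕ, X ^ 2 ∣ (1 + X : ℤ[X]) ^ m - 1 - (m : ℤ[X]) * X := by
    intro m
    induction m with
    | zero => simp
    | succ m ih =>
      obtain ⟨c, hc⟩ := ih
      refine ⟨c * (1 + X) + (m : ℤ[X]), ?_⟩
      push_cast
      rw [pow_succ]
      linear_combination (1 + X) * hc
  -- Modulo `X^2` only the last term of the ghost component survives, because `X` divides every
  -- component: `p^n z_n ≡ (1 + X)^(p^n) - 1 ≡ p^n X`.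
  have hdvd : ∀ i, X ^ 2 ∣ z.coeff i - X := by
    intro n
    have h1 := hz n
    rw [Finset.sum_range_succ, Nat.sub_self, pow_zero, pow_one] at h1
    have h2 : X ^ 2 ∣ ∑ i ∈ Finset.range n, (p : ℤ[X]) ^ i * z.coeff i ^ p ^ (n - i) := by
      refine Finset.dvd_sum fun i hi => Dvd.dvd.mul_left ?_ _
      refine (pow_dvd_pow_of_dvd (hX i) 2).trans (pow_dvd_pow _ ?_)
      have := Finset.mem_range.1 hi
      calc 2 ≤ p := hp.out.two_le
        _ = p ^ 1 := (pow_one p).symm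
        _ ≤ p ^ (n - i) := Nat.pow_le_pow_right hp.out.pos (by omega)
    have h3 : X ^ 2 ∣ (C ((p : ℤ) ^ n)) * (z.coeff n - X) := by
      have h4 := dvd_sub (hpow (p ^ n)) h2
      have h5 : (C ((p : ℤ) ^ n) : ℤ[X]) = (p : ℤ[X]) ^ n := by simp
      rw [h5]
      convert h4 using 1
      push_cast
      linear_combination h1
    rw [X_pow_dvd_iff] at h3 ⊢
    intro d hd
    have h6 := h3 d hd
    rw [coeff_C_mul] at h6
    exact (mul_eq_zero.1 h6).resolve_left (pow_ne_zero _ (Nat.cast_ne_zero.2 hp.out.ne_zero))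
  choose ψ hψ using hdvd
  refine ⟨ψ, fun R _ τ β => ?_⟩
  let Y : ℤ[X][X] := X
  -- Multiplication by `[Y]` scales the `i`-th component by `Y^(p^i)`. The universal identity is
  -- verified on ghost components, which are injective over a domain of characteristic zero.
  let x : WittVector p ℤ[X][X] := WittVector.mk p fun i => Y ^ p ^ i * C (z.coeff i)
  have hx : ∀ i, x.coeff i = Y ^ p ^ i * C (z.coeff i) := fun i => rfl
  have hxe : WittVector.teichmuller p (Y * (1 + C X)) = WittVector.teichmuller p Y + x := by
    apply eq_of_ghostComponent_eq
    intro n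
    rw [map_add, WittVector.ghostComponent_teichmuller, WittVector.ghostComponent_teichmuller,
      ghostComponent_eq_sum]
    have h1 : ∀ i ∈ Finset.range (n + 1), (p : ℤ[X][X]) ^ i * x.coeff i ^ p ^ (n - i)
        = Y ^ p ^ n * C ((p : ℤ[X]) ^ i * z.coeff i ^ p ^ (n - i)) := by
      intro i hi
      have : p ^ n = p ^ i * p ^ (n - i) := by
        rw [← pow_add, Nat.add_sub_cancel' (Nat.lt_succ_iff.1 (Finset.mem_range.1 hi))]
      rw [hx, mul_pow, ← pow_mul, ← this]
      simp only [map_mul, map_pow, map_natCast]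
      ring
    rw [Finset.sum_congr rfl h1, ← Finset.mul_sum, ← map_sum, hz]
    simp only [map_sub, map_pow, map_add, map_one, mul_pow]
    ring
  let f : ℤ[X][X] →+* R := eval₂RingHom (eval₂RingHom (Int.castRingHom R) β) τ
  refine ⟨WittVector.map f x, ?_, fun i => ?_⟩
  · have := congrArg (WittVector.map f) hxe
    rw [map_add, WittVector.map_teichmuller, WittVector.map_teichmuller] at this
    convert this using 3 <;> simp [f, Y]
  · rw [WittVector.map_coeff, hx, eq_add_of_sub_eq (hψ i)]
    have hY : f Y = τ := eval₂_X _ _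
    have hC : ∀ q, f (C q) = eval₂RingHom (Int.castRingHom R) β q := fun q => eval₂_C _ _
    have hX' : eval₂RingHom (Int.castRingHom R) β X = β := eval₂_X _ _
    simp only [map_mul, map_pow, hY, hC, map_add, hX']
    ring

end WittAddition

/-! ### Cohomology classes of Witt vectors -/

section WittClass

variable {p : ℕ} [hp : Fact p.Prime] {R : Type*} [CommRing R] {s t : R} (n : ℕ)

/-- The class of a Witt vector over `R[1/(st)]`. -/
def wcls : WittVector p (Localization.Away (s * t)) →+ LocalH2 p n s t :=
  (cechBoundary p n s t).mkQ.toAddMonoidHom.comp (WittVector.truncate n).toAddMonoidHom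

theorem wcls_apply (x : WittVector p (Localization.Away (s * t))) :
    wcls n x = hmk (WittVector.truncate n x) := rfl

variable {n}

theorem wcls_eq_zero_of_left {x : WittVector p (Localization.Away (s * t))}
    (h : ∀ i, x.coeff i ∈ leftRing s t) : wcls n x = 0 :=
  hmk_eq_zero_of_left _ fun i => by
    change (WittVector.truncate n x).coeff i ∈ _
    rw [WittVector.coeff_truncate]; exact h i

theorem wcls_eq_zero_of_right {x : WittVector p (Localization.Away (s * t))}
    (h : ∀ i, x.coeff i ∈ rightRing s t) : wcls n x = 0 :=
  hmk_eq_zero_of_right _ fun i => by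
    change (WittVector.truncate n x).coeff i ∈ _
    rw [WittVector.coeff_truncate]; exact h i

theorem teichmuller_coeff_mem {S : Type*} [CommRing S] (T : Subring S) {a : S} (h : a ∈ T) (i : ℕ) :
    (WittVector.teichmuller p a).coeff i ∈ T := by
  rcases Nat.eq_zero_or_pos i with rfl | hi
  · rwa [WittVector.teichmuller_coeff_zero]
  · rw [WittVector.teichmuller_coeff_pos _ _ _ hi]; exact T.zero_mem

theorem wcls_teichmuller_left {a : Localization.Away (s * t)} (h : a ∈ leftRing s t) :
    wcls n (WittVector.teichmuller p a) = 0 :=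
  wcls_eq_zero_of_left (teichmuller_coeff_mem _ h)

theorem wcls_teichmuller_right {a : Localization.Away (s * t)} (h : a ∈ rightRing s t) :
    wcls n (WittVector.teichmuller p a) = 0 :=
  wcls_eq_zero_of_right (teichmuller_coeff_mem _ h)

omit hp in
theorem coeff_select_eq_ite {S : Type*} [CommRing S] (P : ℕ → Prop) [DecidablePred P]
    (x : WittVector p S) (i : ℕ) :
    (WittVector.select P x).coeff i = if P i then x.coeff i else 0 := by
  rw [WittVector.select, WittVector.coeff_mk]
  congr

/-- A Witt vector is the sum of its initial part and its tail; the initial part is a coboundary, and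
the tail is truncated to its single component `n`. -/
theorem wcls_succ_of_left {x : WittVector p (Localization.Away (s * t))}
    (h : ∀ i < n, x.coeff i ∈ leftRing s t) :
    wcls (n + 1) x = cohV (Nat.le_add_left 1 n) s t (cls p s t (x.coeff n)) := by
  have h0 : wcls (n + 1) (WittVector.init n x) = 0 := by
    apply wcls_eq_zero_of_left
    intro i
    rw [WittVector.init, coeff_select_eq_ite]
    split_ifs with hi
    · exact h i hi
    · exact Subring.zero_mem _
  have h1 : WittVector.truncate (n + 1) (WittVector.tail n x)
      = wittV (Nat.le_add_left 1 n) (wittOne p (x.coeff n)) := by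
    rw [eq_wittV_of_truncate_eq_zero (WittVector.truncate (n + 1) (WittVector.tail n x))]
    · rw [WittVector.coeff_truncate]
      rw [WittVector.tail, coeff_select_eq_ite]
      exact congrArg _ (congrArg _ (if_pos le_rfl))
    · apply TruncatedWittVector.ext
      intro i
      rw [TruncatedWittVector.coeff_truncate, WittVector.coeff_truncate,
        TruncatedWittVector.coeff_zero, WittVector.tail, coeff_select_eq_ite]
      exact if_neg (not_le.2 i.2)
  conv_lhs => rw [← WittVector.init_add_tail x n, map_add, h0, zero_add, wcls_apply, h1]
  rfl

end WittClass

/-! ### The carries of `[a + b]` for `p = 2, 3, 5` -/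

section SmallPrimes

universe u

/-- The components come from solving the ghost equations over `ℤ` one after another, beginning with
`2 P₁ = (a + b)^2 - a^2 - b^2`. The same method serves `p = 3` and `p = 5`, where one carry
suffices. -/
theorem teichmuller_add_two {R : Type u} [CommRing R] (a b : R) : ∃ x : WittVector 2 R,
    WittVector.teichmuller 2 (a + b) = WittVector.teichmuller 2 a + WittVector.teichmuller 2 b + x ∧
    x.coeff 0 = 0 ∧ x.coeff 1 = a * b ∧ x.coeff 2 = a ^ 3 * b + a ^ 2 * b ^ 2 + a * b ^ 3 ∧
    x.coeff 3 = a ^ 7 * b + 3 * a ^ 6 * b ^ 2 + 6 * a ^ 5 * b ^ 3 + 7 * a ^ 4 * b ^ 4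
      + 6 * a ^ 3 * b ^ 5 + 3 * a ^ 2 * b ^ 6 + a * b ^ 7 := by
  obtain ⟨P, hP, h⟩ := exists_teichmuller_add.{u} 2
  obtain ⟨x, hx, hc⟩ := h R a b
  have h0 : P 0 = 0 := by simpa using hP 0
  have h1 : P 1 = MvPolynomial.X 0 * MvPolynomial.X 1 := by
    have := hP 1
    simp only [Finset.sum_range_succ, Finset.sum_range_zero, h0] at this
    refine mul_left_cancel₀ (two_ne_zero (α := MvPolynomial (Fin 2) ℤ)) ?_
    push_cast at this
    linear_combination this
  have h2 : P 2 = MvPolynomial.X 0 ^ 3 * MvPolynomial.X 1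
      + MvPolynomial.X 0 ^ 2 * MvPolynomial.X 1 ^ 2 + MvPolynomial.X 0 * MvPolynomial.X 1 ^ 3 := by
    have := hP 2
    simp only [Finset.sum_range_succ, Finset.sum_range_zero, h0, h1] at this
    refine mul_left_cancel₀ (OfNat.ofNat_ne_zero 4 : (4 : MvPolynomial (Fin 2) ℤ) ≠ 0) ?_
    push_cast at this
    linear_combination this
  refine ⟨x, hx, by rw [hc, h0, map_zero], by rw [hc, h1]; simp, by rw [hc, h2]; simp, ?_⟩
  have h3 : P 3 = MvPolynomial.X 0 ^ 7 * MvPolynomial.X 1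
      + 3 * MvPolynomial.X 0 ^ 6 * MvPolynomial.X 1 ^ 2
      + 6 * MvPolynomial.X 0 ^ 5 * MvPolynomial.X 1 ^ 3
      + 7 * MvPolynomial.X 0 ^ 4 * MvPolynomial.X 1 ^ 4
      + 6 * MvPolynomial.X 0 ^ 3 * MvPolynomial.X 1 ^ 5
      + 3 * MvPolynomial.X 0 ^ 2 * MvPolynomial.X 1 ^ 6
      + MvPolynomial.X 0 * MvPolynomial.X 1 ^ 7 := by
    have := hP 3
    simp only [Finset.sum_range_succ, Finset.sum_range_zero, h0, h1, h2] at this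
    refine mul_left_cancel₀ (pow_ne_zero 3 (two_ne_zero (α := MvPolynomial (Fin 2) ℤ))) ?_
    push_cast at this
    linear_combination this
  rw [hc, h3]
  simp

theorem teichmuller_add_three [Fact (Nat.Prime 3)] {R : Type u} [CommRing R] (a b : R) :
    ∃ x : WittVector 3 R,
    WittVector.teichmuller 3 (a + b) = WittVector.teichmuller 3 a + WittVector.teichmuller 3 b + x ∧
    x.coeff 0 = 0 ∧ x.coeff 1 = a ^ 2 * b + a * b ^ 2 := by
  obtain ⟨P, hP, h⟩ := exists_teichmuller_add.{u} 3
  obtain ⟨x, hx, hc⟩ := h R a b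
  have h0 : P 0 = 0 := by simpa using hP 0
  refine ⟨x, hx, by rw [hc, h0, map_zero], ?_⟩
  have h1 : P 1 = MvPolynomial.X 0 ^ 2 * MvPolynomial.X 1
      + MvPolynomial.X 0 * MvPolynomial.X 1 ^ 2 := by
    have := hP 1
    simp only [Finset.sum_range_succ, Finset.sum_range_zero, h0] at this
    refine mul_left_cancel₀ (OfNat.ofNat_ne_zero 3 : (3 : MvPolynomial (Fin 2) ℤ) ≠ 0) ?_
    push_cast at this
    linear_combination this
  rw [hc, h1]
  simp

theorem teichmuller_add_five [Fact (Nat.Prime 5)] {R : Type u} [CommRing R] (a b : R) :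
    ∃ x : WittVector 5 R,
    WittVector.teichmuller 5 (a + b) = WittVector.teichmuller 5 a + WittVector.teichmuller 5 b + x ∧
    x.coeff 0 = 0 ∧
    x.coeff 1 = a ^ 4 * b + 2 * a ^ 3 * b ^ 2 + 2 * a ^ 2 * b ^ 3 + a * b ^ 4 := by
  obtain ⟨P, hP, h⟩ := exists_teichmuller_add.{u} 5
  obtain ⟨x, hx, hc⟩ := h R a b
  have h0 : P 0 = 0 := by simpa using hP 0
  refine ⟨x, hx, by rw [hc, h0, map_zero], ?_⟩
  have h1 : P 1 = MvPolynomial.X 0 ^ 4 * MvPolynomial.X 1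
      + 2 * MvPolynomial.X 0 ^ 3 * MvPolynomial.X 1 ^ 2
      + 2 * MvPolynomial.X 0 ^ 2 * MvPolynomial.X 1 ^ 3
      + MvPolynomial.X 0 * MvPolynomial.X 1 ^ 4 := by
    have := hP 1
    simp only [Finset.sum_range_succ, Finset.sum_range_zero, h0] at this
    refine mul_left_cancel₀ (OfNat.ofNat_ne_zero 5 : (5 : MvPolynomial (Fin 2) ℤ) ≠ 0) ?_
    push_cast at this
    linear_combination this
  rw [hc, h1]
  simp

end SmallPrimes

/-! ### The explicit cocycles for each singularity -/

section Classes

universe u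

variable {R : Type u} [CommRing R] {s t : R}

/-- If `W ^ p = N`, the Teichmüller class of `W ^ (p - 1) / (st)` is killed by `[W]`, and Frobenius
maps it to `V ^ (n - 1)` of a class `c / (st)`. -/
def IsWitnessNorm (p : ℕ) [Fact p.Prime] (n : ℕ) (hn : 1 ≤ n) (s t N : R) : Prop :=
  wcls (s := s) (t := t) n (WittVector.teichmuller p (frac s t N 1 1)) = 0 ∧
  ∃ c : ℕ, ¬ p ∣ c ∧ wcls (s := s) (t := t) n (WittVector.teichmuller p
    (frac s t (N ^ (p - 1)) p p)) = cohV hn s t (cls p s t (frac s t (c : R) 1 1))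

theorem isWitnessNorm_A (p : ℕ) [Fact p.Prime] : IsWitnessNorm p 1 le_rfl s t (s * t) := by
  have e1 := algebraMap_mul_invL s t
  have e2 := algebraMap_mul_invR s t
  have h1 : frac s t (s * t) 1 1 = 1 := by
    rw [frac, map_mul]
    linear_combination algebraMap R _ t * invR s t * e1 + e2
  have h2 : frac s t ((s * t) ^ (p - 1)) p p = frac s t 1 1 1 := by
    obtain ⟨m, hm⟩ : ∃ m, p = m + 1 := ⟨p - 1, by have := (Fact.out : p.Prime).pos; omega⟩
    rw [hm, Nat.add_sub_cancel, mul_pow, ← mul_one (t ^ m), add_comm m 1, frac_mul_left,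
      frac_mul_right]
  have hV : ∀ z : LocalH2 p 1 s t, cohV le_rfl s t z = z := by
    intro z
    obtain ⟨a, rfl⟩ := hmk_surj z
    rw [cohV_hmk]
    congr 1
    apply TruncatedWittVector.ext
    intro i
    rw [coeff_wittV, dif_pos (by omega)]
    congr 1
  refine ⟨?_, 1, (Fact.out : p.Prime).one_lt.ne' ∘ Nat.dvd_one.1, ?_⟩
  · rw [h1]
    exact wcls_teichmuller_left (Subring.one_mem _)
  · rw [h2, hV, Nat.cast_one]
    rfl

/-- Up to sign, which is irrelevant in characteristic two, `N/(st)^2 = (1/t)(1 + β)` with `β =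
t^(2^(n-1) - 1)/s`. By `exists_teichmuller_one_add` the `i`-th component of `[(1/t)(1 + β)] - [1/t]`
is `t^(-2^i)(β + ⋯)`. For `i < n - 1` the numerator absorbs the power of `t`; at `i = n - 1` exactly
one factor `1/t` is left over and gives `1/(st)`. -/
theorem isWitnessNorm_D [CharP R 2] (n : ℕ) (hn : 2 ≤ n) :
    IsWitnessNorm 2 n (by omega) s t (-(s ^ 2 * t + s * t ^ 2 ^ (n - 1))) := by
  obtain ⟨n, rfl⟩ : ∃ m, n = m + 1 := ⟨n - 1, by omega⟩
  rw [Nat.add_sub_cancel]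
  obtain ⟨m, hm⟩ : ∃ m, 2 ^ n = m + 2 := ⟨2 ^ n - 2, by
    have : 2 ^ 1 ≤ 2 ^ n := Nat.pow_le_pow_right (by norm_num) (by omega)
    omega⟩
  have e1 := algebraMap_mul_invL s t
  have e2 := algebraMap_mul_invR s t
  have hS := algebraMap_mem_left s t s
  have hT := algebraMap_mem_left s t t
  have hσ := invL_mem s t
  have hτ := invR_mem s t
  have h2 : (2 : Localization.Away (s * t)) = 0 := by
    rw [← map_ofNat (algebraMap R _) 2]
    exact (congrArg _ (CharTwo.two_eq_zero (R := R))).trans (map_zero _)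
  have hN : algebraMap R (Localization.Away (s * t)) (-(s ^ 2 * t + s * t ^ (m + 2)))
      = -(algebraMap R _ s ^ 2 * algebraMap R _ t + algebraMap R _ s * algebraMap R _ t ^ (m + 2)) := by
    simp only [map_neg, map_add, map_mul, map_pow]
  rw [IsWitnessNorm, hm]
  simp only [frac, pow_one, map_pow (algebraMap R _), hN]
  generalize algebraMap R (Localization.Away (s * t)) s = S at *
  generalize algebraMap R (Localization.Away (s * t)) t = T at *
  generalize invL s t = σ at *
  generalize invR s t = τ at *
  constructor
  · apply wcls_teichmuller_left
    have : -(S ^ 2 * T + S * T ^ (m + 2)) * σ * τ = -(S + T ^ (m + 1)) := by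
      rw [show -(S ^ 2 * T + S * T ^ (m + 2)) * σ * τ
        = -((S * σ) * (T * τ) * S + (S * σ) * (T * τ) * T ^ (m + 1)) by ring, e1, e2]
      ring
    rw [this]
    exact neg_mem (add_mem hS (pow_mem hT _))
  · refine ⟨1, by norm_num, ?_⟩
    have h1 : (-(S ^ 2 * T + S * T ^ (m + 2))) ^ (2 - 1) * σ ^ 2 * τ ^ 2
        = τ * (1 + T ^ (m + 1) * σ) := by
      rw [show (-(S ^ 2 * T + S * T ^ (m + 2))) ^ (2 - 1) * σ ^ 2 * τ ^ 2
        = -((S * σ) ^ 2 * (T * τ) * τ + (S * σ) * (T * τ) * T ^ (m + 1) * σ * τ) by ring, e1, e2]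
      linear_combination -(τ + T ^ (m + 1) * σ * τ) * h2
    have hpow : ∀ i j, T ^ (i + j) * τ ^ j = T ^ i := by
      intro i j
      rw [pow_add, mul_assoc, ← mul_pow, e2, one_pow, mul_one]
    obtain ⟨ψ, hψ⟩ := exists_teichmuller_one_add.{u} 2
    obtain ⟨x, hx, hc⟩ := hψ _ τ (T ^ (m + 1) * σ)
    have hβ : T ^ (m + 1) * σ ∈ leftRing s t := mul_mem (pow_mem hT _) hσ
    have hae : ∀ q : Polynomial ℤ, Polynomial.eval₂RingHom (Int.castRingHom _) (T ^ (m + 1) * σ) q ∈ leftRing s t := by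
      intro q
      rw [Polynomial.coe_eval₂RingHom, Polynomial.eval₂_eq_sum_range]
      exact sum_mem fun i _ => mul_mem (intCast_mem _ _) (pow_mem hβ _)
    rw [h1, hx, map_add, wcls_teichmuller_right hτ, zero_add, wcls_succ_of_left, hc, hm]
    · congr 1
      -- The linear term is `1/(st)`; the terms of degree at least two in `β` have enough factors
      -- `t` to lie in the left ring.
      have h3 : τ ^ (m + 2) * (T ^ (m + 1) * σ + (T ^ (m + 1) * σ) ^ 2
          * Polynomial.eval₂RingHom (Int.castRingHom _) (T ^ (m + 1) * σ) (ψ n))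
          = algebraMap R _ ((1 : ℕ) : R) * σ * τ
            + T ^ m * σ ^ 2 * Polynomial.eval₂RingHom (Int.castRingHom _) (T ^ (m + 1) * σ) (ψ n) := by
        have h4 := hpow 0 (m + 1)
        have h5 := hpow m (m + 2)
        rw [zero_add, pow_zero] at h4
        rw [Nat.cast_one, map_one]
        linear_combination (σ * τ) * h4
          + σ ^ 2 * Polynomial.eval₂RingHom (Int.castRingHom _) (T ^ (m + 1) * σ) (ψ n) * h5
      rw [h3, map_add, cls_eq_zero_of_left (mul_mem (mul_mem (pow_mem hT _) (pow_mem hσ _)) (hae _)),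
        add_zero]
    · intro i hi
      rw [hc]
      obtain ⟨j, hj⟩ : ∃ j, m + 1 = j + 2 ^ i := by
        have : 2 ^ i < 2 ^ n := Nat.pow_lt_pow_right (by norm_num) hi
        exact ⟨m + 1 - 2 ^ i, by omega⟩
      have h3 : τ ^ 2 ^ i * (T ^ (m + 1) * σ + (T ^ (m + 1) * σ) ^ 2
          * Polynomial.eval₂RingHom (Int.castRingHom _) (T ^ (m + 1) * σ) (ψ i))
          = T ^ j * σ * (1 + T ^ (m + 1) * σ * Polynomial.eval₂RingHom (Int.castRingHom _) (T ^ (m + 1) * σ) (ψ i)) := by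
        have h4 := hpow j (2 ^ i)
        rw [← hj] at h4
        linear_combination σ * (1 + T ^ (m + 1) * σ
          * Polynomial.eval₂RingHom (Int.castRingHom _) (T ^ (m + 1) * σ) (ψ i)) * h4
      rw [h3]
      exact mul_mem (mul_mem (pow_mem hT _) hσ) (add_mem (one_mem _) (mul_mem hβ (hae _)))

theorem cls_add_add_eq {p : ℕ} [Fact p.Prime] {f l r : Localization.Away (s * t)}
    (hl : l ∈ leftRing s t) (hr : r ∈ rightRing s t) :
    cls p s t (f + l + r) = cls p s t f := by
  rw [map_add, map_add, cls_eq_zero_of_left hl, cls_eq_zero_of_right hr, add_zero, add_zero]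

theorem isWitnessNorm_E6 [Fact (Nat.Prime 3)] :
    IsWitnessNorm 3 2 one_le_two s t (-(t ^ 2 + s ^ 4)) := by
  have e1 := algebraMap_mul_invL s t
  have e2 := algebraMap_mul_invR s t
  have hS := algebraMap_mem_left s t s
  have hT := algebraMap_mem_left s t t
  have hS' := algebraMap_mem_right s t s
  have hT' := algebraMap_mem_right s t t
  have hσ := invL_mem s t
  have hτ := invR_mem s t
  have hN : algebraMap R (Localization.Away (s * t)) (-(t ^ 2 + s ^ 4))
      = -(algebraMap R _ t ^ 2 + algebraMap R _ s ^ 4) := by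
    simp only [map_neg, map_add, map_pow]
  rw [IsWitnessNorm]
  simp only [frac, pow_one, map_pow (algebraMap R _), hN]
  generalize algebraMap R (Localization.Away (s * t)) s = S at *
  generalize algebraMap R (Localization.Away (s * t)) t = T at *
  generalize invL s t = σ at *
  generalize invR s t = τ at *
  constructor
  · have h1 : -(T ^ 2 + S ^ 4) * σ * τ = -(T * σ) + -(S ^ 3 * τ) := by
      rw [show -(T ^ 2 + S ^ 4) * σ * τ = -(T * τ * (T * σ)) + -(S * σ * (S ^ 3 * τ)) by ring, e1, e2]
      ring
    obtain ⟨x, hx, h0, h2⟩ := teichmuller_add_three (-(T * σ)) (-(S ^ 3 * τ))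
    rw [h1, hx, map_add, map_add, wcls_teichmuller_left (neg_mem (mul_mem hT hσ)),
      wcls_teichmuller_right (neg_mem (mul_mem (pow_mem hS' _) hτ)), wcls_succ_of_left, h2]
    · have h3 : (-(T * σ)) ^ 2 * -(S ^ 3 * τ) + -(T * σ) * (-(S ^ 3 * τ)) ^ 2
          = -(S * T) + -(S ^ 5 * τ) := by
        rw [show (-(T * σ)) ^ 2 * -(S ^ 3 * τ) + -(T * σ) * (-(S ^ 3 * τ)) ^ 2
          = -((S * σ) ^ 2 * (T * τ) * (S * T)) + -(S * σ * (T * τ) * (S ^ 5 * τ)) by ring, e1, e2]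
        ring
      rw [h3, ← zero_add (-(S * T)), cls_add_add_eq (neg_mem (mul_mem hS hT))
        (neg_mem (mul_mem (pow_mem hS' _) hτ)), map_zero, add_zero, map_zero, add_zero]
    · intro i hi
      obtain rfl : i = 0 := by omega
      rw [h0]
      exact Subring.zero_mem _
  · refine ⟨5, by norm_num, ?_⟩
    have h1 : (-(T ^ 2 + S ^ 4)) ^ (3 - 1) * σ ^ 3 * τ ^ 3
        = T * σ ^ 3 + (2 * (S * τ) + S ^ 5 * τ ^ 3) := by
      rw [show (-(T ^ 2 + S ^ 4)) ^ (3 - 1) * σ ^ 3 * τ ^ 3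
        = (T * τ) ^ 3 * (T * σ ^ 3) + (2 * ((S * σ) ^ 3 * (T * τ) ^ 2 * (S * τ))
          + (S * σ) ^ 3 * (S ^ 5 * τ ^ 3)) by ring, e1, e2]
      ring
    have hb : 2 * (S * τ) + S ^ 5 * τ ^ 3 ∈ rightRing s t :=
      add_mem (mul_mem (ofNat_mem _ 2) (mul_mem hS' hτ)) (mul_mem (pow_mem hS' _) (pow_mem hτ _))
    obtain ⟨x, hx, h0, h2⟩ := teichmuller_add_three (T * σ ^ 3) (2 * (S * τ) + S ^ 5 * τ ^ 3)
    rw [h1, hx, map_add, map_add, wcls_teichmuller_left (mul_mem hT (pow_mem hσ _)),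
      wcls_teichmuller_right hb, add_zero, zero_add, wcls_succ_of_left, h2]
    · have h3 : (T * σ ^ 3) ^ 2 * (2 * (S * τ) + S ^ 5 * τ ^ 3)
            + T * σ ^ 3 * (2 * (S * τ) + S ^ 5 * τ ^ 3) ^ 2
          = algebraMap R _ ((5 : ℕ) : R) * σ * τ + 2 * (T * σ ^ 5)
            + (4 * (S ^ 3 * τ ^ 3) + S ^ 7 * τ ^ 5) := by
        rw [show (T * σ ^ 3) ^ 2 * (2 * (S * τ) + S ^ 5 * τ ^ 3)
            + T * σ ^ 3 * (2 * (S * τ) + S ^ 5 * τ ^ 3) ^ 2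
          = (S * σ) ^ 5 * (T * τ) ^ 2 * (σ * τ) + 4 * ((S * σ) ^ 2 * (T * τ) * (σ * τ))
            + 2 * ((S * σ) * (T * τ) * (T * σ ^ 5))
            + (4 * ((S * σ) ^ 3 * (T * τ) * (S ^ 3 * τ ^ 3))
              + (S * σ) ^ 3 * (T * τ) * (S ^ 7 * τ ^ 5)) by ring, e1, e2, map_natCast]
        push_cast
        ring
      rw [h3, cls_add_add_eq (mul_mem (ofNat_mem _ 2) (mul_mem hT (pow_mem hσ _)))
        (add_mem (mul_mem (ofNat_mem _ 4) (mul_mem (pow_mem hS' _) (pow_mem hτ _)))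
          (mul_mem (pow_mem hS' _) (pow_mem hτ _)))]
    · intro i hi
      obtain rfl : i = 0 := by omega
      rw [h0]
      exact Subring.zero_mem _

/-- The argument is `N/(st)`. Components `0, 1, 2` of the carry lie in the left ring, and component
`3` is a sum of an element of each ring. -/
theorem wcls_teichmuller_E8_two {S T σ τ : Localization.Away (s * t)}
    (e1 : S * σ = 1) (e2 : T * τ = 1) (hS : S ∈ leftRing s t) (hT : T ∈ leftRing s t)
    (hS' : S ∈ rightRing s t) (hσ : σ ∈ leftRing s t) (hτ : τ ∈ rightRing s t) :
    wcls (s := s) (t := t) 4 (WittVector.teichmuller 2 (S ^ 2 * τ + T ^ 4 * σ)) = 0 := by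
  obtain ⟨a, ea⟩ : ∃ a, a = S ^ 2 * τ := ⟨_, rfl⟩
  obtain ⟨b, eb⟩ : ∃ b, b = T ^ 4 * σ := ⟨_, rfl⟩
  have h11 : a * b = S * T ^ 3 := by
    rw [show a * b = (S * σ) ^ 1 * (T * τ) ^ 1 * (S * T ^ 3) by rw [ea, eb]; ring, e1, e2]
    ring
  have h31 : a ^ 3 * b = S ^ 5 * T := by
    rw [show a ^ 3 * b = (S * σ) ^ 1 * (T * τ) ^ 3 * (S ^ 5 * T) by rw [ea, eb]; ring, e1, e2]
    ring
  have h22 : a ^ 2 * b ^ 2 = S ^ 2 * T ^ 6 := by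
    rw [show a ^ 2 * b ^ 2 = (S * σ) ^ 2 * (T * τ) ^ 2 * (S ^ 2 * T ^ 6) by rw [ea, eb]; ring, e1, e2]
    ring
  have h13 : a * b ^ 3 = T ^ 11 * σ := by
    rw [show a * b ^ 3 = (S * σ) ^ 2 * (T * τ) ^ 1 * (T ^ 11 * σ) by rw [ea, eb]; ring, e1, e2]
    ring
  have h71 : a ^ 7 * b = S ^ 13 * τ ^ 3 := by
    rw [show a ^ 7 * b = (S * σ) ^ 1 * (T * τ) ^ 4 * (S ^ 13 * τ ^ 3) by rw [ea, eb]; ring, e1, e2]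
    ring
  have h62 : a ^ 6 * b ^ 2 = S ^ 10 * T ^ 2 := by
    rw [show a ^ 6 * b ^ 2 = (S * σ) ^ 2 * (T * τ) ^ 6 * (S ^ 10 * T ^ 2) by rw [ea, eb]; ring, e1, e2]
    ring
  have h53 : a ^ 5 * b ^ 3 = S ^ 7 * T ^ 7 := by
    rw [show a ^ 5 * b ^ 3 = (S * σ) ^ 3 * (T * τ) ^ 5 * (S ^ 7 * T ^ 7) by rw [ea, eb]; ring, e1, e2]
    ring
  have h44 : a ^ 4 * b ^ 4 = S ^ 4 * T ^ 12 := by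
    rw [show a ^ 4 * b ^ 4 = (S * σ) ^ 4 * (T * τ) ^ 4 * (S ^ 4 * T ^ 12) by rw [ea, eb]; ring, e1, e2]
    ring
  have h35 : a ^ 3 * b ^ 5 = S * T ^ 17 := by
    rw [show a ^ 3 * b ^ 5 = (S * σ) ^ 5 * (T * τ) ^ 3 * (S * T ^ 17) by rw [ea, eb]; ring, e1, e2]
    ring
  have h26 : a ^ 2 * b ^ 6 = T ^ 22 * σ ^ 2 := by
    rw [show a ^ 2 * b ^ 6 = (S * σ) ^ 4 * (T * τ) ^ 2 * (T ^ 22 * σ ^ 2) by rw [ea, eb]; ring, e1, e2]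
    ring
  have h17 : a * b ^ 7 = T ^ 27 * σ ^ 5 := by
    rw [show a * b ^ 7 = (S * σ) ^ 2 * (T * τ) ^ 1 * (T ^ 27 * σ ^ 5) by rw [ea, eb]; ring, e1, e2]
    ring
  have ha : a ∈ rightRing s t := ea ▸ mul_mem (pow_mem hS' _) hτ
  have hb : b ∈ leftRing s t := eb ▸ mul_mem (pow_mem hT _) hσ
  obtain ⟨x, hx, x0, x1, x2, x3⟩ := teichmuller_add_two a b
  rw [← ea, ← eb, hx, map_add, map_add, wcls_teichmuller_left hb, wcls_teichmuller_right ha, add_zero,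
    zero_add, wcls_succ_of_left]
  · have : x.coeff 3 = 0 + (3 * (S ^ 10 * T ^ 2) + 6 * (S ^ 7 * T ^ 7) + 7 * (S ^ 4 * T ^ 12)
        + 6 * (S * T ^ 17) + 3 * (T ^ 22 * σ ^ 2) + T ^ 27 * σ ^ 5) + S ^ 13 * τ ^ 3 := by
      rw [x3]
      linear_combination h71 + 3 * h62 + 6 * h53 + 7 * h44 + 6 * h35 + 3 * h26 + h17
    have hl : 3 * (S ^ 10 * T ^ 2) + 6 * (S ^ 7 * T ^ 7) + 7 * (S ^ 4 * T ^ 12) + 6 * (S * T ^ 17) + 3 *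
      (T ^ 22 * σ ^ 2) + T ^ 27 * σ ^ 5 ∈ leftRing s t :=
      add_mem (add_mem (add_mem (add_mem (add_mem (mul_mem (ofNat_mem _ 3) (mul_mem (pow_mem hS
      _) (pow_mem hT _))) (mul_mem (ofNat_mem _ 6) (mul_mem (pow_mem hS _) (pow_mem hT _))))
      (mul_mem (ofNat_mem _ 7) (mul_mem (pow_mem hS _) (pow_mem hT _)))) (mul_mem (ofNat_mem _
      6) (mul_mem hS (pow_mem hT _)))) (mul_mem (ofNat_mem _ 3) (mul_mem (pow_mem hT _) (pow_mem
      hσ _)))) (mul_mem (pow_mem hT _) (pow_mem hσ _))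
    rw [this, cls_add_add_eq hl (mul_mem (pow_mem hS' _) (pow_mem hτ _)), map_zero, map_zero]
  · intro i hi
    interval_cases i
    · rw [x0]; exact Subring.zero_mem _
    · rw [x1, h11]; exact mul_mem hS (pow_mem hT _)
    · rw [x2, h31, h22, h13]
      exact add_mem (add_mem (mul_mem (pow_mem hS _) hT) (mul_mem (pow_mem hS _) (pow_mem hT _)))
        (mul_mem (pow_mem hT _) hσ)

/-- Here component `2` of the carry is `s/t^3 + (t^2/s^2 + t^7/s^5)`, which lies in neither ring and
must be split within the Witt vectors. That produces a second carry, whose entry in component `3` is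
the product of the two parts and contributes `1/(st)`. The direct contribution of the first carry in
component `3` is `6 a^5 b^3 = 6/(st) = 0`. -/
theorem wcls_teichmuller_frobenius_E8_two {S T σ τ : Localization.Away (s * t)}
    (e1 : S * σ = 1) (e2 : T * τ = 1) (hT : T ∈ leftRing s t)
    (hS' : S ∈ rightRing s t) (hσ : σ ∈ leftRing s t) (hτ : τ ∈ rightRing s t)
    (h2 : (2 : Localization.Away (s * t)) = 0) :
    wcls (s := s) (t := t) 4 (WittVector.teichmuller 2 (S * τ ^ 2 + T ^ 3 * σ ^ 2))
      = cohV (by norm_num) s t (cls 2 s t (σ * τ)) := by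
  obtain ⟨a, ea⟩ : ∃ a, a = S * τ ^ 2 := ⟨_, rfl⟩
  obtain ⟨b, eb⟩ : ∃ b, b = T ^ 3 * σ ^ 2 := ⟨_, rfl⟩
  have h11 : a * b = T * σ := by
    rw [show a * b = (S * σ) ^ 1 * (T * τ) ^ 2 * (T * σ) by rw [ea, eb]; ring, e1, e2]
    ring
  have h31 : a ^ 3 * b = S * τ ^ 3 := by
    rw [show a ^ 3 * b = (S * σ) ^ 2 * (T * τ) ^ 3 * (S * τ ^ 3) by rw [ea, eb]; ring, e1, e2]
    ring
  have h22 : a ^ 2 * b ^ 2 = T ^ 2 * σ ^ 2 := by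
    rw [show a ^ 2 * b ^ 2 = (S * σ) ^ 2 * (T * τ) ^ 4 * (T ^ 2 * σ ^ 2) by rw [ea, eb]; ring, e1, e2]
    ring
  have h13 : a * b ^ 3 = T ^ 7 * σ ^ 5 := by
    rw [show a * b ^ 3 = (S * σ) ^ 1 * (T * τ) ^ 2 * (T ^ 7 * σ ^ 5) by rw [ea, eb]; ring, e1, e2]
    ring
  have h71 : a ^ 7 * b = S ^ 5 * τ ^ 11 := by
    rw [show a ^ 7 * b = (S * σ) ^ 2 * (T * τ) ^ 3 * (S ^ 5 * τ ^ 11) by rw [ea, eb]; ring, e1, e2]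
    ring
  have h62 : a ^ 6 * b ^ 2 = S ^ 2 * τ ^ 6 := by
    rw [show a ^ 6 * b ^ 2 = (S * σ) ^ 4 * (T * τ) ^ 6 * (S ^ 2 * τ ^ 6) by rw [ea, eb]; ring, e1, e2]
    ring
  have h53 : a ^ 5 * b ^ 3 = σ * τ := by
    rw [show a ^ 5 * b ^ 3 = (S * σ) ^ 5 * (T * τ) ^ 9 * (σ * τ) by rw [ea, eb]; ring, e1, e2]
    ring
  have h44 : a ^ 4 * b ^ 4 = T ^ 4 * σ ^ 4 := by
    rw [show a ^ 4 * b ^ 4 = (S * σ) ^ 4 * (T * τ) ^ 8 * (T ^ 4 * σ ^ 4) by rw [ea, eb]; ring, e1, e2]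
    ring
  have h35 : a ^ 3 * b ^ 5 = T ^ 9 * σ ^ 7 := by
    rw [show a ^ 3 * b ^ 5 = (S * σ) ^ 3 * (T * τ) ^ 6 * (T ^ 9 * σ ^ 7) by rw [ea, eb]; ring, e1, e2]
    ring
  have h26 : a ^ 2 * b ^ 6 = T ^ 14 * σ ^ 10 := by
    rw [show a ^ 2 * b ^ 6 = (S * σ) ^ 2 * (T * τ) ^ 4 * (T ^ 14 * σ ^ 10) by rw [ea, eb]; ring, e1, e2]
    ring
  have h17 : a * b ^ 7 = T ^ 19 * σ ^ 13 := by
    rw [show a * b ^ 7 = (S * σ) ^ 1 * (T * τ) ^ 2 * (T ^ 19 * σ ^ 13) by rw [ea, eb]; ring, e1, e2]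
    ring
  have ha : a ∈ rightRing s t := ea ▸ mul_mem hS' (pow_mem hτ _)
  have hb : b ∈ leftRing s t := eb ▸ mul_mem (pow_mem hT _) (pow_mem hσ _)
  obtain ⟨x, hx, x0, x1, x2, x3⟩ := teichmuller_add_two a b
  -- Component `2` alone is `V²` of a Teichmüller representative, to which the addition formula
  -- applies again.
  have hsel : WittVector.select (· = 2) x
      = WittVector.verschiebung (WittVector.verschiebung
        (WittVector.teichmuller 2 (S * τ ^ 3 + (T ^ 2 * σ ^ 2 + T ^ 7 * σ ^ 5)))) := by
    ext i
    rw [coeff_select_eq_ite]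
    rcases i with _ | _ | _ | i
    · rw [if_neg (by norm_num), WittVector.verschiebung_coeff_zero]
    · rw [if_neg (by norm_num), WittVector.verschiebung_coeff_succ,
        WittVector.verschiebung_coeff_zero]
    · rw [if_pos (by norm_num), WittVector.verschiebung_coeff_succ,
        WittVector.verschiebung_coeff_succ, WittVector.teichmuller_coeff_zero]
      change x.coeff 2 = _
      rw [x2, h31, h22, h13, add_assoc]
    · rw [if_neg (by omega), WittVector.verschiebung_coeff_succ,
        WittVector.verschiebung_coeff_succ, WittVector.teichmuller_coeff_pos _ _ _ i.succ_pos]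
  have hp : S * τ ^ 3 ∈ rightRing s t := mul_mem hS' (pow_mem hτ _)
  have hq : T ^ 2 * σ ^ 2 + T ^ 7 * σ ^ 5 ∈ leftRing s t :=
    add_mem (mul_mem (pow_mem hT _) (pow_mem hσ _)) (mul_mem (pow_mem hT _) (pow_mem hσ _))
  have hVV : ∀ (U : Subring (Localization.Away (s * t))) (w : WittVector 2 _),
      (∀ i, w.coeff i ∈ U) →
      ∀ i, (WittVector.verschiebung (WittVector.verschiebung w)).coeff i ∈ U := by
    intro U w hw i
    rcases i with _ | _ | i
    · rw [WittVector.verschiebung_coeff_zero]; exact U.zero_mem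
    · rw [WittVector.verschiebung_coeff_succ, WittVector.verschiebung_coeff_zero]; exact U.zero_mem
    · rw [WittVector.verschiebung_coeff_succ, WittVector.verschiebung_coeff_succ]; exact hw i
  obtain ⟨z, hz, z0, z1, -, -⟩ :=
    teichmuller_add_two (S * τ ^ 3) (T ^ 2 * σ ^ 2 + T ^ 7 * σ ^ 5)
  have hpq : S * τ ^ 3 * (T ^ 2 * σ ^ 2 + T ^ 7 * σ ^ 5)
      = σ * τ + T ^ 4 * σ ^ 4 + 0 := by
    rw [show S * τ ^ 3 * (T ^ 2 * σ ^ 2 + T ^ 7 * σ ^ 5) = (S * σ) * (T * τ) ^ 2 * (σ * τ)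
      + (S * σ) * (T * τ) ^ 3 * (T ^ 4 * σ ^ 4) by ring, e1, e2]
    ring
  rw [← ea, ← eb, hx, map_add, map_add, wcls_teichmuller_left hb, wcls_teichmuller_right ha, add_zero,
    zero_add, ← WittVector.select_add_select_not (· = 2) x, map_add, hsel, hz]
  simp only [map_add]
  rw [wcls_eq_zero_of_right (hVV _ _ (teichmuller_coeff_mem _ hp)),
    wcls_eq_zero_of_left (hVV _ _ (teichmuller_coeff_mem _ hq)), zero_add, zero_add,
    wcls_succ_of_left, wcls_succ_of_left]
  · have hx3 : (WittVector.select (fun i => ¬ i = 2) x).coeff 3 = 0 + (7 * (T ^ 4 * σ ^ 4)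
        + 6 * (T ^ 9 * σ ^ 7) + 3 * (T ^ 14 * σ ^ 10) + T ^ 19 * σ ^ 13)
        + (3 * (S ^ 2 * τ ^ 6) + S ^ 5 * τ ^ 11) := by
      rw [coeff_select_eq_ite, if_pos (by norm_num), x3]
      linear_combination h71 + 3 * h62 + 6 * h53 + 7 * h44 + 6 * h35 + 3 * h26 + h17
        + 3 * σ * τ * h2
    have hz3 : (WittVector.verschiebung (WittVector.verschiebung z)).coeff 3 = z.coeff 1 := by
      rw [WittVector.verschiebung_coeff_succ, WittVector.verschiebung_coeff_succ]
    have hl : 7 * (T ^ 4 * σ ^ 4) + 6 * (T ^ 9 * σ ^ 7) + 3 * (T ^ 14 * σ ^ 10) + T ^ 19 * σ ^ 13 ∈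
      leftRing s t :=
      add_mem (add_mem (add_mem (mul_mem (ofNat_mem _ 7) (mul_mem (pow_mem hT _) (pow_mem hσ
      _))) (mul_mem (ofNat_mem _ 6) (mul_mem (pow_mem hT _) (pow_mem hσ _)))) (mul_mem
      (ofNat_mem _ 3) (mul_mem (pow_mem hT _) (pow_mem hσ _)))) (mul_mem (pow_mem hT _) (pow_mem
      hσ _))
    have hr : 3 * (S ^ 2 * τ ^ 6) + S ^ 5 * τ ^ 11 ∈ rightRing s t :=
      add_mem (mul_mem (ofNat_mem _ 3) (mul_mem (pow_mem hS' _) (pow_mem hτ _))) (mul_mem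
      (pow_mem hS' _) (pow_mem hτ _))
    rw [hx3, hz3, z1, hpq, cls_add_add_eq (mul_mem (pow_mem hT _) (pow_mem hσ _))
      (Subring.zero_mem _), cls_add_add_eq hl hr, map_zero, map_zero, add_zero]
  · intro i hi
    rw [coeff_select_eq_ite]
    interval_cases i
    · rw [if_pos (by norm_num), x0]; exact Subring.zero_mem _
    · rw [if_pos (by norm_num), x1, h11]; exact mul_mem hT hσ
    · rw [if_neg (by norm_num)]; exact Subring.zero_mem _
  · intro i hi
    interval_cases i
    · rw [WittVector.verschiebung_coeff_zero]; exact Subring.zero_mem _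
    · rw [WittVector.verschiebung_coeff_succ, WittVector.verschiebung_coeff_zero]
      exact Subring.zero_mem _
    · rw [WittVector.verschiebung_coeff_succ, WittVector.verschiebung_coeff_succ, z0]
      exact Subring.zero_mem _

theorem isWitnessNorm_E8_two [CharP R 2] :
    IsWitnessNorm 2 4 (by norm_num) s t (-(s ^ 3 + t ^ 5)) := by
  have e1 := algebraMap_mul_invL s t
  have e2 := algebraMap_mul_invR s t
  have hS := algebraMap_mem_left s t s
  have hT := algebraMap_mem_left s t t
  have hS' := algebraMap_mem_right s t s
  have hT' := algebraMap_mem_right s t t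
  have hσ := invL_mem s t
  have hτ := invR_mem s t
  have h2 : (2 : Localization.Away (s * t)) = 0 := by
    rw [← map_ofNat (algebraMap R _) 2]
    exact (congrArg _ (CharTwo.two_eq_zero (R := R))).trans (map_zero _)
  have hN : algebraMap R (Localization.Away (s * t)) (-(s ^ 3 + t ^ 5))
      = -(algebraMap R _ s ^ 3 + algebraMap R _ t ^ 5) := by
    simp only [map_neg, map_add, map_pow]
  rw [IsWitnessNorm]
  simp only [frac, pow_one, map_pow (algebraMap R _), hN]
  generalize algebraMap R (Localization.Away (s * t)) s = S at *
  generalize algebraMap R (Localization.Away (s * t)) t = T at *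
  generalize invL s t = σ at *
  generalize invR s t = τ at *
  constructor
  · have h1 : -(S ^ 3 + T ^ 5) * σ * τ = S ^ 2 * τ + T ^ 4 * σ := by
      linear_combination -(S ^ 2 * τ) * e1 - T ^ 4 * σ * e2 - (S ^ 2 * τ + T ^ 4 * σ) * h2
    rw [h1, wcls_teichmuller_E8_two e1 e2 hS hT hS' hσ hτ]
  · refine ⟨1, by norm_num, ?_⟩
    have h1 : (-(S ^ 3 + T ^ 5)) ^ (2 - 1) * σ ^ 2 * τ ^ 2 = S * τ ^ 2 + T ^ 3 * σ ^ 2 := by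
      rw [show (-(S ^ 3 + T ^ 5)) ^ (2 - 1) * σ ^ 2 * τ ^ 2
        = -((S * σ) ^ 2 * (S * τ ^ 2)) - (T * τ) ^ 2 * (T ^ 3 * σ ^ 2) by ring, e1, e2]
      linear_combination -(S * τ ^ 2 + T ^ 3 * σ ^ 2) * h2
    rw [h1, wcls_teichmuller_frobenius_E8_two e1 e2 hT hS' hσ hτ h2, Nat.cast_one, map_one, one_mul]

/-- With `M = t^3/s^5` and `r = s^3/t^2`, the argument is `M(1 + r)^4 = a + b`, and `M^5 r^8 =
1/(st)`. In the first carry, `M^5 r^i` lies in the left ring for `i < 8` and in the right ring for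
`i > 8`. The coefficient at `r^8` is `binom(20, 8)/5 = 25194`, as `a^5/M^5` has degree at most `5`
in `r` and `b^5/M^5` has order at least `10`. -/
theorem wcls_teichmuller_frobenius_E8_five [Fact (Nat.Prime 5)]
    {S T σ τ : Localization.Away (s * t)}
    (e1 : S * σ = 1) (e2 : T * τ = 1) (hT : T ∈ leftRing s t)
    (hS' : S ∈ rightRing s t) (hσ : σ ∈ leftRing s t) (hτ : τ ∈ rightRing s t) :
    wcls (s := s) (t := t) 2 (WittVector.teichmuller 5 (T ^ 3 * σ ^ 5 + 4 * (T * σ ^ 2)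
        + (6 * (S * τ) + 4 * (S ^ 4 * τ ^ 3) + S ^ 7 * τ ^ 5)))
      = cohV one_le_two s t (cls 5 s t (25194 * (σ * τ))) := by
  obtain ⟨a, ea⟩ : ∃ a, a = T ^ 3 * σ ^ 5 + 4 * (T * σ ^ 2) := ⟨_, rfl⟩
  obtain ⟨b, eb⟩ : ∃ b, b = 6 * (S * τ) + 4 * (S ^ 4 * τ ^ 3) + S ^ 7 * τ ^ 5 := ⟨_, rfl⟩
  obtain ⟨M, eM⟩ : ∃ M, M = T ^ 3 * σ ^ 5 := ⟨_, rfl⟩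
  obtain ⟨r, er⟩ : ∃ r, r = S ^ 3 * τ ^ 2 := ⟨_, rfl⟩
  obtain ⟨l, el⟩ : ∃ l, l = T ^ 2 * σ ^ 3 := ⟨_, rfl⟩
  have hlr : l * r = 1 := by
    rw [show l * r = (S * σ) ^ 3 * (T * τ) ^ 2 by rw [el, er]; ring, e1, e2]
    ring
  have hM : M ^ 5 = σ * τ * l ^ 8 := by
    rw [show σ * τ * l ^ 8 = (T * τ) * M ^ 5 by rw [eM, el]; ring, e2, one_mul]
  have hA : ∀ i j, i + j = 8 → M ^ 5 * r ^ i = σ * τ * l ^ j := by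
    intro i j hij
    rw [hM, ← hij, pow_add, show σ * τ * (l ^ i * l ^ j) * r ^ i = σ * τ * l ^ j * (l * r) ^ i by ring,
      hlr, one_pow, mul_one]
  have hB : ∀ i, M ^ 5 * r ^ (8 + i) = σ * τ * r ^ i := by
    intro i
    rw [pow_add, ← mul_assoc, hA 8 0 rfl, pow_zero, mul_one]
  have ha : a = M * (1 + 4 * r) := by
    rw [ea, eM, er, show T ^ 3 * σ ^ 5 * (1 + 4 * (S ^ 3 * τ ^ 2))
      = T ^ 3 * σ ^ 5 + 4 * ((S * σ) ^ 3 * (T * τ) ^ 2 * (T * σ ^ 2)) by ring, e1, e2]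
    ring
  have hb : b = M * (6 * r ^ 2 + 4 * r ^ 3 + r ^ 4) := by
    rw [eb, eM, er, show T ^ 3 * σ ^ 5 * (6 * (S ^ 3 * τ ^ 2) ^ 2 + 4 * (S ^ 3 * τ ^ 2) ^ 3
        + (S ^ 3 * τ ^ 2) ^ 4) = 6 * ((S * σ) ^ 5 * (T * τ) ^ 3 * (S * τ))
          + 4 * ((S * σ) ^ 5 * (T * τ) ^ 3 * (S ^ 4 * τ ^ 3))
          + (S * σ) ^ 5 * (T * τ) ^ 3 * (S ^ 7 * τ ^ 5) by ring, e1, e2]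
    ring
  have hl : l ∈ leftRing s t := el ▸ mul_mem (pow_mem hT _) (pow_mem hσ _)
  have hr : r ∈ rightRing s t := er ▸ mul_mem (pow_mem hS' _) (pow_mem hτ _)
  have hal : a ∈ leftRing s t := ea ▸ add_mem (mul_mem (pow_mem hT _) (pow_mem hσ _)) (mul_mem (ofNat_mem _ 4) (mul_mem hT (pow_mem hσ _)))
  have hbr : b ∈ rightRing s t := eb ▸
    add_mem (add_mem (mul_mem (ofNat_mem _ 6) (mul_mem hS' hτ)) (mul_mem (ofNat_mem _ 4)
    (mul_mem (pow_mem hS' _) (pow_mem hτ _)))) (mul_mem (pow_mem hS' _) (pow_mem hτ _))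
  have hl' : σ * τ * l ∈ leftRing s t := by
    rw [show σ * τ * l = T * τ * (T * σ ^ 4) by rw [el]; ring, e2, one_mul]
    exact mul_mem hT (pow_mem hσ _)
  have hr' : σ * τ * r ∈ rightRing s t := by
    rw [show σ * τ * r = S * σ * (S ^ 2 * τ ^ 3) by rw [er]; ring, e1, one_mul]
    exact mul_mem (pow_mem hS' _) (pow_mem hτ _)
  have hL : 6 * l ^ 5 + 100 * l ^ 4 + 713 * l ^ 3 + 2896 * l ^ 2 + 7752 * l ^ 1 + 15504 * l ^ 0 ∈
    leftRing s t :=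
    add_mem (add_mem (add_mem (add_mem (add_mem (mul_mem (ofNat_mem _ 6) (pow_mem hl 5))
    (mul_mem (ofNat_mem _ 100) (pow_mem hl 4))) (mul_mem (ofNat_mem _ 713) (pow_mem hl 3)))
    (mul_mem (ofNat_mem _ 2896) (pow_mem hl 2))) (mul_mem (ofNat_mem _ 7752) (pow_mem hl 1)))
    (mul_mem (ofNat_mem _ 15504) (pow_mem hl 0))
  have hR : 33592 * r ^ 0 + 35396 * r ^ 1 + 28408 * r ^ 2 + 16986 * r ^ 3 + 7440 * r ^ 4 + 2328 * r ^ 5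
    + 496 * r ^ 6 + 65 * r ^ 7 + 4 * r ^ 8 ∈ rightRing s t :=
    add_mem (add_mem (add_mem (add_mem (add_mem (add_mem (add_mem (add_mem (mul_mem (ofNat_mem _
    33592) (pow_mem hr 0)) (mul_mem (ofNat_mem _ 35396) (pow_mem hr 1))) (mul_mem (ofNat_mem _
    28408) (pow_mem hr 2))) (mul_mem (ofNat_mem _ 16986) (pow_mem hr 3))) (mul_mem (ofNat_mem _
    7440) (pow_mem hr 4))) (mul_mem (ofNat_mem _ 2328) (pow_mem hr 5))) (mul_mem (ofNat_mem _
    496) (pow_mem hr 6))) (mul_mem (ofNat_mem _ 65) (pow_mem hr 7))) (mul_mem (ofNat_mem _ 4)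
    (pow_mem hr 8))
  have hab : a ^ 4 * b + 2 * a ^ 3 * b ^ 2 + 2 * a ^ 2 * b ^ 3 + a * b ^ 4
      = 25194 * (σ * τ) + σ * τ * l * (6 * l ^ 5 + 100 * l ^ 4 + 713 * l ^ 3 + 2896 * l ^ 2 + 7752 * l ^ 1 + 15504 * l ^ 0)
        + σ * τ * r * (33592 * r ^ 0 + 35396 * r ^ 1 + 28408 * r ^ 2 + 16986 * r ^ 3 + 7440 * r ^ 4 + 2328 * r
        ^ 5 + 496 * r ^ 6 + 65 * r ^ 7 + 4 * r ^ 8) := by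
    rw [ha, hb]
    trans 6 * (M ^ 5 * r ^ 2) + 100 * (M ^ 5 * r ^ 3) + 713 * (M ^ 5 * r ^ 4) + 2896 * (M ^ 5 * r ^
      5) + 7752 * (M ^ 5 * r ^ 6) + 15504 * (M ^ 5 * r ^ 7) + 25194 * (M ^ 5 * r ^ (8 + 0)) +
      33592 * (M ^ 5 * r ^ (8 + 1)) + 35396 * (M ^ 5 * r ^ (8 + 2)) + 28408 * (M ^ 5 * r ^ (8 +
      3)) + 16986 * (M ^ 5 * r ^ (8 + 4)) + 7440 * (M ^ 5 * r ^ (8 + 5)) + 2328 * (M ^ 5 * r ^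
      (8 + 6)) + 496 * (M ^ 5 * r ^ (8 + 7)) + 65 * (M ^ 5 * r ^ (8 + 8)) + 4 * (M ^ 5 * r ^ (8
      + 9))
    · ring
    · rw [hA 2 6 rfl, hA 3 5 rfl, hA 4 4 rfl, hA 5 3 rfl, hA 6 2 rfl, hA 7 1 rfl]
      simp only [hB]
      ring
  obtain ⟨x, hx, x0, x1⟩ := teichmuller_add_five a b
  rw [← ea, ← eb, hx, map_add, map_add, wcls_teichmuller_left hal, wcls_teichmuller_right hbr,
    add_zero, zero_add, wcls_succ_of_left, x1, hab,
    cls_add_add_eq (mul_mem hl' hL) (mul_mem hr' hR)]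
  intro i hi
  obtain rfl : i = 0 := by omega
  rw [x0]
  exact Subring.zero_mem _

theorem isWitnessNorm_E8_five [Fact (Nat.Prime 5)] :
    IsWitnessNorm 5 2 one_le_two s t (-(t ^ 2 + s ^ 3)) := by
  have e1 := algebraMap_mul_invL s t
  have e2 := algebraMap_mul_invR s t
  have hS := algebraMap_mem_left s t s
  have hT := algebraMap_mem_left s t t
  have hS' := algebraMap_mem_right s t s
  have hT' := algebraMap_mem_right s t t
  have hσ := invL_mem s t
  have hτ := invR_mem s t
  have hN : algebraMap R (Localization.Away (s * t)) (-(t ^ 2 + s ^ 3))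
      = -(algebraMap R _ t ^ 2 + algebraMap R _ s ^ 3) := by
    simp only [map_neg, map_add, map_pow]
  rw [IsWitnessNorm]
  simp only [frac, pow_one, map_pow (algebraMap R _), hN]
  generalize algebraMap R (Localization.Away (s * t)) s = S at *
  generalize algebraMap R (Localization.Away (s * t)) t = T at *
  generalize invL s t = σ at *
  generalize invR s t = τ at *
  constructor
  · obtain ⟨a, ea⟩ : ∃ a, a = T * σ := ⟨_, rfl⟩
    obtain ⟨b, eb⟩ : ∃ b, b = S ^ 2 * τ := ⟨_, rfl⟩
    have h1 : -(T ^ 2 + S ^ 3) * σ * τ = -a + -b := by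
      rw [show -(T ^ 2 + S ^ 3) * σ * τ = -(T * τ * (T * σ)) + -(S * σ * (S ^ 2 * τ)) by ring, e1, e2]
      rw [ea, eb]
      ring
    have h41 : a ^ 4 * b = T ^ 3 * σ ^ 2 := by
      rw [show a ^ 4 * b = (S * σ) ^ 2 * (T * τ) ^ 1 * (T ^ 3 * σ ^ 2) by rw [ea, eb]; ring, e1, e2]
      ring
    have h32 : a ^ 3 * b ^ 2 = S * T := by
      rw [show a ^ 3 * b ^ 2 = (S * σ) ^ 3 * (T * τ) ^ 2 * (S * T) by rw [ea, eb]; ring, e1, e2]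
      ring
    have h23 : a ^ 2 * b ^ 3 = S ^ 4 * τ := by
      rw [show a ^ 2 * b ^ 3 = (S * σ) ^ 2 * (T * τ) ^ 2 * (S ^ 4 * τ) by rw [ea, eb]; ring, e1, e2]
      ring
    have h14 : a * b ^ 4 = S ^ 7 * τ ^ 3 := by
      rw [show a * b ^ 4 = (S * σ) ^ 1 * (T * τ) ^ 1 * (S ^ 7 * τ ^ 3) by rw [ea, eb]; ring, e1, e2]
      ring
    have ha : a ∈ leftRing s t := ea ▸ mul_mem hT hσ
    have hb : b ∈ rightRing s t := eb ▸ mul_mem (pow_mem hS' _) hτ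
    obtain ⟨x, hx, x0, x1⟩ := teichmuller_add_five (-a) (-b)
    rw [h1, hx, map_add, map_add, wcls_teichmuller_left (neg_mem ha),
      wcls_teichmuller_right (neg_mem hb), add_zero, zero_add, wcls_succ_of_left]
    · have : x.coeff 1 = 0 + -(T ^ 3 * σ ^ 2 + 2 * (S * T)) + -(2 * (S ^ 4 * τ) + S ^ 7 * τ ^ 3) := by
        rw [x1]
        linear_combination -h41 - 2 * h32 - 2 * h23 - h14
      rw [this, cls_add_add_eq (neg_mem (add_mem (mul_mem (pow_mem hT _) (pow_mem hσ _)) (mul_mem (ofNat_mem _ 2) (mul_mem hS hT))))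
        (neg_mem (add_mem (mul_mem (ofNat_mem _ 2) (mul_mem (pow_mem hS' _) hτ)) (mul_mem (pow_mem hS' _) (pow_mem hτ _)))), map_zero, map_zero]
    · intro i hi
      obtain rfl : i = 0 := by omega
      rw [x0]
      exact Subring.zero_mem _
  · refine ⟨25194, by norm_num, ?_⟩
    rw [show (-(T ^ 2 + S ^ 3)) ^ (5 - 1) * σ ^ 5 * τ ^ 5 = (T * τ) ^ 5 * (T ^ 3 * σ ^ 5)
        + 4 * ((S * σ) ^ 3 * (T * τ) ^ 5 * (T * σ ^ 2))
        + (6 * ((S * σ) ^ 5 * (T * τ) ^ 4 * (S * τ)) + 4 * ((S * σ) ^ 5 * (T * τ) ^ 2 * (S ^ 4 * τ ^ 3))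
          + (S * σ) ^ 5 * (S ^ 7 * τ ^ 5)) by ring, e1, e2]
    simp only [one_pow, one_mul]
    rw [wcls_teichmuller_frobenius_E8_five e1 e2 hT hS' hσ hτ, map_natCast]
    congr 2
    push_cast
    ring

end Classes

/-! ### Scalar multiplication, restriction and Verschiebung on classes -/

section WittSmul

variable {p : ℕ} [hp : Fact p.Prime] {R S : Type*} [CommRing R] [CommRing S] {s t : R}

theorem wittMap_truncate (n : ℕ) (f : R →+* S) (x : WittVector p R) :
    wittMap p n f (WittVector.truncate n x) = WittVector.truncate n (WittVector.map f x) := by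
  apply TruncatedWittVector.ext
  intro i
  rw [coeff_wittMap, WittVector.coeff_truncate, WittVector.coeff_truncate, WittVector.map_coeff]

theorem truncate_smul_wcls (n : ℕ) (r : WittVector p R)
    (x : WittVector p (Localization.Away (s * t))) :
    WittVector.truncate n r • (wcls n x : LocalH2 p n s t)
      = wcls n (WittVector.map (algebraMap R _) r * x) := by
  rw [wcls_apply, wcls_apply, smul_hmk, wittMap_truncate, map_mul]

theorem cechMap_wcls (n : ℕ) {g : R →+* S} {s' t' : S} (h : IsCechHom g s t s' t')
    (x : WittVector p (Localization.Away (s * t))) :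
    cechMap p n h (wcls n x) = wcls n (WittVector.map h.loc x) := by
  rw [wcls_apply, wcls_apply, cechMap_hmk, wittMap_truncate]

theorem cohR_wcls {m n : ℕ} (h : m ≤ n) (x : WittVector p (Localization.Away (s * t))) :
    cohR h s t (wcls n x) = wcls m x := by
  rw [wcls_apply, wcls_apply, cohR_hmk, TruncatedWittVector.truncate_wittVector_truncate]

theorem wcls_verschiebung (n : ℕ) (x : WittVector p (Localization.Away (s * t))) :
    wcls (n + 1) (WittVector.verschiebung x) = cohV n.le_succ s t (wcls n x) := by
  rw [wcls_apply, wcls_apply, cohV_hmk]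
  congr 1
  apply TruncatedWittVector.ext
  intro i
  rw [WittVector.coeff_truncate, coeff_wittV]
  have h1 : n + 1 - n = 1 := by omega
  split_ifs with hi
  · rw [WittVector.coeff_truncate]
    obtain ⟨j, hj⟩ : ∃ j, (i : ℕ) = j + 1 := ⟨i - 1, by omega⟩
    simp only [hj, WittVector.verschiebung_coeff_succ]
    congr 1
    omega
  · have : (i : ℕ) = 0 := by omega
    rw [this, WittVector.verschiebung_coeff_zero]

theorem wcls_one (x : WittVector p (Localization.Away (s * t))) :
    wcls 1 x = cls p s t (x.coeff 0) := by
  rw [wcls_apply, cls_apply]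
  congr 1
  apply TruncatedWittVector.ext
  intro i
  obtain rfl := Subsingleton.elim i ⟨0, one_pos⟩
  rw [WittVector.coeff_truncate, coeff_wittOne]

end WittSmul

/-! ### The witness class on the hypersurface -/

section WitnessClass

universe u

variable {p : ℕ} [hp : Fact p.Prime] {Q : Type u} [CommRing Q] [IsLocalRing Q] [CharP Q p]
  {s t W : Q} {d : Derivation ℤ Q Q}

variable (p s t W) in
/-- The Teichmüller class of `W ^ (p - 1) / (st)`. -/
def witness (n : ℕ) : LocalH2 p n s t :=
  wcls n (WittVector.teichmuller p (frac s t (W ^ (p - 1)) 1 1))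

omit [IsLocalRing Q] [CharP Q p] in
theorem cohR_witness {m n : ℕ} (h : m ≤ n) :
    cohR h s t (witness p s t W n) = witness p s t W m := cohR_wcls h _

omit [IsLocalRing Q] [CharP Q p] in
theorem witness_one : witness p s t W 1 = cls p s t (frac s t (W ^ (p - 1)) 1 1) := by
  rw [witness, wcls_one, WittVector.teichmuller_coeff_zero]

omit [IsLocalRing Q] in
theorem frobenius_witness (n : ℕ) :
    cechMap p n (IsCechHom.frobenius (p := p) s t) (witness p s t W n)
      = wcls n (WittVector.teichmuller p (frac s t ((W ^ p) ^ (p - 1)) p p)) := by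
  rw [witness, cechMap_wcls, WittVector.map_teichmuller, loc_frobenius_frac, one_mul, ← pow_mul,
    ← pow_mul, mul_comm (p - 1) p]

/-- A Witt vector with zeroth component in `(s, t, W)` is a combination of `[s]`, `[t]`, `[W]` plus
some `V u`. The first two cancel a denominator, the third gives `[W^p/(st)]`, which vanishes by
hypothesis. For the last, `V u · θ = V(u · F θ)`, and `F θ` vanishes in one length less, being a
full Verschiebung. -/
theorem witness_mem_cohTorsion (h : RegPair s t) {n : ℕ} (hn : 1 ≤ n)
    (hW : IsWitnessNorm p n hn s t (W ^ p)) (hm : maximalIdeal Q = Ideal.span {s, t, W}) :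
    witness p s t W n ∈ cohTorsion p n s t (maximalIdeal Q) := by
  obtain ⟨n, rfl⟩ := Nat.exists_eq_add_of_le' hn
  set θ := WittVector.teichmuller p (frac s t (W ^ (p - 1)) 1 1) with hθ
  have hchar : CharP (Localization.Away (s * t)) p :=
    charP_of_injective_ringHom h.algebraMap_injective p
  have hF : WittVector.frobenius θ
      = WittVector.teichmuller p (frac s t ((W ^ p) ^ (p - 1)) p p) := by
    rw [WittVector.frobenius_eq_map_frobenius, WittVector.map_teichmuller, frobenius_def]
    congr 1
    rw [frac, frac, mul_pow, mul_pow, ← pow_mul, ← pow_mul, one_mul, ← map_pow, ← pow_mul,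
      ← pow_mul, mul_comm p]
  have hFn : (wcls n (WittVector.frobenius θ) : LocalH2 p n s t) = 0 := by
    obtain ⟨c, -, hc⟩ := hW.2
    have := congrArg (cohR n.le_succ s t) hc
    rwa [cohR_wcls, cohR_cohV, ← hF] at this
  rw [cohTorsion, Submodule.mem_torsionBySet_iff]
  rintro ⟨r, hr⟩
  obtain ⟨r, rfl⟩ := WittVector.truncate_surjective (p := p) (n + 1) Q r
  change WittVector.truncate (n + 1) r • witness p s t W (n + 1) = 0
  have hr := (mem_wittIdeal_iff hn _ _).1 hr
  rw [WittVector.coeff_truncate, hm, Ideal.mem_span_insert] at hr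
  obtain ⟨a, z, hz, hr⟩ := hr
  obtain ⟨b, c, rfl⟩ := Ideal.mem_span_pair.1 hz
  have hkill : ∀ w q : Q, wcls (n + 1) (WittVector.map (algebraMap Q _)
      (WittVector.teichmuller p w) * θ) = (0 : LocalH2 p (n + 1) s t) →
      wcls (n + 1) (WittVector.map (algebraMap Q _)
      (WittVector.teichmuller p q * WittVector.teichmuller p w) * θ)
        = (0 : LocalH2 p (n + 1) s t) := by
    intro w q hw
    rw [← truncate_smul_wcls] at hw
    rw [← truncate_smul_wcls, map_mul, mul_smul, hw, smul_zero]
  have hT : ∀ w, WittVector.map (algebraMap Q _) (WittVector.teichmuller p w) * θ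
      = WittVector.teichmuller p (frac s t (w * W ^ (p - 1)) 1 1) := by
    intro w
    rw [WittVector.map_teichmuller, hθ, ← map_mul, algebraMap_mul_frac]
  have hks := hkill s a (by
    rw [hT]
    apply wcls_teichmuller_right
    have := frac_mul_left s t (W ^ (p - 1)) 0 1 1
    rw [pow_one, zero_add] at this
    rw [this]
    exact frac_mem_right ..)
  have hkt := hkill t b (by
    rw [hT]
    apply wcls_teichmuller_left
    have := frac_mul_right s t (W ^ (p - 1)) 1 0 1
    rw [pow_one, zero_add] at this
    rw [this]
    exact frac_mem_left ..)
  have hkW := hkill W c (by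
    rw [hT, mul_pow_sub_one hp.out.ne_zero]
    exact hW.1)
  set v := r - (WittVector.teichmuller p a * WittVector.teichmuller p s
    + (WittVector.teichmuller p b * WittVector.teichmuller p t
      + WittVector.teichmuller p c * WittVector.teichmuller p W)) with hv
  have hv0 : v.coeff 0 = 0 := by
    have : WittVector.constantCoeff v = 0 := by
      rw [hv, map_sub, map_add, map_add, map_mul, map_mul, map_mul]
      simp only [WittVector.constantCoeff_apply, WittVector.teichmuller_coeff_zero, hr]
      ring
    exact this
  obtain ⟨u, hu⟩ : ∃ u, v = WittVector.verschiebung u :=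
    ⟨v.shift 1, by
      have := WittVector.verschiebung_shift v 0 (fun i hi => by
        obtain rfl : i = 0 := by omega
        exact hv0)
      rw [show v.shift 0 = v from WittVector.ext fun i => by rw [WittVector.shift_coeff, zero_add]]
        at this
      exact this.symm⟩
  have hkv : wcls (n + 1) (WittVector.map (algebraMap Q _) v * θ)
      = (0 : LocalH2 p (n + 1) s t) := by
    rw [hu, WittVector.map_verschiebung, ← WittVector.verschiebung_mul_frobenius,
      wcls_verschiebung, ← truncate_smul_wcls, hFn, smul_zero, map_zero]
  rw [show r = v + (WittVector.teichmuller p a * WittVector.teichmuller p s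
    + (WittVector.teichmuller p b * WittVector.teichmuller p t
      + WittVector.teichmuller p c * WittVector.teichmuller p W)) by rw [hv]; ring]
  rw [witness, truncate_smul_wcls, map_add, map_add, map_add, add_mul, add_mul, add_mul, map_add,
    map_add, map_add, ← hθ, hks, hkt, hkW, hkv]
  simp

/-- Classes killed by `s` and `t` are `α/(st)` with `α` modulo `(s, t)`, so the question is the
socle of `Q/(s, t)`, where every nonzero element is a unit times `W^i` with `i < p`. -/
theorem isTorsionGenerator_witness_one (h : RegPair s t) (M : InsepModel p s t W d) :
    IsTorsionGenerator p s t (maximalIdeal Q) (witness p s t W 1) := by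
  rw [witness_one, isTorsionGenerator_iff]
  have hs : s ∈ Ideal.span {s, t} := Ideal.subset_span (by simp)
  have ht : t ∈ Ideal.span {s, t} := Ideal.subset_span (by simp)
  have hsm : ∀ w ∈ ({s, t, W} : Set Q), w ∈ maximalIdeal Q := by
    rw [M.span_eq]; exact fun w hw => Ideal.subset_span hw
  have hle : Ideal.span {s, t} ≤ maximalIdeal Q :=
    Ideal.span_le.2 fun w hw => hsm w (by
      rcases hw with rfl | hw
      · simp
      · rw [Set.mem_singleton_iff.1 hw]; simp)
  have hcls : ∀ a : Q, cls p s t (frac s t a 1 1) = 0 ↔ a ∈ Ideal.span {s, t} := by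
    intro a
    rw [h.cls_frac_eq_zero_iff, Ideal.mem_span_pair]
    constructor
    · rintro ⟨α, β, rfl⟩; exact ⟨α, β, by ring⟩
    · rintro ⟨α, β, rfl⟩; exact ⟨α, β, by ring⟩
  -- The ideal `(s, t)` is `d`-stable, so a power `W^i` with `i < p` inside it could be
  -- differentiated down to `1`.
  have hWp : ∀ i, i < p → W ^ i ∉ Ideal.span {s, t} := by
    intro i
    induction i with
    | zero =>
      intro _ hi
      rw [pow_zero] at hi
      exact (maximalIdeal.isMaximal Q).ne_top ((Ideal.eq_top_iff_one _).2 (hle hi))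
    | succ i ih =>
      intro hi hmem
      have hd : ∀ q ∈ Ideal.span {s, t}, d q ∈ Ideal.span {s, t} := by
        intro q hq
        obtain ⟨a, b, rfl⟩ := Ideal.mem_span_pair.1 hq
        rw [map_add, Derivation.leibniz, Derivation.leibniz, M.dl, M.dr, smul_zero, smul_zero,
          zero_add, zero_add, smul_eq_mul, smul_eq_mul]
        exact Ideal.add_mem _ (Ideal.mul_mem_right _ _ hs) (Ideal.mul_mem_right _ _ ht)
      have h1 := hd _ hmem
      rw [Derivation.leibniz_pow, M.dW, smul_eq_mul, mul_one, nsmul_eq_mul] at h1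
      have h4 : IsUnit ((i + 1 : ℕ) : Q) := by
        rw [CharP.isUnit_natCast_iff hp.out]
        exact fun h => absurd (Nat.le_of_dvd (by omega) h) (by omega)
      exact ih (by omega) ((Ideal.unit_mul_mem_iff_mem _ h4).1 h1)
  refine ⟨fun r hr => ?_, fun z hz => ?_⟩
  · rw [smul_cls, algebraMap_mul_frac, hcls]
    rw [M.span_eq, Ideal.mem_span_insert] at hr
    obtain ⟨a, z, hz, rfl⟩ := hr
    obtain ⟨b, c, rfl⟩ := Ideal.mem_span_pair.1 hz
    have := Ideal.add_mem _ (Ideal.add_mem _ (Ideal.mul_mem_left _ (a * W ^ (p - 1)) hs)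
      (Ideal.mul_mem_left _ (b * W ^ (p - 1)) ht)) (Ideal.mul_mem_left _ c M.pow_mem)
    rw [← mul_pow_sub_one hp.out.ne_zero W] at this
    convert this using 1
    ring
  · obtain ⟨α, rfl⟩ := h.exists_cls_frac_one_one z (hz s (hsm s (by simp))) (hz t (hsm t (by simp)))
    have hα := hz W (hsm W (by simp))
    rw [smul_cls, algebraMap_mul_frac, hcls] at hα
    by_cases hα0 : α ∈ Ideal.span {s, t}
    · exact ⟨0, by rw [(hcls α).2 hα0, map_zero, zero_smul]⟩
    obtain ⟨i, hi, u, hu, hαu⟩ := M.exists_unit_mul_pow α hα0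
    have hip : i = p - 1 := by
      by_contra hne
      refine hWp (i + 1) (by omega) ?_
      have h1 := Ideal.sub_mem _ hα (Ideal.mul_mem_left _ W hαu)
      rw [show W * α - W * (α - u * W ^ i) = u * W ^ (i + 1) by ring] at h1
      exact (Ideal.unit_mul_mem_iff_mem _ hu).1 h1
    subst hip
    refine ⟨u, ?_⟩
    have h1 := (hcls _).2 hαu
    rw [smul_cls, algebraMap_mul_frac, ← sub_eq_zero, ← map_sub, ← h1]
    congr 1
    rw [sub_eq_iff_eq_add, ← frac_add, sub_add_cancel]

end WitnessClass

/-! ### Transport of the witness to `A` with parameters `x, y` -/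

section Transport

variable {p : ℕ} [hp : Fact p.Prime]

/-- Two identifications are composed: from `s, t` to `g x, g y` in `Q`, and from `Q` to `A`. The
class `η` corresponds to `c/(st)`: nonzero because `c` is a unit, and killed by whatever maps into
`(s, t)`. -/
theorem exists_transported_witness {A Q : Type*} [CommRing A] [IsLocalRing A] [IsNoetherianRing A]
    [CharP A p] [CommRing Q] [IsLocalRing Q] [IsNoetherianRing Q] [CharP Q p] {g : A →+* Q}
    (hg : IsCompletionMap g) {s t W : Q} {d : Derivation ℤ Q Q} (M : InsepModel p s t W d)
    (hs0 : ∀ q, s * q = 0 → q = 0) (ht0 : ∀ q, t * q = 0 → q = 0) {n : ℕ} (hn : 1 ≤ n)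
    (hW : IsWitnessNorm p n hn s t (W ^ p)) {x y : A} (hxy : ParamPair x y) :
    ∃ e ∈ cohTorsion p n x y (maximalIdeal A),
      IsTorsionGenerator p x y (maximalIdeal A) (cohR hn x y e) ∧
      ∃ η : LocalH2 p 1 x y, η ≠ 0 ∧
        cechMap p n (IsCechHom.frobenius (p := p) x y) e = cohV hn x y η ∧
        ∀ a : A, g a ∈ Ideal.span {s, t} → wittOne p a • η = 0 := by
  have hQ := hg.paramPair hxy
  have hfg : (maximalIdeal A).FG := IsNoetherian.noetherian _
  have hfgQ : (maximalIdeal Q).FG := IsNoetherian.noetherian _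
  have hstm : ∀ w ∈ ({s, t, W} : Set Q), w ∈ maximalIdeal Q := by
    rw [M.span_eq]; exact fun w hw => Ideal.subset_span hw
  have hsm := hstm s (by simp)
  have htm := hstm t (by simp)
  have hst : ParamPair s t := by
    refine hQ.of_primary_of_nz hsm htm ?_ hs0 ht0
    apply Ideal.exists_pow_le_of_le_radical_of_fg _ hfgQ
    rw [M.span_eq, Ideal.span_le]
    rintro w (rfl | rfl | rfl)
    · exact Ideal.le_radical (Ideal.subset_span (by simp))
    · exact Ideal.le_radical (Ideal.subset_span (by simp))
    · exact ⟨p, M.pow_mem⟩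
  obtain ⟨E⟩ := hst.nonempty_cechEquiv (p := p) hQ
  set γ := IsCechHom.self_map g x y
  have hγ : ∀ n, Function.Bijective (cechMap p n γ) := hg.cechMap_bijective hxy hfg
  obtain ⟨c, hpc, hc⟩ := hW.2
  obtain ⟨e, he⟩ := (hγ n).2 (E.equiv n (witness p s t W n))
  obtain ⟨η, hη⟩ := (hγ 1).2 (E.equiv 1 (cls p s t (frac s t (c : Q) 1 1)))
  have hRe : cechMap p 1 γ (cohR hn x y e) = E.equiv 1 (witness p s t W 1) := by
    rw [cechMap_cohR, he, ← E.restr, cohR_witness]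
  have hgen := isTorsionGenerator_iff.1 (isTorsionGenerator_witness_one hst.toRegPair M)
  have hsmul1 : ∀ (a : A) (z : LocalH2 p 1 x y),
      cechMap p 1 γ (wittOne p a • z) = wittOne p (g a) • cechMap p 1 γ z := by
    intro a z
    rw [cechMap_smul, wittMap_wittOne]
  refine ⟨e, ?_, isTorsionGenerator_iff.2 ⟨fun a ha => ?_, fun z hz => ?_⟩, η, ?_, ?_, ?_⟩
  · rw [cohTorsion, Submodule.mem_torsionBySet_iff]
    rintro ⟨a, ha⟩
    change a • e = 0
    have ha := (mem_wittIdeal_iff hn _ _).1 ha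
    apply (hγ n).1
    rw [cechMap_smul, he, ← E.smul, map_zero]
    have := (Submodule.mem_torsionBySet_iff _ _).1
      (witness_mem_cohTorsion hst.toRegPair hn hW M.span_eq)
      ⟨wittMap p n g a, (mem_wittIdeal_iff hn _ _).2 (by
        rw [coeff_wittMap]; exact (hg.mem_iff _).2 ha)⟩
    change wittMap p n g a • witness p s t W n = 0 at this
    rw [this, map_zero]
  · apply (hγ 1).1
    rw [hsmul1, hRe, ← E.smul, hgen.1 _ ((hg.mem_iff a).2 ha), map_zero, map_zero]
  · have hz' : ∀ q ∈ maximalIdeal Q, wittOne p q • cechMap p 1 γ z = 0 := by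
      intro q hq
      obtain ⟨N, hN⟩ := hQ.exists_pow_smul_eq_zero hfgQ (cechMap p 1 γ z)
      obtain ⟨a, ha⟩ := hg.approx (N + 1) q
      have h1 : g a ∈ maximalIdeal Q := by
        have := Ideal.sub_mem _ hq (Ideal.pow_le_self N.succ_ne_zero ha)
        rwa [sub_sub_cancel] at this
      have h2 := hN _ (Ideal.pow_le_pow_right N.le_succ ha)
      rw [map_sub, sub_smul, ← hsmul1, hz a ((hg.mem_iff a).1 h1), map_zero, sub_zero] at h2
      exact h2
    obtain ⟨r, hr⟩ := hgen.2 ((E.equiv 1).symm (cechMap p 1 γ z)) (fun q hq => by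
      apply (E.equiv 1).injective
      rw [E.smul, AddEquiv.apply_symm_apply, hz' q hq, map_zero])
    obtain ⟨a, ha⟩ := hg.approx 1 r
    rw [pow_one] at ha
    have h1 := hgen.1 _ ha
    rw [map_sub, sub_smul, sub_eq_zero, ← hr] at h1
    refine ⟨a, (hγ 1).1 ?_⟩
    rw [hsmul1, hRe, ← E.smul, ← h1, AddEquiv.apply_symm_apply]
  · rintro rfl
    rw [map_zero, eq_comm, map_eq_zero_iff _ (E.equiv 1).injective,
      hst.toRegPair.cls_frac_eq_zero_iff] at hη
    obtain ⟨α, β, h⟩ := hη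
    have h1 : (c : Q) ∈ maximalIdeal Q := by
      rw [h, pow_one, pow_one]
      exact Ideal.add_mem _ (Ideal.mul_mem_right _ _ hsm) (Ideal.mul_mem_right _ _ htm)
    exact h1 ((CharP.isUnit_natCast_iff hp.out).2 hpc)
  · apply (hγ n).1
    rw [cechMap_comm (IsCechHom.frobenius (p := p) x y) γ γ (IsCechHom.frobenius (p := p) _ _)
      (fun a => map_pow g a p), he, ← E.frob, frobenius_witness, hc, E.versch, cechMap_cohV, hη]
  · intro a ha
    apply (hγ 1).1
    obtain ⟨α, β, h⟩ := Ideal.mem_span_pair.1 ha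
    rw [hsmul1, hη, ← E.smul, smul_cls, algebraMap_mul_frac, ← h, map_zero]
    rw [show (α * s + β * t) * (c : Q) = s ^ 1 * (α * c) + t ^ 1 * (β * c) by ring,
      cls_frac_eq_zero, map_zero]

/-- A regular sequence `x, y` of `A` generates an `𝔪`-primary ideal if the Frobenius of `A` factors
through a ring of dimension at most two. -/
theorem paramPair_of_isRegular {A B : Type*} [CommRing A] [IsLocalRing A] [IsNoetherianRing A]
    [IsDomain A] [CommRing B] (hdim : ringKrullDim B ≤ 2) (π : A →+* B) (φ : B →+* A)
    (hφ : ∀ a, φ (π a) = a ^ p) {x y : A} (hxy : RingTheory.Sequence.IsRegular A [x, y]) :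
    ParamPair x y := by
  have hx : ∀ z ∈ [x, y], z ∈ maximalIdeal A := by
    intro z hz
    by_contra hu
    have hu : IsUnit z := by rwa [mem_maximalIdeal, mem_nonunits_iff, not_not] at hu
    refine hxy.top_ne_smul (Eq.symm ?_)
    rw [Ideal.eq_top_of_isUnit_mem (Ideal.ofList [x, y]) (Ideal.subset_span hz) hu, Submodule.top_smul]
  have hI : Ideal.ofList [x, y] = Ideal.span {x, y} := by
    rw [Ideal.ofList]; congr 1; ext z; simp
  have hdimA : ringKrullDim A ≤ 2 := by
    -- `φ ∘ π` is Frobenius, which pulls every prime back to itself; hence `Spec φ` is injective and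
    -- maps chains of primes of `A` to chains of primes of `B`.
    refine le_trans (Order.krullDim_le_of_strictMono (PrimeSpectrum.comap φ) ?_) hdim
    intro P P' h
    refine lt_of_le_of_ne (fun b hb => h.le hb) (fun heq => h.not_ge fun a ha => ?_)
    have h1 : φ (π a) ∈ P'.asIdeal := by
      rw [hφ]; exact Ideal.pow_mem_of_mem _ ha p hp.out.pos
    have h2 : π a ∈ (PrimeSpectrum.comap φ P).asIdeal := by rw [heq]; exact h1
    have h3 : φ (π a) ∈ P.asIdeal := h2
    rw [hφ] at h3
    exact P.isPrime.mem_of_pow_mem p h3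
  have hreg := ringKrullDim_add_length_eq_ringKrullDim_of_isRegular [x, y] hxy
  rw [hI] at hreg
  have h0 : ringKrullDim (A ⧸ Ideal.span {x, y}) ≤ 0 := by
    rw [← hreg] at hdimA
    exact (ENat.WithBot.add_le_add_natCast_right_iff (c := 2)).1 (by simpa using hdimA)
  refine ⟨regPair_of_isRegular hxy, hx x (by simp), hx y (by simp), ?_⟩
  have : Ring.KrullDimLE 0 (A ⧸ Ideal.span {x, y}) := Ring.krullDimLE_iff.2 (by simpa using h0)
  apply Ideal.exists_pow_le_of_le_radical_of_fg _ (IsNoetherian.noetherian _)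
  rw [Ideal.radical_eq_sInf]
  refine le_sInf ?_
  rintro P ⟨hle, hP⟩
  have hsurj := Ideal.Quotient.mk_surjective (I := Ideal.span {x, y})
  have hPm : (P.map (Ideal.Quotient.mk (Ideal.span {x, y}))).IsPrime :=
    Ideal.map_isPrime_of_surjective hsurj (by rw [Ideal.mk_ker]; exact hle)
  have hmax := Ideal.comap_isMaximal_of_surjective _ hsurj 
    (K := P.map (Ideal.Quotient.mk (Ideal.span {x, y}))) (H := Ideal.isMaximal_of_isPrime _)
  rw [Ideal.comap_map_of_surjective' _ hsurj, Ideal.mk_ker, sup_eq_left.2 hle] at hmax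
  exact (IsLocalRing.eq_maximalIdeal hmax).ge

end Transport

/-! ### The five equations -/

section Models

universe u

variable {p : ℕ} [hp : Fact p.Prime] {k : Type*} [Field k] [CharP k p] {Q : Type u} [CommRing Q]
  [hQ : IsLocalRing Q]

variable (p Q) in
/-- `Q` is a purely inseparable hypersurface `W ^ p = N(s, t)` for which the Teichmüller class of
`W ^ (p - 1) / (st)` is a witness in length `n`. -/
def HasWitness (n : ℕ) (hn : 1 ≤ n) : Prop :=
  CharP Q p ∧ IsNoetherianRing Q ∧ ∃ (s t W : Q) (d : Derivation ℤ Q Q), InsepModel p s t W d ∧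
    (∀ q, s * q = 0 → q = 0) ∧ (∀ q, t * q = 0 → q = 0) ∧ IsWitnessNorm p n hn s t (W ^ p)

theorem hasWitness_of_equation {a b w : Fin 3} (hσ : ∀ i, i = a ∨ i = b ∨ i = w) (haw : a ≠ w)
    (hbw : b ≠ w) {f N : MvPowerSeries (Fin 3) k} (hf : f = MvPowerSeries.X w ^ p - N)
    (hN : N ∈ Ideal.span {MvPowerSeries.X a, MvPowerSeries.X b})
    (hd : MvPowerSeries.pderiv k w N = 0) (e : (MvPowerSeries (Fin 3) k ⧸ Ideal.span {f}) ≃+* Q)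
    {n : ℕ} (hn : 1 ≤ n)
    (hW : ∀ m : MvPowerSeries (Fin 3) k →+* Q, CharP Q p →
      IsWitnessNorm p n hn (m (MvPowerSeries.X a)) (m (MvPowerSeries.X b)) (m N)) :
    HasWitness p Q n hn := by
  obtain ⟨m, hm, hchar, hnoeth, _, d, M, hs, ht⟩ := exists_insepModel hσ haw hbw hf hN hd e
  exact ⟨hchar, hnoeth, _, _, _, d, M, hs, ht, hm ▸ hW m hchar⟩

theorem hasWitness_A (e : (MvPowerSeries (Fin 3) k ⧸
    Ideal.span {rdpEquation k p (Dynkin.A (p - 1))}) ≃+* Q) : HasWitness p Q 1 le_rfl := by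
  refine hasWitness_of_equation (p := p) (a := 0) (b := 1) (w := 2)
    (N := MvPowerSeries.X 0 * MvPowerSeries.X 1)
    (by decide) (by decide) (by decide) ?_ ?_ ?_ e _ fun m _ => ?_
  · rw [rdpEquation, Nat.sub_add_cancel hp.out.one_le]
  · exact Ideal.mul_mem_right _ _ (Ideal.subset_span (by simp))
  · simp [Derivation.leibniz]
  · rw [map_mul]
    exact isWitnessNorm_A p

theorem hasWitness_D [Fact (Nat.Prime 2)] [CharP k 2] {n : ℕ} (hn : 2 ≤ n)
    (e : (MvPowerSeries (Fin 3) k ⧸ Ideal.span {rdpEquation k 2 (Dynkin.D (2 ^ n))}) ≃+* Q) :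
    HasWitness 2 Q n (one_le_two.trans hn) := by
  have h2 : 2 ^ n / 2 = 2 ^ (n - 1) := by
    obtain ⟨m, rfl⟩ := Nat.exists_eq_add_of_le' (one_le_two.trans hn)
    rw [pow_succ, Nat.mul_div_cancel _ two_pos, Nat.add_sub_cancel]
  have hev : Even (2 ^ n) := (Nat.even_pow.2 ⟨even_two, by omega⟩)
  refine hasWitness_of_equation (p := 2) (a := 0) (b := 1) (w := 2)
    (N := -(MvPowerSeries.X 0 ^ 2 * MvPowerSeries.X 1
      + MvPowerSeries.X 0 * MvPowerSeries.X 1 ^ 2 ^ (n - 1)))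
    (by decide) (by decide) (by decide) ?_ ?_ ?_ e _ fun m _ => ?_
  · rw [rdpEquation, if_pos rfl, if_pos hev, h2]; ring
  · refine neg_mem (Ideal.add_mem _ (Ideal.mul_mem_left _ _ ?_)
      (Ideal.mul_mem_right _ _ ?_)) <;> exact Ideal.subset_span (by simp)
  · simp [Derivation.leibniz, Derivation.leibniz_pow]
  · rw [map_neg, map_add, map_mul, map_mul, map_pow, map_pow]
    exact isWitnessNorm_D n hn

theorem hasWitness_E8_two [Fact (Nat.Prime 2)] [CharP k 2]
    (e : (MvPowerSeries (Fin 3) k ⧸ Ideal.span {rdpEquation k 2 Dynkin.E8}) ≃+* Q) :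
    HasWitness 2 Q 4 (by norm_num) := by
  refine hasWitness_of_equation (p := 2) (a := 0) (b := 1) (w := 2)
    (N := -(MvPowerSeries.X 0 ^ 3 + MvPowerSeries.X 1 ^ 5))
    (by decide) (by decide) (by decide) ?_ ?_ ?_ e _ fun m _ => ?_
  · rw [rdpEquation]; ring
  · refine neg_mem (Ideal.add_mem _ (Ideal.pow_mem_of_mem _ ?_ 3 (by norm_num))
      (Ideal.pow_mem_of_mem _ ?_ 5 (by norm_num))) <;> exact Ideal.subset_span (by simp)
  · simp [Derivation.leibniz_pow]
  · rw [map_neg, map_add, map_pow, map_pow]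
    exact isWitnessNorm_E8_two

theorem hasWitness_E6 [Fact (Nat.Prime 3)] [CharP k 3]
    (e : (MvPowerSeries (Fin 3) k ⧸ Ideal.span {rdpEquation k 3 Dynkin.E6}) ≃+* Q) :
    HasWitness 3 Q 2 one_le_two := by
  -- In characteristic `3` the inseparable variable of `z^2 + x^3 + y^4` is `x`, and `y, z` are the
  -- parameters.
  refine hasWitness_of_equation (p := 3) (a := 1) (b := 2) (w := 0)
    (N := -(MvPowerSeries.X 2 ^ 2 + MvPowerSeries.X 1 ^ 4))
    (by decide) (by decide) (by decide) ?_ ?_ ?_ e _ fun m _ => ?_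
  · rw [rdpEquation, if_neg (by norm_num)]; ring
  · refine neg_mem (Ideal.add_mem _ (Ideal.pow_mem_of_mem _ ?_ 2 (by norm_num))
      (Ideal.pow_mem_of_mem _ ?_ 4 (by norm_num))) <;> exact Ideal.subset_span (by simp)
  · simp [Derivation.leibniz_pow]
  · rw [map_neg, map_add, map_pow, map_pow]
    exact isWitnessNorm_E6

theorem hasWitness_E8_five [Fact (Nat.Prime 5)] [CharP k 5]
    (e : (MvPowerSeries (Fin 3) k ⧸ Ideal.span {rdpEquation k 5 Dynkin.E8}) ≃+* Q) :
    HasWitness 5 Q 2 one_le_two := by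
  -- In characteristic `5` the inseparable variable of `z^2 + x^3 + y^5` is `y`, and `x, z` are the
  -- parameters.
  refine hasWitness_of_equation (p := 5) (a := 0) (b := 2) (w := 1)
    (N := -(MvPowerSeries.X 2 ^ 2 + MvPowerSeries.X 0 ^ 3))
    (by decide) (by decide) (by decide) ?_ ?_ ?_ e _ fun m _ => ?_
  · rw [rdpEquation]; ring
  · refine neg_mem (Ideal.add_mem _ (Ideal.pow_mem_of_mem _ ?_ 2 (by norm_num))
      (Ideal.pow_mem_of_mem _ ?_ 3 (by norm_num))) <;> exact Ideal.subset_span (by simp)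
  · simp [Derivation.leibniz_pow]
  · rw [map_neg, map_add, map_pow, map_pow]
    exact isWitnessNorm_E8_five

end Models

/-! ### Descent of the witness along the quotient map -/

section Quotients

universe u v

variable {p : ℕ} [hp : Fact p.Prime] {k : Type*} [Field k] [CharP k p]
    {H : Type*} [CommRing H] [HopfAlgebra k H]
    {A : Type u} [CommRing A] [IsLocalRing A] [Algebra k A]
    {B : Type v} [CommRing B] [IsLocalRing B] [Algebra k B]

omit [IsLocalRing A] in
theorem pow_mem_range (hH : IsMuP k p H ∨ IsAlphaP k p H) (ρ : GroupSchemeAction k H B)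
    {π : A →ₐ[k] B} (hπ : ρ.IsQuotient π) (b : B) : b ^ p ∈ Set.range π := by
  rcases hH with ⟨t, hct, hc, hs, hk⟩ | ⟨t, hct, hc, hs, hk⟩
  · exact pow_mem_range_of_isQuotient (t := t) (c := 1)
      ⟨hc, hs, by rw [hk, map_one], one_pow _⟩ ρ hπ b
  · exact pow_mem_range_of_isQuotient (t := t) (c := 0)
      ⟨hc, hs, by rw [hk, map_zero, sub_zero], zero_pow hp.out.ne_zero⟩ ρ hπ b

/-- If `f ∘ g` is the Frobenius, then `g` is local. -/
theorem map_mem_of_frobenius_factor {R S : Type*} [CommRing R] [IsLocalRing R] [CommRing S]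
    [IsLocalRing S] {g : R →+* S} {f : S →+* R} (h : ∀ r, f (g r) = r ^ p) {r : R}
    (hr : r ∈ maximalIdeal R) : g r ∈ maximalIdeal S := by
  rw [mem_maximalIdeal, mem_nonunits_iff]
  intro hu
  have := hu.map f
  rw [h] at this
  exact hr ((isUnit_pow_iff hp.out.ne_zero).1 this)

omit [IsLocalRing A] [IsLocalRing B] in
/-- The inverse of the quotient map up to Frobenius. -/
theorem exists_frobenius_factor [CharP B p] (π : A →+* B) (hπ : Function.Injective π)
    (h : ∀ b : B, b ^ p ∈ Set.range π) :
    ∃ φ : B →+* A, (∀ b, π (φ b) = b ^ p) ∧ ∀ a, φ (π a) = a ^ p := by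
  choose φ hφ using h
  refine ⟨{
    toFun := φ
    map_one' := hπ ?_
    map_zero' := hπ ?_
    map_mul' := fun a b => hπ ?_
    map_add' := fun a b => hπ ?_ }, hφ, fun a => hπ ?_⟩
  · rw [hφ, one_pow, map_one]
  · rw [hφ, map_mul, hφ, hφ, mul_pow]
  · change π (φ 0) = _
    rw [hφ, zero_pow hp.out.ne_zero, map_zero]
  · change π (φ (a + b)) = π (φ a + φ b)
    rw [hφ, map_add, hφ, hφ, add_pow_char]
  · exact (hφ _).trans (map_pow π a p).symm

/-- All assertions about `π^* e` are tested after applying the injective map `φ^*`, where `φ^* π^* e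
= F e = V^(n-1) η` is known. The fixed locus enters only through `hspan`, which makes `𝔪_B` kill the
class. -/
theorem exists_class_of_frobenius_factor [IsNoetherianRing A] [IsDomain A] [CharP A p]
    [IsNoetherianRing B] [IsDomain B] [CharP B p] {u v : B} (huv : RegPair u v)
    (hm : maximalIdeal B = Ideal.span {u, v}) {Q : Type*} [CommRing Q] [IsLocalRing Q]
    [IsNoetherianRing Q] [CharP Q p] {g : A →+* Q} (hg : IsCompletionMap g) {s t W : Q}
    {d : Derivation ℤ Q Q} (M : InsepModel p s t W d) (hs0 : ∀ q, s * q = 0 → q = 0)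
    (ht0 : ∀ q, t * q = 0 → q = 0) {n : ℕ} (hn : 1 ≤ n) (hW : IsWitnessNorm p n hn s t (W ^ p))
    {π : A →+* B} (hπ : Function.Injective π) {φ : B →+* A} (hφ : ∀ b, π (φ b) = b ^ p)
    (hφ' : ∀ a, φ (π a) = a ^ p) (hspan : ∀ b ∈ maximalIdeal B, g (φ b) ∈ Ideal.span {s, t})
    {x y : A} (hP : ParamPair x y) :
    ∃ e ∈ cohTorsion p n x y (maximalIdeal A),
      IsTorsionGenerator p x y (maximalIdeal A) (cohR hn x y e) ∧
      ∃ e' : LocalH2 p 1 (π x) (π y),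
        IsTorsionGenerator p (π x) (π y) (maximalIdeal B) e' ∧
        cohPullback p n π x y e = cohV hn (π x) (π y) e' := by
  have hPB : ParamPair (π x) (π y) := by
    refine (huv.paramPair_of_span_eq hm).of_primary_of_nz ?_ ?_ ?_ ?_ ?_
    · exact map_mem_of_frobenius_factor hφ' hP.memL
    · exact map_mem_of_frobenius_factor hφ' hP.memR
    · apply Ideal.exists_pow_le_of_le_radical_of_fg _ (IsNoetherian.noetherian _)
      intro b hb
      obtain ⟨N, hN⟩ := hP.exists_pow_mem (map_mem_of_frobenius_factor hφ hb) 1 1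
      rw [pow_one, pow_one] at hN
      obtain ⟨α, β, h⟩ := Ideal.mem_span_pair.1 hN
      refine ⟨p * N, ?_⟩
      rw [pow_mul, ← hφ, ← map_pow, ← h, map_add, map_mul, map_mul]
      exact Ideal.mem_span_pair.2 ⟨_, _, rfl⟩
    · exact fun a ha => (mul_eq_zero.1 ha).resolve_left fun h0 => one_ne_zero
        (hP.nzl 1 (by rw [mul_one]; exact hπ (by rw [h0, map_zero])))
    · exact fun a ha => (mul_eq_zero.1 ha).resolve_left fun h0 => one_ne_zero
        (hP.nzr 1 (by rw [mul_one]; exact hπ (by rw [h0, map_zero])))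
  obtain ⟨e, he, hgen, η, hη0, hFe, hηk⟩ := exists_transported_witness hg M hs0 ht0 hn hW hP
  have hφC : IsCechHom φ (π x) (π y) x y :=
    ⟨isUnit_algebraMap_of_dvd_pow (k := p) (by rw [hφ']),
      isUnit_algebraMap_of_dvd_pow (k := p) (by rw [hφ'])⟩
  -- Followed by `π^*`, this map is the Frobenius of the regular ring `B`, which is injective.
  have hinj : ∀ m, Function.Injective (cechMap p m hφC) := by
    intro m a b hab
    apply frobenius_injective huv hm hPB m
    rw [← cechMap_comp (IsCechHom.self_map π x y) hφC _ hφ,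
      ← cechMap_comp (IsCechHom.self_map π x y) hφC _ hφ, hab]
  obtain ⟨n, rfl⟩ := Nat.exists_eq_add_of_le' hn
  have hφe : cechMap p (n + 1) hφC (cohPullback p (n + 1) π x y e) = cohV hn x y η := by
    rw [cohPullback_eq_cechMap, cechMap_comp hφC (IsCechHom.self_map π x y)
      (IsCechHom.frobenius (p := p) x y) hφ', hFe]
  -- The restriction to length `n` vanishes because `φ^*` turns it into the restriction of a class
  -- in the image of `V^n`.
  obtain ⟨ε, hε⟩ := exists_cohV_eq_of_cohR_eq_zero (cohPullback p (n + 1) π x y e) (by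
    apply hinj
    rw [cechMap_cohR, hφe, cohR_cohV, map_zero])
  have hφε : cechMap p 1 hφC ε = η := by
    apply cohV_injective (n := n) hP.toRegPair
    rw [← cechMap_cohV, hε, hφe]
  refine ⟨e, he, hgen, ε, ?_, hε.symm⟩
  refine isTorsionGenerator_of_regular huv hm hPB ε ?_ ?_
  · rintro rfl
    exact hη0 (by rw [← hφε, map_zero])
  · intro b hb
    apply hinj
    rw [cechMap_smul, wittMap_wittOne, hφε, map_zero]
    exact hηk _ (hspan b hb)

theorem exists_class_of_hasWitness [IsNoetherianRing A] {n : ℕ} (hn : 1 ≤ n)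
    (hw : HasWitness p (AdicCompletion (maximalIdeal A) A) n hn)
    (hH : IsMuP k p H ∨ IsAlphaP k p H) (hB : IsSmoothPoint k B)
    (ρ : GroupSchemeAction k H B) (π : A →ₐ[k] B) (hπ : ρ.IsQuotient π)
    (hfix : ρ.fixedLocus = {closedPoint B})
    (x y : A) (hxy : RingTheory.Sequence.IsRegular A [x, y]) :
    ∃ e ∈ cohTorsion p n x y (maximalIdeal A),
      IsTorsionGenerator p x y (maximalIdeal A) (cohR hn x y e) ∧
      ∃ e' : LocalH2 p 1 (π x) (π y),
        IsTorsionGenerator p (π x) (π y) (maximalIdeal B) e' ∧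
        cohPullback p n (π : A →+* B) x y e = cohV hn (π x) (π y) e' := by
  obtain ⟨hchar, hnoeth, s, t, W, d, M, hs0, ht0, hW⟩ := hw
  obtain ⟨hdom, u, v, hm, huv⟩ := exists_params_of_isRegularLocalRing B hB.1 hB.2.1
  have : IsNoetherianRing B := by have := hB.1; infer_instance
  have : CharP A p := charP_of_injective_algebraMap (algebraMap k A).injective p
  have : CharP B p := charP_of_injective_algebraMap (algebraMap k B).injective p
  have : IsDomain A := hπ.1.isDomain (π : A →+* B)
  obtain ⟨φ, hφ, hφ'⟩ := exists_frobenius_factor (π : A →+* B) hπ.1 (pow_mem_range hH ρ hπ)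
  have hφ0 : ∀ b, φ b = 0 → b = 0 := fun b hb => by
    have := hφ b
    rw [hb, map_zero] at this
    exact (pow_eq_zero_iff hp.out.ne_zero).1 this.symm
  have hP : ParamPair x y := paramPair_of_isRegular hB.2.1.le (π : A →+* B) φ hφ' hxy
  have hg := isCompletionMap_algebraMap A
  set g := algebraMap A (AdicCompletion (maximalIdeal A) A)
  refine exists_class_of_frobenius_factor huv hm hg M hs0 ht0 hn hW (π := (π : A →+* B)) hπ.1 hφ
    hφ' (fun b hb => ?_) hP
  -- The completion is a `B`-algebra through `φ`, not through `π`: thus `π a` acts as `(g a)^p`, as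
  -- the derivation argument requires.
  let _ : Algebra B (AdicCompletion (maximalIdeal A) A) := (g.comp φ).toAlgebra
  have hx : ∀ a, algebraMap B (AdicCompletion (maximalIdeal A) A) (π a) = g a ^ p := fun a => by
    rw [← map_pow, ← hφ']
    rfl
  refine M.algebraMap_mem_span hH ρ hπ hfix (x := π x) (y := π y) ?_ ?_ (fun a => ⟨g a, hx a⟩)
    (map_mem_of_frobenius_factor hφ' hP.memL) (map_mem_of_frobenius_factor hφ' hP.memR) ?_ b hb
  · intro b hb q hq
    exact hg.nz (φ b) (fun a ha => (mul_eq_zero.1 ha).resolve_left fun h => hb (hφ0 b h)) q hq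
  · exact fun b hb => (hg.mem_iff _).2 (map_mem_of_frobenius_factor hφ hb)
  · rw [hx, hx]
    have := (hg.regPair _ _ hP.toRegPair).pow p p
    exact this

end Quotients

end

end RDPWitt

theorem proposition4p9 {p : ℕ} [Fact p.Prime]
    {k : Type*} [Field k] [IsAlgClosed k] [CharP k p]
    {H : Type*} [CommRing H] [HopfAlgebra k H]
    {A : Type*} [CommRing A] [IsLocalRing A] [Algebra k A]
    {B : Type*} [CommRing B] [IsLocalRing B] [Algebra k B]
    (S : Dynkin) (n : ℕ) (hn : 1 ≤ n)
    (hcase :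
      (IsMuP k p H ∧ S = Dynkin.A (p - 1) ∧ n = 1) ∨
      (p = 2 ∧ IsAlphaP k p H ∧ S = Dynkin.D (2 ^ n) ∧ 2 ≤ n) ∨
      (p = 2 ∧ IsAlphaP k p H ∧ S = Dynkin.E8 ∧ n = 4) ∨
      (p = 3 ∧ IsAlphaP k p H ∧ S = Dynkin.E6 ∧ n = 2) ∨
      (p = 5 ∧ IsAlphaP k p H ∧ S = Dynkin.E8 ∧ n = 2))
    (hA : IsRDPZero k p S A) (hB : IsSmoothPoint k B)
    (ρ : GroupSchemeAction k H B) (π : A →ₐ[k] B) (hπ : ρ.IsQuotient π)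
    (hfix : ρ.fixedLocus = {IsLocalRing.closedPoint B})
    (x y : A) (hxy : RingTheory.Sequence.IsRegular A [x, y]) :
    ∃ e ∈ cohTorsion p n x y (IsLocalRing.maximalIdeal A),
      IsTorsionGenerator p x y (IsLocalRing.maximalIdeal A) (cohR hn x y e) ∧
      ∃ e' : LocalH2 p 1 (π x) (π y),
        IsTorsionGenerator p (π x) (π y) (IsLocalRing.maximalIdeal B) e' ∧
        cohPullback p n (π : A →+* B) x y e = cohV hn (π x) (π y) e' := by
  obtain ⟨hnoeth, ⟨E⟩⟩ := hA
  have e := E.symm.toRingEquiv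
  rcases hcase with ⟨hH, rfl, rfl⟩ | ⟨rfl, hH, rfl, h2⟩ | ⟨rfl, hH, rfl, rfl⟩ |
    ⟨rfl, hH, rfl, rfl⟩ | ⟨rfl, hH, rfl, rfl⟩
  · exact exists_class_of_hasWitness hn (hasWitness_A e) (.inl hH) hB ρ π hπ hfix x y hxy
  · exact exists_class_of_hasWitness hn (hasWitness_D h2 e) (.inr hH) hB ρ π hπ hfix x y hxy
  · exact exists_class_of_hasWitness hn (hasWitness_E8_two e) (.inr hH) hB ρ π hπ hfix x y hxy
  · exact exists_class_of_hasWitness hn (hasWitness_E6 e) (.inr hH) hB ρ π hπ hfix x y hxy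
  · exact exists_class_of_hasWitness hn (hasWitness_E8_five e) (.inr hH) hB ρ π hπ hfix x y hxy
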